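/- **Setting.** Let $0<k<n$ be integers, write $\mathbb R^n=\mathbb R^k\times\mathbb R^{n-k}$, let $T$ be the orthogonal projection of $\mathbb R^n$ onto $\mathbb R^k\times\{0\}$, $B^k_r=\{x\in\mathbb R^k:|x|<r\}$, and $C(T,r)=\{x\in\mathbb R^n:|T(x)|<r\}$. The Grassmannian $G(n,k)$ consists of the orthogonal projections $S$ of $\mathbb R^n$ onto $k$-dimensional subspaces; $S^\perp=I-S$. For matrices, $A\cdot B=\operatorname{trace}(A^{*}B)$ and $|A|=\sqrt{A\cdot A}$. A $k$-varifold $V$ in an open set $U\subset\mathbb R^n$ is a Radon measure on $U\times G(n,k)$, $\|V\|$ is its projection to $U$, and $\delta V(X)=\int\nabla X(x)\cdot S\,dV(x,S)$ for $X\in C^1_c(U;\mathbb R^n)$. For an $\mathcal H^k$-measurable, countably $k$-rectifiable set $M\subset U$ of locally finite $\mathcal H^k$-measure, $|M|$ is the varifold $\phi\mapsto\int_M\phi(x,\operatorname{Tan}_xM)\,d\mathcal H^k(x)$, with $\operatorname{Tan}_xM$ the approximate tangent space; such varifolds are called unit density, and those of the form $\phi\mapsto\int_M\phi(x,\operatorname{Tan}_xM)\,\theta(x)\,d\mathcal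 H^k(x)$ with $\theta$ positive integer valued are called integral. For $u\in L^2(\|V\|)$ and $\phi\in C^1_c(U;[0,\infty))$ put $$\mathcal B(V,u,\phi)=\int(-\phi(x) h(x)+\nabla\phi(x))\cdot(h(x)+S^\perp u(x))\,dV(x,S)$$ if $V$ is integral and has a generalized mean curvature $h\in L^2(\|V\|)$, i.e. $\delta V(X)=-\int X\cdot h\,d\|V\|$ for all $X\in C^1_c(U;\mathbb R^n)$; otherwise $\mathcal B(V,u,\phi)=-\infty$. Families $\{V_t\}_{-1<t<1}$ of $k$-varifolds in $U$ and $\{u(\cdot,t)\}_{-1<t<1}$ of vector fields $U\to\mathbb R^n$, with $u(\cdot,t)\in L^2(\|V_t\|)$ for a.e. $t$, satisfy (B1) and (B4) on $U\times(-1,1)$ if * (B1) $V_t$ is a unit density varifold for a.e. $t\in(-1,1)$; * (B4) for every $\phi\in C^1(U\times(-1,1);[0,\infty))$ such that for each $[a,b]\subset(-1,1)$ the functions $\phi(\cdot,t)$, $t\in[a,b]$, are supported in one compact subset of $U$, and all $-1<t_1<t_2<1$, $$\int\phi(\cdot,t_2)\,d\|V_{t_2}\|-\int\phi(\cdot,t_1)\,d\|V_{t_1}\|\le\int_{t_1}^{t_2}\mathcal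 B(V_t,u(\cdot,t),\phi(\cdot,t))\,dt+\int_{t_1}^{t_2}\int_U\frac{\partial\phi}{\partial t}(\cdot,t)\,d\|V_t\|\,dt .$$ Let $\mathcal F$ be the set of maps $g=(g_{k+1},\dots,g_n):\mathbb R^k\times\mathbb R\to\mathbb R^{n-k}$ with $g_l(x,t)=a_l+b_lt+\sum_{i}a_{li}x_i+\frac12\sum_{i,j}a_{lij}x_ix_j$ for real coefficients with $a_{lij}=a_{lji}$ and $b_l=\sum_i a_{lii}$. For $g\in\mathcal F$ let $Q_g(x,t)=\frac12\sum_{l=k+1}^n\big(x_l-g_l(T(x),t)\big)^2$ for $x\in\mathbb R^n$. $\nabla$ denotes the spatial gradient. **Proposition.** There is a constant $c_2<\infty$ depending only on $n$ and $k$ with the following property. Let $f:B_1^k\times(-1,1)\to\mathbb R^{n-k}$ be differentiable in $x$ with $\nabla f$ continuous on $B_1^k\times(-1,1)$, and let $V_t=|M_t|$ with $M_t=\operatorname{graph}f(\cdot,t)$ for $-1<t<1$. Suppose that $\{V_t\}_{-1<t<1}$ and $\{u(\cdot,t)\}_{-1<t<1}$ satisfy (B1) and (B4) on $C(T,1)\times(-1,1)$,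 and let $g\in\mathcal F$. Assume $$\|\nabla f\|_0:=\sup_{B_1^k\times(-1,1)}|\nabla f|\le1,\qquad \|\nabla g\|_0:=\sup_{B_1^k\times(-1,1)}|\nabla g|\le1,\qquad \|u\|_0:=\sup_{C(T,1)\times(-1,1)}|u|\le1 .$$ Then, with $\|\nabla^2g\|_0:=\sup_{B_1^k\times(-1,1)}|\nabla^2g|$, $$\sup_{B_{1/2}^k\times(-3/4,1)}|f-g|^2+\int_{-3/4}^1\int_{B_{1/2}^k}|\nabla f-\nabla g|^2\,d\mathcal H^k\,dt\le c_2\Big(\int_{-1}^1\int_{C(T,1)}Q_g\,d\|V_t\|\,dt+\|u\|_0^2+\|\nabla f\|_0^4\,\|\nabla^2g\|_0^2\Big).$$ -/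

import Mathlib

open Set Filter Topology MeasureTheory
open scoped ENNReal RealInnerProductSpace

noncomputable section

namespace BrakkeFlow

/-! ## Varifolds in a finite-dimensional Euclidean space `E` -/

section Varifolds

variable {E : Type*} [NormedAddCommGroup E] [InnerProductSpace ℝ E] [FiniteDimensional ℝ E]
  [MeasurableSpace E] [BorelSpace E]

/-- The Grassmannian of `k`-dimensional subspaces of `E`; a subspace is identified with the
orthogonal projection onto it. It carries the subspace topology (and its Borel sets). -/
abbrev Grass (E : Type*) [NormedAddCommGroup E] [InnerProductSpace ℝ E] (k : ℕ) : Type _ :=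
  {S : E →L[ℝ] E // (S : E →ₗ[ℝ] E).IsSymmetricProjection ∧
    Module.finrank ℝ (LinearMap.range (S : E →ₗ[ℝ] E)) = k}

/-- The plane, as a subset of `E`, that belongs to a point of the Grassmannian. -/
def Grass.plane {k : ℕ} (S : Grass E k) : Set E := Set.range S.1

/-- The scalar product `A · B = trace (A* ∘ B)` on `Hom (E, E)`. -/
def hsInner (A B : E →L[ℝ] E) : ℝ :=
  LinearMap.trace ℝ E (LinearMap.adjoint (A : E →ₗ[ℝ] E) ∘ₗ (B : E →ₗ[ℝ] E))

/-- A general `k`-varifold in `U`: a Radon measure on `U × G(n,k)`, written as a measure on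
`E × G(n,k)` that is carried by `U × G(n,k)` and finite on `K × G(n,k)` for compact `K ⊆ U`
(the Grassmannian itself is compact). -/
structure Varifold (E : Type*) [NormedAddCommGroup E] [InnerProductSpace ℝ E]
    [MeasurableSpace E] (k : ℕ) (U : Set E) where
  /-- the underlying measure -/
  measure : Measure (E × Grass E k)
  carried : measure (Uᶜ ×ˢ univ) = 0
  finite_on_compacts : ∀ K : Set E, IsCompact K → K ⊆ U → measure (K ×ˢ univ) < ∞

/-- The mass measure `‖V‖`. -/
def Varifold.mass {k : ℕ} {U : Set E} (V : Varifold E k U) : Measure E :=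
  V.measure.map Prod.fst

/-- `M` is countably `k`-rectifiable: `ℋᵏ`-almost all of `M` is covered by countably many Lipschitz
images of `ℝᵏ`. -/
def CountablyRectifiable (k : ℕ) (M : Set E) : Prop :=
  ∃ F : ℕ → EuclideanSpace ℝ (Fin k) → E, (∀ j, ∃ L, LipschitzWith L (F j)) ∧
    μHE[k] (M \ ⋃ j, Set.range (F j)) = 0

/-- `S` is the approximate tangent space of `M` at `x`: the blow-ups of `ℋᵏ⌊M` at `x` converge
weakly to `ℋᵏ⌊S`. -/
def IsApproxTangent {k : ℕ} (M : Set E) (x : E) (S : Grass E k) : Prop :=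
  ∀ ψ : E → ℝ, Continuous ψ → HasCompactSupport ψ →
    Tendsto (fun r : ℝ => (r ^ k)⁻¹ * ∫ y in M, ψ (r⁻¹ • (y - x)) ∂μHE[k]) (𝓝[>] 0)
      (𝓝 (∫ y in S.plane, ψ y ∂μHE[k]))

/-- `V(ψ) = ∫_M ψ(x, Tan_x M) θ(x) dℋᵏ(x)`, where `M ⊆ U` is an `ℋᵏ`-measurable, countably
`k`-rectifiable set of locally finite `ℋᵏ`-measure in `U`, and `θ` is a positive integer-valued
function on `M`. Here `τ` is (a measurable version of) `x ↦ Tan_x M`. -/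
def Varifold.IsCarriedBy {k : ℕ} {U : Set E} (V : Varifold E k U) (M : Set E) (θ : E → ℕ) :
    Prop :=
  M ⊆ U ∧ NullMeasurableSet M μHE[k] ∧ CountablyRectifiable k M ∧
  (∀ K : Set E, IsCompact K → K ⊆ U → μHE[k] (M ∩ K) < ∞) ∧
  AEMeasurable θ (μHE[k].restrict M) ∧ (∀ x ∈ M, 1 ≤ θ x) ∧
  ∃ τ : E → Grass E k, AEMeasurable τ (μHE[k].restrict M) ∧
    (∀ᵐ x ∂μHE[k].restrict M, IsApproxTangent M x (τ x)) ∧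
    V.measure =
      ((μHE[k].restrict M).withDensity (fun x => (θ x : ℝ≥0∞))).map (fun x => (x, τ x))

/-- `V` is the natural varifold `|M|` of the rectifiable set `M`. -/
def Varifold.IsNaturalVarifold {k : ℕ} {U : Set E} (V : Varifold E k U) (M : Set E) : Prop :=
  V.IsCarriedBy M (fun _ => 1)

/-- Integral varifolds. -/
def Varifold.IsIntegral {k : ℕ} {U : Set E} (V : Varifold E k U) : Prop :=
  ∃ (M : Set E) (θ : E → ℕ), V.IsCarriedBy M θ

/-- Unit density varifolds. -/
def Varifold.IsUnitDensity {k : ℕ} {U : Set E} (V : Varifold E k U) : Prop :=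
  ∃ M : Set E, V.IsNaturalVarifold M

/-- The first variation `δV(X) = ∫ ∇X(x) · S dV(x,S)`. -/
def Varifold.firstVariation {k : ℕ} {U : Set E} (V : Varifold E k U) (X : E → E) : ℝ :=
  ∫ p, hsInner (fderiv ℝ X p.1) p.2.1 ∂V.measure

/-- `h` is a generalized mean curvature vector of `V` that lies in `L²(‖V‖)`. By the Riesz
representation theorem such an `h` exists exactly if `‖δV‖` is locally finite and absolutely
continuous with respect to `‖V‖` with density in `L²(‖V‖)`; it is then unique up to
`‖V‖`-null sets. -/
def Varifold.IsL2MeanCurvature {k : ℕ} {U : Set E} (V : Varifold E k U) (h : E → E) : Prop :=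
  MemLp h 2 V.mass ∧
  ∀ X : E → E, ContDiff ℝ 1 X → HasCompactSupport X → tsupport X ⊆ U →
    V.firstVariation X = - ∫ x, ⟪X x, h x⟫ ∂V.mass

open Classical in
/-- `𝓑(V,u,φ) = ∫ (-φ h + ∇φ) · (h + u^⊥) d‖V‖` if `V` is integral with generalized mean curvature
`h ∈ L²(‖V‖)`, and `-∞` otherwise; `u^⊥` stands for `S^⊥(u(x)) = u(x) - S(u(x))`, integrated against
`V(x,S)`. The value does not depend on the choice of `h`. -/
def Varifold.brakke {k : ℕ} {U : Set E} (V : Varifold E k U) (u : E → E) (φ : E → ℝ) : EReal :=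
  if H : V.IsIntegral ∧ ∃ h : E → E, V.IsL2MeanCurvature h then
    ((∫ p, ⟪-(φ p.1) • H.2.choose p.1 + gradient φ p.1,
        H.2.choose p.1 + (u p.1 - p.2.1 (u p.1))⟫ ∂V.measure : ℝ) : EReal)
  else ⊥

/-- The integral `∫ F⁺ - ∫ F⁻` of an extended-real-valued function over `(a, b)`. It is `-∞` if
`∫ F⁻ = ∞`. -/
def extIntegral (a b : ℝ) (F : ℝ → EReal) : EReal :=
  ((∫⁻ t in Ioo a b, (F t).toENNReal : ℝ≥0∞) : EReal) -
    ((∫⁻ t in Ioo a b, (-F t).toENNReal : ℝ≥0∞) : EReal)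

/-- Admissible test functions: `φ ∈ C¹(U × I; ℝ⁺)` such that the functions `φ(·,t)`, for `t` in a
compact subinterval of `I`, are supported in one compact subset of `U` (and are extended by zero
outside `U`). -/
structure IsTestFunction (U : Set E) (I : Set ℝ) (φ : E → ℝ → ℝ) : Prop where
  contDiffOn : ContDiffOn ℝ 1 (fun p : E × ℝ => φ p.1 p.2) (U ×ˢ I)
  nonneg : ∀ x ∈ U, ∀ t ∈ I, 0 ≤ φ x t
  compact_support : ∀ a b : ℝ, Icc a b ⊆ I →
    ∃ K : Set E, IsCompact K ∧ K ⊆ U ∧ ∀ t ∈ Icc a b, ∀ x ∉ K, φ x t = 0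

/-- (B1): for almost every time `V_t` is a unit density varifold. -/
def SatisfiesB1 {k : ℕ} {U : Set E} (I : Set ℝ) (V : ℝ → Varifold E k U) : Prop :=
  ∀ᵐ t ∂volume.restrict I, (V t).IsUnitDensity

/-- (B4): the integral form of `velocity = mean curvature + u^⊥`. The first clause is what makes
`𝓑(V_t, u(·,t), ·)` meaningful. -/
def SatisfiesB4 {k : ℕ} {U : Set E} (I : Set ℝ) (V : ℝ → Varifold E k U) (u : E → ℝ → E) :
    Prop :=
  (∀ᵐ t ∂volume.restrict I, MemLp (fun x => u x t) 2 (V t).mass) ∧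
  ∀ φ : E → ℝ → ℝ, IsTestFunction U I φ → ∀ t₁ ∈ I, ∀ t₂ ∈ I, t₁ < t₂ →
    (((∫ x, φ x t₂ ∂(V t₂).mass) - ∫ x, φ x t₁ ∂(V t₁).mass : ℝ) : EReal) ≤
      extIntegral t₁ t₂ (fun t => (V t).brakke (fun x => u x t) (fun x => φ x t)) +
        ((∫ t in Ioo t₁ t₂, ∫ x, deriv (fun s => φ x s) t ∂(V t).mass : ℝ) : EReal)

end Varifolds

/-! ## Graphs over `ℝᵏ` in `ℝⁿ = ℝᵏ × ℝᵐ`, `m = n - k` -/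

section Graphs

variable {k m : ℕ}

/-- `ℝⁿ = ℝᵏ × ℝᵐ` with its Euclidean norm. -/
abbrev Ambient (k m : ℕ) : Type := EuclideanSpace ℝ (Fin k ⊕ Fin m)

/-- The first `k` coordinates. -/
def base (z : Ambient k m) : EuclideanSpace ℝ (Fin k) := WithLp.toLp 2 fun i => z (Sum.inl i)

/-- The last `m` coordinates. -/
def height (z : Ambient k m) : EuclideanSpace ℝ (Fin m) := WithLp.toLp 2 fun l => z (Sum.inr l)

/-- The cylinder `C(T,r)` around `T = ℝᵏ × {0}`. -/
def cylinder (k m : ℕ) (r : ℝ) : Set (Ambient k m) := {z | ‖base z‖ < r}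

/-- The graph over `B₁ᵏ` of a map `w`. -/
def graphOverBall (w : EuclideanSpace ℝ (Fin k) → EuclideanSpace ℝ (Fin m)) : Set (Ambient k m) :=
  {z | ‖base z‖ < 1 ∧ height z = w (base z)}

/-- The class `𝓕`: each component is `a_l + b_l t + ∑ a_{li} x_i + ½ ∑ a_{lij} x_i x_j` with
`a_{lij} = a_{lji}` and `b_l = ∑ a_{lii}`. -/
def CaloricQuadratic (g : EuclideanSpace ℝ (Fin k) → ℝ → EuclideanSpace ℝ (Fin m)) : Prop :=
  ∃ (a b : Fin m → ℝ) (p : Fin m → Fin k → ℝ) (A : Fin m → Fin k → Fin k → ℝ),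
    (∀ l i j, A l i j = A l j i) ∧ (∀ l, b l = ∑ i, A l i i) ∧
    ∀ x t l, g x t l =
      a l + b l * t + ∑ i, p l i * x i + (1 / 2) * ∑ i, ∑ j, A l i j * x i * x j

/-- `Q_g(z,t) = ½ ∑_l (z_l - g_l(z,t))²`. -/
def qDist (g : EuclideanSpace ℝ (Fin k) → ℝ → EuclideanSpace ℝ (Fin m)) (z : Ambient k m) (t : ℝ) :
    ℝ :=
  (1 / 2) * ∑ l, (height z l - g (base z) t l) ^ 2

/-- The norm `|A| = (∑ A_{li}²)^{1/2}` of a matrix, such as `∇f`. -/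
def gradNorm (A : EuclideanSpace ℝ (Fin k) →L[ℝ] EuclideanSpace ℝ (Fin m)) : ℝ :=
  √(∑ l, ∑ i, (A (EuclideanSpace.single i 1) l) ^ 2)

/-- `|∇²w(x)| = (∑ (∂_i ∂_j w_l(x))²)^{1/2}`. -/
def hessNorm (w : EuclideanSpace ℝ (Fin k) → EuclideanSpace ℝ (Fin m))
    (x : EuclideanSpace ℝ (Fin k)) : ℝ :=
  √(∑ l, ∑ i, ∑ j, (iteratedFDeriv ℝ 2 w x
    ![EuclideanSpace.single i 1, EuclideanSpace.single j 1] l) ^ 2)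

/-- The supremum (in `[0,∞]`) of a nonnegative function over `A × (a,b)`. -/
def supNorm {X : Type*} (A : Set X) (a b : ℝ) (F : X → ℝ → ℝ) : ℝ≥0∞ :=
  ⨆ x ∈ A, ⨆ t ∈ Ioo a b, ENNReal.ofReal (F x t)

end Graphs

end BrakkeFlow

end

/-!
A varifold that moves by Brakke's inequality (B4) and consists of graphs of small slope satisfies,
when tested with functions of the squared distance `Q_g` to a caloric quadratic `g`, the same
estimates as a subsolution of the heat equation.

Three facts produce the differential inequality. Completing the square in the mean curvature `h`, and
replacing `∫ ∇φ · h` by the first variation `-δV(∇φ)`, bounds Brakke's functional from above by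
`∫ φ |S^⊥ u|² / 4 + ∇φ · S^⊥ u - ∇²φ · S`, in which `h` does not occur (`Varifold.brakke_le`). The
approximate tangent planes of a `C¹` graph are almost everywhere the graphs of `∇f`
(`Varifold.IsNaturalVarifold.ae_tangent`). On such a plane `S` the trace of a quadratic form in the
horizontal variables differs from its full trace by a term quadratic in `∇f`
(`IsGraphPlane.abs_trace_defect_le`); as `∂_t g = Δg`, the operator `∂_t - ∇² · S` applied to `Q_g`
gives a negative multiple of `|∇f - ∇g|²` and an error of size `√Q_g |∇f|² |∇²g|`.

The test function is `(t - τ)₊² χ (r² - |x|²)₊⁴ (Q_g + ε)^p` with `p ≥ 1` and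
`ε ≥ ‖u‖² + ‖∇f‖⁴ ‖∇²g‖²`; with this `ε`, all error terms are absorbed by `(Q_g + ε)^p`
(`IsCaloric.pointwise_le`). The cut-off `χ` in the vertical directions makes the support compact. It
equals `1` near the graphs, whose heights are bounded because a graph that jumped in time would make a
test function gain mass too quickly (`IsGraphFlow.exists_height_bound`). The result is the local energy
inequality `IsGraphFlow.energy_real`: it bounds the integral of `(Q_g + ε)^p` at a single time, and
the integral over space and time of `(Q_g + ε)^(p-1) |∇f - ∇g|²`, by that of `(Q_g + ε)^p` on a larger
domain. All integrals in time make sense because the mass measures depend measurably on time, again a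
consequence of (B4) (`IsGraphFlow.measurable_flowMeasure`).

Together with a Sobolev inequality on the base (`lintegral_rpow_le_mul_lintegral`) the two energy
bounds raise the exponent `p` by the factor `1 + 1 / (k + 1)` (`IsGraphFlow.powInt_step`), and
Moser's iteration gives the mean value inequality for `|f - g|²` (`IsGraphFlow.mean_value`). The energy
inequality with `p = 1` bounds the integral of `|∇f - ∇g|²` (`IsGraphFlow.lintegral_gradDiffSq_le`).
Finally `ε` tends to `‖u‖² + ‖∇f‖⁴ ‖∇²g‖²`.
-/

open Set Filter Topology MeasureTheory
open scoped ENNReal RealInnerProductSpace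

noncomputable section

namespace BrakkeFlow

variable {k m : ℕ}

/-! ### Base and height coordinates; integrals over graphs -/

/-- The point `(x, y)` of `ℝᵏ × ℝᵐ`. -/
def joinPt (x : EuclideanSpace ℝ (Fin k)) (y : EuclideanSpace ℝ (Fin m)) : Ambient k m :=
  WithLp.toLp 2 (Sum.elim x y)

@[simp] lemma base_joinPt (x : EuclideanSpace ℝ (Fin k)) (y : EuclideanSpace ℝ (Fin m)) :
    base (joinPt x y) = x := by
  ext i; simp [base, joinPt]

@[simp] lemma height_joinPt (x : EuclideanSpace ℝ (Fin k)) (y : EuclideanSpace ℝ (Fin m)) :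
    height (joinPt x y) = y := by
  ext i; simp [height, joinPt]

@[simp] lemma joinPt_base_height (z : Ambient k m) : joinPt (base z) (height z) = z := by
  ext i; cases i <;> simp [base, height, joinPt]

/-- `base` as a continuous linear map. -/
def baseL (k m : ℕ) : Ambient k m →L[ℝ] EuclideanSpace ℝ (Fin k) :=
  LinearMap.toContinuousLinearMap
    { toFun := base
      map_add' := fun x y => by ext i; simp [base]
      map_smul' := fun c x => by ext i; simp [base] }

/-- `height` as a continuous linear map. -/
def heightL (k m : ℕ) : Ambient k m →L[ℝ] EuclideanSpace ℝ (Fin m) :=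
  LinearMap.toContinuousLinearMap
    { toFun := height
      map_add' := fun x y => by ext i; simp [height]
      map_smul' := fun c x => by ext i; simp [height] }

@[simp] lemma baseL_apply (z : Ambient k m) : baseL k m z = base z := rfl
@[simp] lemma heightL_apply (z : Ambient k m) : heightL k m z = height z := rfl

lemma base_add (y z : Ambient k m) : base (y + z) = base y + base z := (baseL k m).map_add y z
lemma base_sub (y z : Ambient k m) : base (y - z) = base y - base z := (baseL k m).map_sub y z
lemma base_smul (c : ℝ) (z : Ambient k m) : base (c • z) = c • base z := (baseL k m).map_smul c z
lemma height_add (y z : Ambient k m) : height (y + z) = height y + height z :=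
  (heightL k m).map_add y z
lemma height_sub (y z : Ambient k m) : height (y - z) = height y - height z :=
  (heightL k m).map_sub y z
lemma height_smul (c : ℝ) (z : Ambient k m) : height (c • z) = c • height z :=
  (heightL k m).map_smul c z

@[fun_prop] lemma continuous_base : Continuous (base : Ambient k m → _) := (baseL k m).continuous
@[fun_prop] lemma continuous_height : Continuous (height : Ambient k m → _) :=
  (heightL k m).continuous
@[fun_prop] lemma measurable_base : Measurable (base : Ambient k m → _) :=
  continuous_base.measurable

lemma joinPt_ext {y z : Ambient k m} (h₁ : base y = base z) (h₂ : height y = height z) : y = z := by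
  rw [← joinPt_base_height y, ← joinPt_base_height z, h₁, h₂]

lemma inner_eq_base_add_height (y z : Ambient k m) :
    ⟪y, z⟫ = ⟪base y, base z⟫ + ⟪height y, height z⟫ := by
  simp [PiLp.inner_apply, base, height, Fintype.sum_sum_type]

lemma norm_sq_eq_base_add_height (z : Ambient k m) : ‖z‖ ^ 2 = ‖base z‖ ^ 2 + ‖height z‖ ^ 2 := by
  rw [← real_inner_self_eq_norm_sq, inner_eq_base_add_height, real_inner_self_eq_norm_sq,
    real_inner_self_eq_norm_sq]

lemma norm_base_le (z : Ambient k m) : ‖base z‖ ≤ ‖z‖ := by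
  have := norm_sq_eq_base_add_height z
  exact le_of_sq_le_sq (by nlinarith [sq_nonneg ‖height z‖]) (norm_nonneg _)

lemma norm_height_le (z : Ambient k m) : ‖height z‖ ≤ ‖z‖ := by
  have := norm_sq_eq_base_add_height z
  exact le_of_sq_le_sq (by nlinarith [sq_nonneg ‖base z‖]) (norm_nonneg _)

lemma gradNorm_sq (A : EuclideanSpace ℝ (Fin k) →L[ℝ] EuclideanSpace ℝ (Fin m)) :
    gradNorm A ^ 2 = ∑ l, ∑ i, (A (EuclideanSpace.single i 1) l) ^ 2 :=
  Real.sq_sqrt (by positivity)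

lemma gradNorm_nonneg (A : EuclideanSpace ℝ (Fin k) →L[ℝ] EuclideanSpace ℝ (Fin m)) :
    0 ≤ gradNorm A := Real.sqrt_nonneg _

lemma clm_apply_eq_sum (A : EuclideanSpace ℝ (Fin k) →L[ℝ] EuclideanSpace ℝ (Fin m))
    (v : EuclideanSpace ℝ (Fin k)) (l : Fin m) :
    A v l = ∑ i, A (EuclideanSpace.single i 1) l * v i := by
  conv_lhs => rw [← (EuclideanSpace.basisFun (Fin k) ℝ).sum_repr v]
  simp [map_sum, mul_comm]

lemma norm_apply_le_gradNorm (A : EuclideanSpace ℝ (Fin k) →L[ℝ] EuclideanSpace ℝ (Fin m))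
    (v : EuclideanSpace ℝ (Fin k)) : ‖A v‖ ≤ gradNorm A * ‖v‖ := by
  refine le_of_sq_le_sq ?_ (mul_nonneg (gradNorm_nonneg A) (norm_nonneg v))
  rw [mul_pow, gradNorm_sq, EuclideanSpace.norm_sq_eq, Finset.sum_mul]
  refine Finset.sum_le_sum fun l _ => ?_
  rw [Real.norm_eq_abs, sq_abs, clm_apply_eq_sum, EuclideanSpace.norm_sq_eq]
  simp only [Real.norm_eq_abs, sq_abs]
  exact Finset.sum_mul_sq_le_sq_mul_sq _ _ _

lemma opNorm_le_gradNorm (A : EuclideanSpace ℝ (Fin k) →L[ℝ] EuclideanSpace ℝ (Fin m)) :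
    ‖A‖ ≤ gradNorm A :=
  A.opNorm_le_bound (gradNorm_nonneg A) (norm_apply_le_gradNorm A)

lemma continuous_gradNorm :
    Continuous (gradNorm : (EuclideanSpace ℝ (Fin k) →L[ℝ] EuclideanSpace ℝ (Fin m)) → ℝ) := by
  unfold gradNorm
  fun_prop

/-- The graph map `x ↦ (x, w x)`. -/
def graphMap (w : EuclideanSpace ℝ (Fin k) → EuclideanSpace ℝ (Fin m)) :
    EuclideanSpace ℝ (Fin k) → Ambient k m := fun x => joinPt x (w x)

lemma lipschitzOnWith_of_gradNorm_le {w : EuclideanSpace ℝ (Fin k) → EuclideanSpace ℝ (Fin m)}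
    (hd : DifferentiableOn ℝ w (Metric.ball 0 1))
    (hg : ∀ x ∈ Metric.ball (0 : EuclideanSpace ℝ (Fin k)) 1, gradNorm (fderiv ℝ w x) ≤ 1) :
    LipschitzOnWith 1 w (Metric.ball 0 1) := by
  refine (convex_ball _ _).lipschitzOnWith_of_nnnorm_fderiv_le (𝕜 := ℝ)
    (fun x hx => (hd x hx).differentiableAt (Metric.isOpen_ball.mem_nhds hx)) (fun x hx => ?_)
  exact_mod_cast (opNorm_le_gradNorm _).trans (hg x hx)

lemma LipschitzOnWith.graphMap {w : EuclideanSpace ℝ (Fin k) → EuclideanSpace ℝ (Fin m)}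
    {s : Set (EuclideanSpace ℝ (Fin k))}
    (hw : LipschitzOnWith 1 w s) : LipschitzOnWith 2 (BrakkeFlow.graphMap w) s := by
  refine LipschitzOnWith.of_dist_le_mul fun x hx y hy => ?_
  have h1 := hw.dist_le_mul x hx y hy
  rw [dist_eq_norm, dist_eq_norm] at *
  have h2 := norm_sq_eq_base_add_height (BrakkeFlow.graphMap w x - BrakkeFlow.graphMap w y)
  simp only [base_sub, height_sub, BrakkeFlow.graphMap, base_joinPt, height_joinPt] at h2 ⊢
  simp only [NNReal.coe_one, one_mul, NNReal.coe_ofNat] at h1 ⊢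
  have := norm_nonneg (w x - w y)
  refine le_of_sq_le_sq ?_ (by positivity)
  nlinarith [norm_nonneg (x - y)]

lemma graphOverBall_eq_image (w : EuclideanSpace ℝ (Fin k) → EuclideanSpace ℝ (Fin m)) :
    graphOverBall w = graphMap w '' Metric.ball 0 1 := by
  ext z
  constructor
  · rintro ⟨h1, h2⟩
    exact ⟨base z, by simpa using h1, by rw [graphMap, ← h2, joinPt_base_height]⟩
  · rintro ⟨x, hx, rfl⟩
    exact ⟨by simpa [graphMap] using hx, by simp [graphMap]⟩

lemma measurableSet_graphOverBall {w : EuclideanSpace ℝ (Fin k) → EuclideanSpace ℝ (Fin m)}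
    (hw : ContinuousOn w (Metric.ball 0 1)) : MeasurableSet (graphOverBall w) := by
  have hO : IsOpen {z : Ambient k m | ‖base z‖ < 1} :=
    isOpen_lt (by fun_prop) continuous_const
  have hc : ContinuousOn (fun z : Ambient k m => height z - w (base z)) {z | ‖base z‖ < 1} :=
    continuous_height.continuousOn.sub
      (hw.comp continuous_base.continuousOn fun z hz => by simpa using hz)
  have := hc.isOpen_inter_preimage hO (isOpen_compl_singleton (x := 0))
  convert hO.measurableSet.diff this.measurableSet using 1
  ext z
  simp only [graphOverBall, mem_ofPred_eq, Set.mem_sdiff, mem_inter_iff, mem_preimage,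
    mem_compl_iff, mem_singleton_iff, not_and, not_not, sub_eq_zero]
  tauto

lemma euclideanHausdorffMeasure_image_le {E F : Type*} [MetricSpace E] [MeasurableSpace E]
    [BorelSpace E] [MetricSpace F] [MeasurableSpace F] [BorelSpace F] {K : NNReal} {g : E → F}
    {s : Set E} (h : LipschitzOnWith K g s) (d : ℕ) :
    μHE[d] (g '' s) ≤ (K : ℝ≥0∞) ^ d * μHE[d] s := by
  simp only [Measure.euclideanHausdorffMeasure_def, Measure.smul_apply]
  have := h.hausdorffMeasure_image_le (d := d) (by positivity)
  rw [ENNReal.rpow_natCast] at this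
  calc _ ≤ _ := by
        simp only [ENNReal.smul_def, smul_eq_mul]
        exact mul_le_mul_right this _
    _ = _ := by simp only [ENNReal.smul_def, smul_eq_mul]; ring

/-- The projection onto `ℝᵏ` does not increase Hausdorff measure, so the measure of a graph
dominates Lebesgue measure on the base. -/
lemma lintegral_ball_le_graph (w : EuclideanSpace ℝ (Fin k) → EuclideanSpace ℝ (Fin m))
    (F : EuclideanSpace ℝ (Fin k) → ℝ≥0∞) :
    ∫⁻ x in Metric.ball 0 1, F x ≤ ∫⁻ z in graphOverBall w, F (base z) ∂μHE[k] := by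
  refine le_trans (lintegral_mono' ?_ le_rfl) (lintegral_map_le F base)
  refine Measure.le_iff.2 fun A hA => ?_
  rw [Measure.restrict_apply hA, Measure.map_apply measurable_base hA,
    Measure.restrict_apply (measurable_base hA)]
  have hL : LipschitzOnWith 1 (base : Ambient k m → _) (base ⁻¹' A ∩ graphOverBall w) := by
    refine LipschitzOnWith.of_dist_le_mul fun x _ y _ => ?_
    rw [dist_eq_norm, dist_eq_norm, ← base_sub]
    simpa using norm_base_le (x - y)
  have := euclideanHausdorffMeasure_image_le hL k
  simp only [ENNReal.coe_one, one_pow, one_mul] at this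
  refine le_trans ?_ this
  rw [EuclideanSpace.euclideanHausdorffMeasure_eq_volume]
  refine measure_mono ?_
  rintro x ⟨hxA, hx⟩
  exact ⟨graphMap w x, ⟨by simpa [graphMap] using hxA, by
    simpa [graphOverBall, graphMap] using hx⟩, by simp [graphMap]⟩

/-- The graph map of a `1`-Lipschitz function is `2`-Lipschitz, so the measure of a graph is at most
`2ᵏ` times Lebesgue measure on the base. -/
lemma lintegral_graph_le {w : EuclideanSpace ℝ (Fin k) → EuclideanSpace ℝ (Fin m)}
    (hw : LipschitzOnWith 1 w (Metric.ball 0 1)) (G : Ambient k m → ℝ≥0∞) :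
    ∫⁻ z in graphOverBall w, G z ∂μHE[k] ≤
      2 ^ k * ∫⁻ x in Metric.ball 0 1, G (joinPt x (w x)) := by
  have hgr := LipschitzOnWith.graphMap hw
  have hm : AEMeasurable (graphMap w) (volume.restrict (Metric.ball 0 1)) :=
    hgr.continuousOn.aemeasurable Metric.isOpen_ball.measurableSet
  have key : (μHE[k] : Measure (Ambient k m)).restrict (graphOverBall w) ≤
      (2 ^ k : ℝ≥0∞) • (volume.restrict (Metric.ball 0 1)).map (graphMap w) := by
    refine Measure.le_iff.2 fun A hA => ?_
    rw [Measure.restrict_apply hA, Measure.smul_apply, Measure.map_apply_of_aemeasurable hm hA,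
      Measure.restrict_apply' Metric.isOpen_ball.measurableSet]
    have := euclideanHausdorffMeasure_image_le
      (hgr.mono (inter_subset_right (s := graphMap w ⁻¹' A))) k
    rw [EuclideanSpace.euclideanHausdorffMeasure_eq_volume] at this
    refine le_trans (measure_mono ?_) this
    rw [graphOverBall_eq_image]
    rintro _ ⟨hz, x, hx, rfl⟩
    exact ⟨x, ⟨hz, hx⟩, rfl⟩
  calc _ ≤ _ := lintegral_mono' key le_rfl
    _ = _ := lintegral_smul_measure _ _
    _ ≤ _ := mul_le_mul_right (lintegral_map_le G _) _

/-- The mass of the natural varifold of `M` is `ℋᵏ` restricted to `M`. -/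
lemma Varifold.IsNaturalVarifold.mass_eq {E : Type*} [NormedAddCommGroup E] [InnerProductSpace ℝ E]
    [FiniteDimensional ℝ E] [MeasurableSpace E] [BorelSpace E] {k : ℕ} {U M : Set E}
    {V : Varifold E k U} (h : V.IsNaturalVarifold M) : V.mass = μHE[k].restrict M := by
  obtain ⟨-, -, -, -, -, -, τ, hτ, -, hV⟩ := h
  have h1 : (μHE[k].restrict M).withDensity (fun _ : E => ((1 : ℕ) : ℝ≥0∞)) = μHE[k].restrict M := by
    simp
  rw [h1] at hV
  rw [Varifold.mass, hV, AEMeasurable.map_map_of_aemeasurable measurable_fst.aemeasurable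
    (aemeasurable_id'.prodMk hτ)]
  exact Measure.map_id'

/-! ### Tangent planes of graphs -/

/-- A nonnegative bump centred at a point of a `k`-plane has positive `ℋᵏ`-integral over the
plane. -/
lemma Grass.integral_plane_pos {E : Type*} [NormedAddCommGroup E] [InnerProductSpace ℝ E]
    [FiniteDimensional ℝ E] [MeasurableSpace E] [BorelSpace E] (S : Grass E k) {ψ : E → ℝ}
    (hc : Continuous ψ) (hs : HasCompactSupport ψ) (h0 : ∀ y, 0 ≤ ψ y) {v : E} (hv : v ∈ S.plane)
    (hpos : ψ v ≠ 0) : 0 < ∫ y in S.plane, ψ y ∂μHE[k] := by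
  let P : Submodule ℝ E := LinearMap.range (S.1 : E →ₗ[ℝ] E)
  have hP : Module.finrank ℝ P = k := S.2.2
  let e : P ≃ₗᵢ[ℝ] EuclideanSpace ℝ (Fin k) :=
    ((stdOrthonormalBasis ℝ P).reindex (finCongr hP)).repr
  let ι : EuclideanSpace ℝ (Fin k) → E := fun x => (e.symm x : E)
  have hι : Isometry ι := P.subtypeₗᵢ.isometry.comp e.symm.isometry
  have hr : Set.range ι = S.plane := by
    ext y
    constructor
    · rintro ⟨x, rfl⟩
      exact (e.symm x).2
    · intro hy
      exact ⟨e ⟨y, hy⟩, by simp [ι]⟩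
  have hmap := Isometry.map_euclideanHausdorffMeasure (d := k) hι
  rw [hr, EuclideanSpace.euclideanHausdorffMeasure_eq_volume] at hmap
  rw [← hmap, hι.isClosedEmbedding.measurableEmbedding.integral_map]
  obtain ⟨x, hx⟩ := hr.symm ▸ hv
  exact (hc.comp hι.continuous).integral_pos_of_hasCompactSupport_nonneg_nonzero
    (hs.comp_isClosedEmbedding hι.isClosedEmbedding) (fun y => h0 _) (x := x) (by simpa [hx])

/-- An approximate tangent plane of the graph of a differentiable map lies in the graph of the
derivative: a direction off that graph has a neighbourhood which the blow-ups avoid. -/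
lemma IsApproxTangent.height_eq {w : EuclideanSpace ℝ (Fin k) → EuclideanSpace ℝ (Fin m)}
    {x₀ : EuclideanSpace ℝ (Fin k)} (hw : DifferentiableAt ℝ w x₀)
    {S : Grass (Ambient k m) k} (hS : IsApproxTangent (graphOverBall w) (graphMap w x₀) S)
    {v : Ambient k m} (hv : v ∈ S.plane) : height v = fderiv ℝ w x₀ (base v) := by
  by_contra hne
  set L := fderiv ℝ w x₀
  set δ := ‖height v - L (base v)‖
  have hδ : 0 < δ := norm_pos_iff.2 (sub_ne_zero.2 hne)
  have hcont : Continuous fun y : Ambient k m => ‖height y - L (base y)‖ := by fun_prop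
  obtain ⟨ρ, hρ, hball⟩ := Metric.eventually_nhds_iff.1
    ((hcont.tendsto v).eventually (lt_mem_nhds (show δ / 2 < δ by linarith)))
  let ψ : ContDiffBump v := ⟨ρ / 2, ρ, by positivity, by linarith⟩
  have hpos := S.integral_plane_pos ψ.continuous ψ.hasCompactSupport (fun y => ψ.nonneg) hv
    (by simp [ψ.one_of_mem_closedBall (Metric.mem_closedBall_self ψ.rIn_pos.le)])
  set R := ‖v‖ + ρ + 1
  have hR : 0 < R := by positivity
  have hlo := hw.hasFDerivAt.isLittleO.bound (show 0 < δ / (2 * R) by positivity)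
  obtain ⟨ε, hε, hlo⟩ := Metric.eventually_nhds_iff.1 hlo
  have hzero : ∀ᶠ r : ℝ in 𝓝[>] 0,
      (r ^ k)⁻¹ * ∫ y in graphOverBall w, ψ (r⁻¹ • (y - graphMap w x₀)) ∂μHE[k] = 0 := by
    have : ∀ᶠ r : ℝ in 𝓝[>] 0, r ∈ Ioo 0 (ε / R) := Ioo_mem_nhdsGT (by positivity)
    filter_upwards [this] with r hr
    rw [setIntegral_eq_zero_of_forall_eq_zero, mul_zero]
    rintro y ⟨hy1, hy2⟩
    by_contra hψ
    have hr0 : 0 < r := hr.1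
    set Y := r⁻¹ • (y - graphMap w x₀) with hY
    have hYv : dist Y v < ρ := by
      have : Y ∈ Function.support ψ := hψ
      rwa [ψ.support_eq] at this
    have h1 := hball hYv
    have hbY : base Y = r⁻¹ • (base y - x₀) := by
      rw [hY, base_smul, base_sub, graphMap, base_joinPt]
    have hhY : height Y = r⁻¹ • (w (base y) - w x₀) := by
      rw [hY, height_smul, height_sub, graphMap, height_joinPt, hy2]
    have hYR : ‖base Y‖ < R := by
      have h2 := norm_base_le Y
      have h3 : ‖Y‖ ≤ ‖v‖ + ‖Y - v‖ := by
        simpa using norm_add_le v (Y - v)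
      rw [dist_eq_norm] at hYv
      simp only [R]; linarith
    have hxy : base y - x₀ = r • base Y := by rw [hbY, smul_inv_smul₀ hr0.ne']
    have h4 : dist (base y) x₀ < ε := by
      rw [dist_eq_norm, hxy, norm_smul, Real.norm_of_nonneg hr0.le]
      have := hr.2
      rw [lt_div_iff₀ hR] at this
      nlinarith
    have h5 := hlo h4
    have h6 : height Y - L (base Y) = r⁻¹ • (w (base y) - w x₀ - L (base y - x₀)) := by
      rw [hhY, hbY, map_smul, ← smul_sub]
    rw [h6, norm_smul, norm_inv, Real.norm_of_nonneg hr0.le] at h1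
    rw [hxy, norm_smul, Real.norm_of_nonneg hr0.le, ← hxy] at h5
    have h7 : r⁻¹ * ‖w (base y) - w x₀ - L (base y - x₀)‖ ≤ δ / (2 * R) * ‖base Y‖ := by
      calc _ ≤ r⁻¹ * (δ / (2 * R) * (r * ‖base Y‖)) := by gcongr
        _ = _ := by field_simp
    have h8 : δ / (2 * R) * ‖base Y‖ ≤ δ / (2 * R) * R := by gcongr
    have h9 : δ / (2 * R) * R = δ / 2 := by field_simp
    linarith
  have := tendsto_nhds_unique (hS ψ ψ.continuous ψ.hasCompactSupport)
    (tendsto_const_nhds.congr' (hzero.mono fun r h => h.symm))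
  linarith

/-- A `k`-plane contained in the graph of a linear map on `ℝᵏ` is that graph. -/
lemma Grass.apply_joinPt_of_height_eq {S : Grass (Ambient k m) k}
    {L : EuclideanSpace ℝ (Fin k) →L[ℝ] EuclideanSpace ℝ (Fin m)}
    (h : ∀ v ∈ S.plane, height v = L (base v)) (ξ : EuclideanSpace ℝ (Fin k)) :
    S.1 (joinPt ξ (L ξ)) = joinPt ξ (L ξ) := by
  let P : Submodule ℝ (Ambient k m) := LinearMap.range (S.1 : Ambient k m →ₗ[ℝ] Ambient k m)
  let b : P →ₗ[ℝ] EuclideanSpace ℝ (Fin k) := (baseL k m : _ →ₗ[ℝ] _) ∘ₗ P.subtype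
  have hinj : Function.Injective b := by
    rw [← LinearMap.ker_eq_bot, LinearMap.ker_eq_bot']
    intro v hv
    have hv' : base (v : Ambient k m) = 0 := hv
    have h2 := h v v.2
    rw [hv', map_zero] at h2
    exact Subtype.ext (joinPt_ext (hv'.trans (baseL k m).map_zero.symm)
      (h2.trans (heightL k m).map_zero.symm))
  have hdim : Module.finrank ℝ P = Module.finrank ℝ (EuclideanSpace ℝ (Fin k)) := by
    rw [finrank_euclideanSpace_fin]; exact S.2.2
  obtain ⟨v, hv⟩ := (LinearMap.injective_iff_surjective_of_finrank_eq_finrank hdim).1 hinj ξ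
  have hv' : base (v : Ambient k m) = ξ := hv
  have hvj : (v : Ambient k m) = joinPt ξ (L ξ) := by
    rw [← joinPt_base_height (v : Ambient k m), h v v.2, hv']
  rw [← hvj]
  obtain ⟨y, hy⟩ := v.2
  rw [← hy]
  exact congrArg (fun f : Ambient k m →ₗ[ℝ] Ambient k m => f y) S.2.1.isIdempotentElem

/-- The natural varifold of a `C¹` graph is carried by pairs of a point of the graph and the tangent
plane there. -/
lemma Varifold.IsNaturalVarifold.ae_tangent
    {w : EuclideanSpace ℝ (Fin k) → EuclideanSpace ℝ (Fin m)}
    (hd : DifferentiableOn ℝ w (Metric.ball 0 1))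
    (hc : ContinuousOn (fderiv ℝ w) (Metric.ball 0 1))
    {U : Set (Ambient k m)} {V : Varifold (Ambient k m) k U}
    (h : V.IsNaturalVarifold (graphOverBall w)) :
    ∀ᵐ p ∂V.measure, p.1 ∈ graphOverBall w ∧
      ∀ v, height (p.2.1 v) = fderiv ℝ w (base p.1) (base (p.2.1 v)) := by
  obtain ⟨-, hM, -, -, -, -, τ, hτ, hT, hV⟩ := h
  have h1 : (μHE[k].restrict (graphOverBall w)).withDensity
      (fun _ : Ambient k m => ((1 : ℕ) : ℝ≥0∞)) = μHE[k].restrict (graphOverBall w) := by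
    simp
  rw [h1] at hV
  rw [hV]
  have hMm : MeasurableSet (graphOverBall w) := measurableSet_graphOverBall hd.continuousOn
  have hmeas : MeasurableSet {p : Ambient k m × Grass (Ambient k m) k |
      p.1 ∈ graphOverBall w ∧
      ∀ v, height (p.2.1 v) = fderiv ℝ w (base p.1) (base (p.2.1 v))} := by
    let O : Set (Ambient k m × Grass (Ambient k m) k) := {p | ‖base p.1‖ < 1}
    have hO : IsOpen O := isOpen_lt (by fun_prop) continuous_const
    let D : Ambient k m → Ambient k m × Grass (Ambient k m) k → EuclideanSpace ℝ (Fin m) :=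
      fun v p => height (p.2.1 v) - fderiv ℝ w (base p.1) (base (p.2.1 v))
    have hcl : ∀ v, ContinuousOn (D v) O := by
      intro v
      have h2 : ContinuousOn (fun p : Ambient k m × Grass (Ambient k m) k =>
          fderiv ℝ w (base p.1)) O :=
        hc.comp (continuous_base.comp continuous_fst).continuousOn
          fun p hp => by simpa [O] using hp
      have h3 : Continuous fun p : Ambient k m × Grass (Ambient k m) k => p.2.1 v := by fun_prop
      exact (continuous_height.comp h3).continuousOn.sub
        (h2.clm_apply (continuous_base.comp h3).continuousOn)
    have hopen : IsOpen (⋃ v, O ∩ D v ⁻¹' {0}ᶜ) :=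
      isOpen_iUnion fun v => (hcl v).isOpen_inter_preimage hO isOpen_compl_singleton
    convert (measurable_fst hMm).diff hopen.measurableSet using 1
    ext p
    simp only [mem_ofPred_eq, Set.mem_sdiff, mem_preimage, mem_iUnion, mem_inter_iff, mem_compl_iff,
      mem_singleton_iff, D, sub_eq_zero, not_exists, not_and, not_not]
    constructor
    · rintro ⟨h1, h2⟩
      exact ⟨h1, fun v _ => h2 v⟩
    · rintro ⟨h1, h2⟩
      exact ⟨h1, fun v => h2 v h1.1⟩
  rw [ae_map_iff (aemeasurable_id'.prodMk hτ) hmeas]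
  filter_upwards [hT, ae_restrict_mem hMm] with z hz hzM
  refine ⟨hzM, fun v => ?_⟩
  have hzg : z = graphMap w (base z) := by rw [graphMap, ← hzM.2, joinPt_base_height]
  have hdz : DifferentiableAt ℝ w (base z) :=
    (hd _ (by simpa using hzM.1)).differentiableAt
      (Metric.isOpen_ball.mem_nhds (by simpa using hzM.1))
  exact IsApproxTangent.height_eq hdz (hzg ▸ hz) ⟨v, rfl⟩

/-! ### An upper bound for Brakke's functional -/

section Varifolds

variable {E : Type*} [NormedAddCommGroup E] [InnerProductSpace ℝ E]

lemma Grass.apply_apply {k : ℕ} (S : Grass E k) (x : E) : S.1 (S.1 x) = S.1 x :=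
  congrArg (fun f : E →ₗ[ℝ] E => f x) S.2.1.isIdempotentElem

lemma Grass.inner_apply_left {k : ℕ} (S : Grass E k) (x y : E) : ⟪S.1 x, y⟫ = ⟪x, S.1 y⟫ :=
  S.2.1.isSymmetric x y

lemma Grass.norm_sub_sq {k : ℕ} (S : Grass E k) (x : E) :
    ‖x - S.1 x‖ ^ 2 = ‖x‖ ^ 2 - ‖S.1 x‖ ^ 2 := by
  rw [norm_sub_sq_real, ← S.apply_apply x, ← S.inner_apply_left, S.apply_apply,
    real_inner_self_eq_norm_sq]
  ring

lemma Grass.norm_apply_le {k : ℕ} (S : Grass E k) (x : E) : ‖S.1 x‖ ≤ ‖x‖ :=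
  le_of_sq_le_sq (by nlinarith [S.norm_sub_sq x, sq_nonneg ‖x - S.1 x‖]) (norm_nonneg _)

lemma Grass.norm_sub_apply_le {k : ℕ} (S : Grass E k) (x : E) : ‖x - S.1 x‖ ≤ ‖x‖ :=
  le_of_sq_le_sq (by nlinarith [S.norm_sub_sq x, sq_nonneg ‖S.1 x‖]) (norm_nonneg _)

lemma MemLp.integrable_inner {α : Type*} [MeasurableSpace α] {μ : Measure α} {F G : α → E}
    (hF : MemLp F 2 μ) (hG : MemLp G 2 μ) : Integrable (fun x => ⟪F x, G x⟫) μ := by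
  refine (hF.norm.integrable_mul hG.norm).mono (hF.1.inner hG.1) ?_
  filter_upwards with x
  rw [Real.norm_eq_abs, Pi.mul_apply, Real.norm_eq_abs, abs_mul, abs_norm, abs_norm]
  exact abs_real_inner_le_norm _ _

lemma Varifold.measurePreserving_fst [MeasurableSpace E] {k : ℕ} {U : Set E} (V : Varifold E k U) :
    MeasurePreserving Prod.fst V.measure V.mass :=
  ⟨measurable_fst, rfl⟩

variable [FiniteDimensional ℝ E]

lemma hsInner_eq_sum {ι : Type*} [Fintype ι] (b : OrthonormalBasis ι ℝ E) (A B : E →L[ℝ] E) :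
    hsInner A B = ∑ i, ⟪A (b i), B (b i)⟫ := by
  rw [hsInner, LinearMap.trace_eq_sum_inner _ b]
  refine Finset.sum_congr rfl fun i _ => ?_
  rw [LinearMap.comp_apply, LinearMap.adjoint_inner_right]
  rfl

/-- `A · S` is the sum of the second-order terms `⟨A v, v⟩` over the projections `v` onto `S` of an
orthonormal basis. -/
lemma hsInner_grass {k : ℕ} {ι : Type*} [Fintype ι] (b : OrthonormalBasis ι ℝ E) (A : E →L[ℝ] E)
    (S : Grass E k) : hsInner A S.1 = ∑ i, ⟪A (S.1 (b i)), S.1 (b i)⟫ := by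
  have hS : (S.1 : E →ₗ[ℝ] E) ∘ₗ (S.1 : E →ₗ[ℝ] E) = S.1 := S.2.1.isIdempotentElem
  rw [hsInner]
  have : LinearMap.trace ℝ E (LinearMap.adjoint (A : E →ₗ[ℝ] E) ∘ₗ (S.1 : E →ₗ[ℝ] E)) =
      LinearMap.trace ℝ E ((S.1 : E →ₗ[ℝ] E) ∘ₗ
        (LinearMap.adjoint (A : E →ₗ[ℝ] E) ∘ₗ (S.1 : E →ₗ[ℝ] E))) := by
    rw [LinearMap.trace_comp_comm' (LinearMap.adjoint (A : E →ₗ[ℝ] E) ∘ₗ (S.1 : E →ₗ[ℝ] E))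
      (S.1 : E →ₗ[ℝ] E), LinearMap.comp_assoc, hS]
  rw [this, LinearMap.trace_eq_sum_inner _ b]
  refine Finset.sum_congr rfl fun i _ => ?_
  rw [LinearMap.comp_apply, LinearMap.comp_apply]
  change ⟪b i, S.1 _⟫ = _
  rw [← S.inner_apply_left, LinearMap.adjoint_inner_right]
  rfl

lemma abs_hsInner_grass_le {k : ℕ} (A : E →L[ℝ] E) (S : Grass E k) :
    |hsInner A S.1| ≤ Module.finrank ℝ E * ‖A‖ := by
  rw [hsInner_eq_sum (stdOrthonormalBasis ℝ E)]
  refine (Finset.abs_sum_le_sum_abs _ _).trans ?_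
  calc _ ≤ ∑ _i : Fin (Module.finrank ℝ E), ‖A‖ := by
        refine Finset.sum_le_sum fun i _ => ?_
        refine (abs_real_inner_le_norm _ _).trans ?_
        have h1 := A.le_opNorm (stdOrthonormalBasis ℝ E i)
        have h2 := S.norm_apply_le (stdOrthonormalBasis ℝ E i)
        rw [OrthonormalBasis.norm_eq_one] at h1 h2
        nlinarith [norm_nonneg (A (stdOrthonormalBasis ℝ E i)),
          norm_nonneg (S.1 (stdOrthonormalBasis ℝ E i))]
    _ = _ := by simp

lemma gradient_inner (φ : E → ℝ) (z v : E) : ⟪gradient φ z, v⟫ = fderiv ℝ φ z v := by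
  rw [gradient, InnerProductSpace.toDual_symm_apply]

lemma contDiff_gradient {φ : E → ℝ} (h : ContDiff ℝ 2 φ) : ContDiff ℝ 1 (gradient φ) :=
  (InnerProductSpace.toDual ℝ E).symm.contDiff.comp (h.fderiv_right (m := 1) (by norm_num))

lemma tsupport_gradient_subset (φ : E → ℝ) : tsupport (gradient φ) ⊆ tsupport φ := by
  refine (closure_mono fun z hz => ?_).trans (tsupport_fderiv_subset ℝ)
  rw [Function.mem_support] at hz ⊢
  intro h
  exact hz (by rw [gradient, h, map_zero])

/-- The quadratic form of the Hessian as a second derivative along a line. -/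
lemma inner_fderiv_gradient {φ : E → ℝ} (h : ContDiff ℝ 2 φ) {z v : E} {N N' : ℝ → ℝ} {N'' : ℝ}
    (hN : ∀ᶠ s in 𝓝 (0 : ℝ), φ (z + s • v) = N s)
    (hN' : ∀ᶠ s in 𝓝 (0 : ℝ), HasDerivAt N (N' s) s) (hN'' : HasDerivAt N' N'' 0) :
    ⟪fderiv ℝ (gradient φ) z v, v⟫ = N'' := by
  have hline : ∀ s : ℝ, HasDerivAt (fun s : ℝ => z + s • v) v s := fun s => by
    simpa using ((hasDerivAt_id s).smul_const v).const_add z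
  have h1 : ∀ s : ℝ, HasDerivAt (fun s : ℝ => φ (z + s • v)) ⟪gradient φ (z + s • v), v⟫ s := by
    intro s
    rw [gradient_inner]
    exact ((h.differentiable (by norm_num) _).hasFDerivAt).comp_hasDerivAt s (hline s)
  have h2 : ∀ᶠ s in 𝓝 (0 : ℝ), ⟪gradient φ (z + s • v), v⟫ = N' s := by
    filter_upwards [hN.eventually_nhds, hN'] with s hs hs'
    exact (h1 s).unique (hs'.congr_of_eventuallyEq hs)
  have h3 : HasDerivAt (fun s : ℝ => ⟪gradient φ (z + s • v), v⟫)
      ⟪fderiv ℝ (gradient φ) z v, v⟫ 0 := by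
    have h4 : HasFDerivAt (gradient φ) (fderiv ℝ (gradient φ) (z + (0 : ℝ) • v))
        (z + (0 : ℝ) • v) :=
      ((contDiff_gradient h).differentiable (by norm_num) _).hasFDerivAt
    have h5 := (h4.comp_hasDerivAt (0 : ℝ) (hline 0)).inner ℝ (hasDerivAt_const (0 : ℝ) v)
    simpa using h5
  exact h3.unique (hN''.congr_of_eventuallyEq h2)

lemma continuous_hsInner_prod {k : ℕ} {D : E → E →L[ℝ] E} (hD : Continuous D) :
    Continuous fun p : E × Grass E k => hsInner (D p.1) p.2.1 := by
  simp only [hsInner_eq_sum (stdOrthonormalBasis ℝ E)]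
  fun_prop

variable [MeasurableSpace E] [BorelSpace E]

/-- Completing the square in `h` and using the first variation formula for `∇φ` bounds Brakke's
functional by an expression without the mean curvature. No information on the direction of `h` is
needed. -/
lemma Varifold.brakke_le {k : ℕ} {U : Set E} (V : Varifold E k U) [IsFiniteMeasure V.measure]
    {u : E → E} (hu : MemLp u 2 V.mass) {φ : E → ℝ} (hφ : ContDiff ℝ 2 φ)
    (hcs : HasCompactSupport φ) (hU : tsupport φ ⊆ U) (h0 : ∀ x, 0 ≤ φ x) {R : E → ℝ}
    (hR : Integrable R V.mass)
    (hle : ∀ᵐ p ∂V.measure, φ p.1 / 4 * ‖u p.1 - p.2.1 (u p.1)‖ ^ 2 +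
      ⟪gradient φ p.1, u p.1 - p.2.1 (u p.1)⟫ -
      hsInner (fderiv ℝ (gradient φ) p.1) p.2.1 ≤ R p.1) :
    V.brakke u φ ≤ ((∫ x, R x ∂V.mass : ℝ) : EReal) := by
  unfold Varifold.brakke
  split_ifs with H
  swap
  · exact bot_le
  rw [EReal.coe_le_coe_iff]
  obtain ⟨hL2, hvar⟩ := H.2.choose_spec
  set h := H.2.choose
  have hX := contDiff_gradient hφ
  have hXc : HasCompactSupport (gradient φ) :=
    hcs.of_isClosed_subset (isClosed_tsupport _) (tsupport_gradient_subset φ)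
  have hmp := V.measurePreserving_fst
  have hh : MemLp (fun p : E × Grass E k => h p.1) 2 V.measure := hL2.comp_measurePreserving hmp
  have hu' : MemLp (fun p : E × Grass E k => u p.1) 2 V.measure := hu.comp_measurePreserving hmp
  have hSm : AEStronglyMeasurable (fun p : E × Grass E k => p.2.1) V.measure :=
    (continuous_subtype_val.comp continuous_snd).aestronglyMeasurable
  have hW : MemLp (fun p : E × Grass E k => u p.1 - p.2.1 (u p.1)) 2 V.measure := by
    refine hu'.of_le (hu'.1.sub ?_) (ae_of_all _ fun p => p.2.norm_sub_apply_le _)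
    exact (ContinuousLinearMap.id ℝ (E →L[ℝ] E)).aestronglyMeasurable_comp₂ hSm hu'.1
  obtain ⟨CX, hCX⟩ := hX.continuous.bounded_above_of_compact_support hXc
  obtain ⟨Cφ, hCφ⟩ := hφ.continuous.bounded_above_of_compact_support hcs
  have hXL : MemLp (fun p : E × Grass E k => gradient φ p.1) 2 V.measure :=
    MemLp.of_bound (hX.continuous.comp continuous_fst).aestronglyMeasurable CX
      (ae_of_all _ fun p => hCX _)
  have hφm : AEStronglyMeasurable (fun p : E × Grass E k => φ p.1) V.measure :=
    (hφ.continuous.comp continuous_fst).aestronglyMeasurable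
  have hφb : ∀ᵐ p ∂V.measure, ‖(fun p : E × Grass E k => φ p.1) p‖ ≤ Cφ :=
    ae_of_all _ fun p => hCφ _
  have i1 := MemLp.integrable_inner hXL hh
  have i2 := MemLp.integrable_inner hXL hW
  have i3 : Integrable (fun p : E × Grass E k => φ p.1 *
      (⟪h p.1, h p.1⟫ + ⟪h p.1, u p.1 - p.2.1 (u p.1)⟫)) V.measure :=
    ((MemLp.integrable_inner hh hh).add (MemLp.integrable_inner hh hW)).bdd_mul hφm hφb
  have i4 : Integrable (fun p : E × Grass E k => φ p.1 *
      ⟪u p.1 - p.2.1 (u p.1), u p.1 - p.2.1 (u p.1)⟫) V.measure :=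
    (MemLp.integrable_inner hW hW).bdd_mul hφm hφb
  have hDX : Continuous (fderiv ℝ (gradient φ)) := hX.continuous_fderiv (by norm_num)
  obtain ⟨CD, hCD⟩ := hDX.bounded_above_of_compact_support (hXc.fderiv ℝ)
  have i5 : Integrable (fun p : E × Grass E k => hsInner (fderiv ℝ (gradient φ) p.1) p.2.1)
      V.measure := by
    refine Integrable.of_bound (continuous_hsInner_prod hDX).aestronglyMeasurable
      (Module.finrank ℝ E * CD) (ae_of_all _ fun p => ?_)
    refine (abs_hsInner_grass_le _ _).trans ?_
    gcongr
    exact hCD _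
  have hfv : ∫ p, hsInner (fderiv ℝ (gradient φ) p.1) p.2.1 ∂V.measure =
      - ∫ p, ⟪gradient φ p.1, h p.1⟫ ∂V.measure := by
    have := hvar (gradient φ) hX hXc ((tsupport_gradient_subset φ).trans hU)
    rw [Varifold.firstVariation] at this
    rw [this, Varifold.mass, integral_map measurable_fst.aemeasurable]
    exact hX.continuous.aestronglyMeasurable.inner hL2.1
  have i6 : Integrable (fun p : E × Grass E k => φ p.1 / 4 * ‖u p.1 - p.2.1 (u p.1)‖ ^ 2 +
      ⟪gradient φ p.1, u p.1 - p.2.1 (u p.1)⟫) V.measure := by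
    refine Integrable.add ((i4.const_mul (1 / 4)).congr (ae_of_all _ fun p => ?_)) i2
    simp only [real_inner_self_eq_norm_sq]; ring
  have hRm : ∫ x, R x ∂V.mass = ∫ p, R p.1 ∂V.measure := by
    rw [Varifold.mass, integral_map measurable_fst.aemeasurable]
    exact hR.1
  have hRi : Integrable (fun p : E × Grass E k => R p.1) V.measure :=
    hR.comp_measurable measurable_fst
  rw [hRm]
  refine le_trans ?_ (integral_mono_ae (i6.sub i5) hRi hle)
  simp only [Pi.sub_apply]
  rw [integral_sub i6 i5, hfv, sub_neg_eq_add, ← integral_add i6 i1]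
  refine integral_mono (((i1.add i2).sub i3).congr (ae_of_all _ fun p => ?_)) (i6.add i1)
    fun p => ?_
  · simp only [Pi.add_apply, Pi.sub_apply, inner_add_left, inner_add_right, inner_smul_left,
      neg_smul, inner_neg_left]
    simp only [conj_trivial]
    ring
  · have h1 : 0 ≤ ‖h p.1 + (1 / 2 : ℝ) • (u p.1 - p.2.1 (u p.1))‖ ^ 2 := by positivity
    rw [norm_add_sq_real, norm_smul, inner_smul_right] at h1
    simp only [inner_add_left, inner_add_right, inner_smul_left, neg_smul, inner_neg_left,
      real_inner_self_eq_norm_sq]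
    simp only [conj_trivial, Real.norm_eq_abs] at h1 ⊢
    rw [abs_of_pos (by norm_num : (0 : ℝ) < 1 / 2)] at h1
    have h2 := h0 p.1
    nlinarith [mul_nonneg h2 h1]

end Varifolds

/-! ### Linear algebra of graph planes -/

/-- `S` is the tangent plane `{(ξ, L ξ)}` of a graph with derivative `L`. -/
def IsGraphPlane (S : Grass (Ambient k m) k)
    (L : EuclideanSpace ℝ (Fin k) →L[ℝ] EuclideanSpace ℝ (Fin m)) : Prop :=
  ∀ v, height (S.1 v) = L (base (S.1 v))

/-- The base component of the projection of the `a`-th standard basis vector onto `S`. -/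
def planeVec (S : Grass (Ambient k m) k) (a : Fin k ⊕ Fin m) : EuclideanSpace ℝ (Fin k) :=
  base (S.1 (EuclideanSpace.basisFun (Fin k ⊕ Fin m) ℝ a))

lemma inner_planeVec (S : Grass (Ambient k m) k) (x : EuclideanSpace ℝ (Fin k))
    (a : Fin k ⊕ Fin m) : ⟪x, planeVec S a⟫ =
      ⟪S.1 (joinPt x 0), EuclideanSpace.basisFun (Fin k ⊕ Fin m) ℝ a⟫ := by
  rw [S.inner_apply_left, inner_eq_base_add_height]
  simp [planeVec]

lemma sum_inner_planeVec (S : Grass (Ambient k m) k) (x y : EuclideanSpace ℝ (Fin k)) :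
    ∑ a, ⟪x, planeVec S a⟫ * ⟪y, planeVec S a⟫ = ⟪S.1 (joinPt x 0), S.1 (joinPt y 0)⟫ := by
  simp only [inner_planeVec]
  rw [← (EuclideanSpace.basisFun (Fin k ⊕ Fin m) ℝ).sum_inner_mul_inner]
  exact Finset.sum_congr rfl fun a _ => by rw [real_inner_comm (S.1 (joinPt y 0))]

lemma norm_planeVec_le (S : Grass (Ambient k m) k) (a : Fin k ⊕ Fin m) : ‖planeVec S a‖ ≤ 1 := by
  refine (norm_base_le _).trans ((S.norm_apply_le _).trans ?_)
  rw [OrthonormalBasis.norm_eq_one]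

lemma norm_joinPt_sq (x : EuclideanSpace ℝ (Fin k)) (y : EuclideanSpace ℝ (Fin m)) :
    ‖joinPt x y‖ ^ 2 = ‖x‖ ^ 2 + ‖y‖ ^ 2 := by
  rw [norm_sq_eq_base_add_height, base_joinPt, height_joinPt]

lemma IsGraphPlane.apply_joinPt {S : Grass (Ambient k m) k}
    {L : EuclideanSpace ℝ (Fin k) →L[ℝ] EuclideanSpace ℝ (Fin m)} (h : IsGraphPlane S L)
    (ξ : EuclideanSpace ℝ (Fin k)) : S.1 (joinPt ξ (L ξ)) = joinPt ξ (L ξ) :=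
  Grass.apply_joinPt_of_height_eq (by rintro _ ⟨v, rfl⟩; exact h v) ξ

/-- A horizontal vector is at distance at most `|L x|` from the plane `{(ξ, L ξ)}`. -/
lemma IsGraphPlane.norm_sub_le {S : Grass (Ambient k m) k}
    {L : EuclideanSpace ℝ (Fin k) →L[ℝ] EuclideanSpace ℝ (Fin m)} (h : IsGraphPlane S L)
    (x : EuclideanSpace ℝ (Fin k)) : ‖joinPt x 0 - S.1 (joinPt x 0)‖ ≤ ‖L x‖ := by
  have h1 : joinPt x (0 : EuclideanSpace ℝ (Fin m)) = joinPt x (L x) - joinPt 0 (L x) := by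
    refine joinPt_ext ?_ ?_ <;> simp [base_sub, height_sub]
  have h2 : joinPt x 0 - S.1 (joinPt x 0) =
      -(joinPt 0 (L x) - S.1 (joinPt (0 : EuclideanSpace ℝ (Fin k)) (L x))) := by
    rw [h1, map_sub, h.apply_joinPt]; abel
  rw [h2, norm_neg]
  refine (S.norm_sub_apply_le _).trans ?_
  refine le_of_sq_le_sq ?_ (norm_nonneg _)
  rw [norm_joinPt_sq]; simp

/-- If `|L| ≤ 1` then projecting onto `{(ξ, L ξ)}` keeps at least half of the square length of a
horizontal vector. -/
lemma IsGraphPlane.half_norm_sq_le {S : Grass (Ambient k m) k}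
    {L : EuclideanSpace ℝ (Fin k) →L[ℝ] EuclideanSpace ℝ (Fin m)} (h : IsGraphPlane S L)
    (hL : gradNorm L ≤ 1) (x : EuclideanSpace ℝ (Fin k)) :
    ‖x‖ ^ 2 / 2 ≤ ‖S.1 (joinPt x 0)‖ ^ 2 := by
  have h1 : ⟪S.1 (joinPt x 0), joinPt x (L x)⟫ = ‖x‖ ^ 2 := by
    rw [S.inner_apply_left, h.apply_joinPt, inner_eq_base_add_height]
    simp
  have h2 := real_inner_le_norm (S.1 (joinPt x 0)) (joinPt x (L x))
  have h3 : ‖joinPt x (L x)‖ ^ 2 ≤ 2 * ‖x‖ ^ 2 := by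
    rw [norm_joinPt_sq]
    have := norm_apply_le_gradNorm L x
    have h4 : ‖L x‖ ≤ ‖x‖ := this.trans (by nlinarith [norm_nonneg x])
    nlinarith [norm_nonneg (L x)]
  rw [h1] at h2
  rcases eq_or_ne x 0 with rfl | hx
  · simp
  have hx' : 0 < ‖x‖ := norm_pos_iff.2 hx
  have h5 : (‖x‖ ^ 2) ^ 2 ≤ ‖S.1 (joinPt x 0)‖ ^ 2 * (2 * ‖x‖ ^ 2) := by
    calc (‖x‖ ^ 2) ^ 2 ≤ (‖S.1 (joinPt x 0)‖ * ‖joinPt x (L x)‖) ^ 2 := by gcongr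
      _ = ‖S.1 (joinPt x 0)‖ ^ 2 * ‖joinPt x (L x)‖ ^ 2 := by ring
      _ ≤ _ := by gcongr
  have h6 : 0 < ‖x‖ ^ 2 := by positivity
  nlinarith

/-- The tangential energy `Σ_a |M ξ_a|²` controls the full gradient norm of `M`. -/
lemma IsGraphPlane.half_gradNorm_sq_le {S : Grass (Ambient k m) k}
    {L : EuclideanSpace ℝ (Fin k) →L[ℝ] EuclideanSpace ℝ (Fin m)} (h : IsGraphPlane S L)
    (hL : gradNorm L ≤ 1) (M : EuclideanSpace ℝ (Fin k) →L[ℝ] EuclideanSpace ℝ (Fin m)) :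
    gradNorm M ^ 2 / 2 ≤ ∑ a, ‖M (planeVec S a)‖ ^ 2 := by
  let row : Fin m → EuclideanSpace ℝ (Fin k) :=
    fun l => WithLp.toLp 2 fun i => M (EuclideanSpace.single i 1) l
  have hrow : ∀ l v, M v l = ⟪row l, v⟫ := by
    intro l v
    rw [clm_apply_eq_sum, PiLp.inner_apply]
    simp [row, mul_comm]
  have h1 : ∑ a, ‖M (planeVec S a)‖ ^ 2 = ∑ l, ‖S.1 (joinPt (row l) 0)‖ ^ 2 := by
    simp only [EuclideanSpace.norm_sq_eq (M _), Real.norm_eq_abs, sq_abs]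
    rw [Finset.sum_comm]
    refine Finset.sum_congr rfl fun l _ => ?_
    rw [← real_inner_self_eq_norm_sq, ← sum_inner_planeVec]
    exact Finset.sum_congr rfl fun a _ => by rw [hrow, sq]
  rw [h1, gradNorm_sq, Finset.sum_div]
  refine Finset.sum_le_sum fun l _ => ?_
  refine le_trans (le_of_eq ?_) (h.half_norm_sq_le hL (row l))
  rw [EuclideanSpace.norm_sq_eq]
  simp [row]

/-- The horizontal block of `S` differs from the identity only to second order in `L`; this is the
source of the factor `‖∇f‖⁴` in the estimate. -/
lemma IsGraphPlane.abs_trace_defect_le {S : Grass (Ambient k m) k}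
    {L : EuclideanSpace ℝ (Fin k) →L[ℝ] EuclideanSpace ℝ (Fin m)} (h : IsGraphPlane S L)
    (A : Fin m → Fin k → Fin k → ℝ) (w : EuclideanSpace ℝ (Fin m)) :
    |∑ l, w l * (∑ i, A l i i -
        ∑ a, ∑ i, ∑ j, A l i j * planeVec S a i * planeVec S a j)| ≤
      ‖w‖ * √(∑ l, ∑ i, ∑ j, A l i j ^ 2) * gradNorm L ^ 2 := by
  let N : Fin k → Ambient k m := fun i =>
    joinPt (EuclideanSpace.single i 1) 0 - S.1 (joinPt (EuclideanSpace.single i 1) 0)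
  have hN : ∀ i, ‖N i‖ ≤ ‖L (EuclideanSpace.single i 1)‖ := fun i => h.norm_sub_le _
  have hNN : ∀ i j, ⟪N i, N j⟫ = (if i = j then 1 else 0) -
      ∑ a, planeVec S a i * planeVec S a j := by
    intro i j
    have h1 := sum_inner_planeVec S (EuclideanSpace.single i 1) (EuclideanSpace.single j 1)
    simp only [EuclideanSpace.inner_single_left, map_one, one_mul] at h1
    rw [h1]
    simp only [N, inner_sub_left, inner_sub_right]
    rw [← S.inner_apply_left, S.inner_apply_left (joinPt _ _) (S.1 _), S.apply_apply,
      ← S.inner_apply_left]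
    have h2 : ⟪joinPt (EuclideanSpace.single i (1 : ℝ)) (0 : EuclideanSpace ℝ (Fin m)),
        joinPt (EuclideanSpace.single j 1) 0⟫ = if i = j then 1 else 0 := by
      rw [inner_eq_base_add_height]
      simp [EuclideanSpace.inner_single_left]
    rw [h2]
    ring
  have hrep : ∀ l, ∑ i, A l i i - ∑ a, ∑ i, ∑ j, A l i j * planeVec S a i * planeVec S a j =
      ∑ i, ∑ j, A l i j * ⟪N i, N j⟫ := by
    intro l
    simp only [hNN, mul_sub, Finset.sum_sub_distrib, Finset.mul_sum]
    congr 1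
    · simp
    · rw [Finset.sum_comm]
      refine Finset.sum_congr rfl fun i _ => ?_
      rw [Finset.sum_comm]
      exact Finset.sum_congr rfl fun j _ => Finset.sum_congr rfl fun a _ => by ring
  simp only [hrep]
  refine abs_le_of_sq_le_sq ?_ (by positivity)
  have hL4 : ∑ i, ∑ j, ⟪N i, N j⟫ ^ 2 ≤ (gradNorm L ^ 2) ^ 2 := by
    have h1 : gradNorm L ^ 2 = ∑ i, ‖L (EuclideanSpace.single i 1)‖ ^ 2 := by
      rw [gradNorm_sq, Finset.sum_comm]
      refine Finset.sum_congr rfl fun i _ => ?_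
      rw [EuclideanSpace.norm_sq_eq]; simp
    rw [h1, sq, Finset.sum_mul_sum]
    refine Finset.sum_le_sum fun i _ => Finset.sum_le_sum fun j _ => ?_
    rw [← sq_abs, ← mul_pow]
    refine pow_le_pow_left₀ (abs_nonneg _) ((abs_real_inner_le_norm _ _).trans ?_) 2
    exact mul_le_mul (hN i) (hN j) (norm_nonneg _) (norm_nonneg _)
  have hA : ∀ l, (∑ i, ∑ j, A l i j * ⟪N i, N j⟫) ^ 2 ≤
      (∑ i, ∑ j, A l i j ^ 2) * (gradNorm L ^ 2) ^ 2 := by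
    intro l
    simp only [← Finset.sum_product']
    refine (Finset.sum_mul_sq_le_sq_mul_sq _ _ _).trans ?_
    gcongr
    simpa only [← Finset.sum_product'] using hL4
  calc (∑ l, w l * ∑ i, ∑ j, A l i j * ⟪N i, N j⟫) ^ 2
      ≤ (∑ l, w l ^ 2) * ∑ l, (∑ i, ∑ j, A l i j * ⟪N i, N j⟫) ^ 2 :=
        Finset.sum_mul_sq_le_sq_mul_sq _ _ _
    _ ≤ (∑ l, w l ^ 2) * ∑ l, (∑ i, ∑ j, A l i j ^ 2) * (gradNorm L ^ 2) ^ 2 := by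
        gcongr with l; exact hA l
    _ = _ := by
        rw [← Finset.sum_mul, mul_pow, mul_pow, Real.sq_sqrt (by positivity),
          EuclideanSpace.norm_sq_eq]
        simp only [Real.norm_eq_abs, sq_abs]
        ring

/-! ### Flows of graphs: real form of (B4), measurability in time, and bounded heights -/

/-- The extended integral is monotone against an integrable majorant; measurability of the smaller
function is not required. -/
lemma extIntegral_le {a b : ℝ} {F : ℝ → EReal} {G : ℝ → ℝ}
    (hF : ∀ᵐ t ∂volume.restrict (Ioo a b), F t ≤ (G t : EReal))
    (hG : IntegrableOn G (Ioo a b)) :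
    extIntegral a b F ≤ ((∫ t in Ioo a b, G t : ℝ) : EReal) := by
  have h1 : ∫⁻ t in Ioo a b, (F t).toENNReal ≤ ∫⁻ t in Ioo a b, ENNReal.ofReal (G t) := by
    refine lintegral_mono_ae (hF.mono fun t ht => ?_)
    simpa using EReal.toENNReal_le_toENNReal ht
  have h2 : ∫⁻ t in Ioo a b, ENNReal.ofReal (-G t) ≤ ∫⁻ t in Ioo a b, (-F t).toENNReal := by
    refine lintegral_mono_ae (hF.mono fun t ht => ?_)
    have := EReal.toENNReal_le_toENNReal (EReal.neg_le_neg_iff.2 ht)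
    rwa [← EReal.coe_neg, EReal.toENNReal_of_ne_top (EReal.coe_ne_top _), EReal.toReal_coe] at this
  have hP : ∫⁻ t in Ioo a b, ENNReal.ofReal (G t) ≠ ∞ := hG.lintegral_lt_top.ne
  have hN : ∫⁻ t in Ioo a b, ENNReal.ofReal (-G t) ≠ ∞ := hG.neg.lintegral_lt_top.ne
  rw [integral_eq_lintegral_pos_part_sub_lintegral_neg_part hG, EReal.coe_sub,
    EReal.coe_ennreal_toReal hP, EReal.coe_ennreal_toReal hN]
  exact EReal.sub_le_sub (EReal.coe_ennreal_le_coe_ennreal_iff.2 h1)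
    (EReal.coe_ennreal_le_coe_ennreal_iff.2 h2)

/-- The data of the theorem, with real bounds `F, E ≤ 1` for the gradient of `f` and for `u`. -/
structure IsGraphFlow (f : EuclideanSpace ℝ (Fin k) → ℝ → EuclideanSpace ℝ (Fin m))
    (V : ℝ → Varifold (Ambient k m) k (cylinder k m 1)) (u : Ambient k m → ℝ → Ambient k m)
    (F E : ℝ) : Prop where
  diff : ∀ t ∈ Ioo (-1 : ℝ) 1, DifferentiableOn ℝ (fun x => f x t) (Metric.ball 0 1)
  cont : ContinuousOn
    (fun p : EuclideanSpace ℝ (Fin k) × ℝ => fderiv ℝ (fun x => f x p.2) p.1)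
    (Metric.ball 0 1 ×ˢ Ioo (-1 : ℝ) 1)
  natural : ∀ t ∈ Ioo (-1 : ℝ) 1, (V t).IsNaturalVarifold (graphOverBall fun x => f x t)
  b4 : SatisfiesB4 (Ioo (-1 : ℝ) 1) V u
  grad_le : ∀ t ∈ Ioo (-1 : ℝ) 1, ∀ x ∈ Metric.ball (0 : EuclideanSpace ℝ (Fin k)) 1,
    gradNorm (fderiv ℝ (fun x => f x t) x) ≤ F
  F_le : F ≤ 1
  u_le : ∀ t ∈ Ioo (-1 : ℝ) 1, ∀ z ∈ cylinder k m 1, ‖u z t‖ ≤ E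
  E_le : E ≤ 1

lemma isOpen_cylinder (r : ℝ) : IsOpen (cylinder k m r) :=
  isOpen_lt (by fun_prop) continuous_const

/-- An upper bound for the `ℋᵏ`-measure of a `1`-Lipschitz graph over the unit ball. -/
def massBound (k : ℕ) : ℝ := 2 ^ k * volume.real (Metric.ball (0 : EuclideanSpace ℝ (Fin k)) 1)

lemma massBound_nonneg (k : ℕ) : 0 ≤ massBound k := by unfold massBound; positivity

section Flow

variable {f : EuclideanSpace ℝ (Fin k) → ℝ → EuclideanSpace ℝ (Fin m)}
    {V : ℝ → Varifold (Ambient k m) k (cylinder k m 1)} {u : Ambient k m → ℝ → Ambient k m}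
    {F E : ℝ}

lemma IsGraphFlow.lipschitz (hf : IsGraphFlow f V u F E) {t : ℝ} (ht : t ∈ Ioo (-1 : ℝ) 1) :
    LipschitzOnWith 1 (fun x => f x t) (Metric.ball 0 1) :=
  lipschitzOnWith_of_gradNorm_le (hf.diff t ht) fun x hx => (hf.grad_le t ht x hx).trans hf.F_le

lemma IsGraphFlow.cont_slice (hf : IsGraphFlow f V u F E) {t : ℝ} (ht : t ∈ Ioo (-1 : ℝ) 1) :
    ContinuousOn (fderiv ℝ (fun x => f x t)) (Metric.ball 0 1) :=
  hf.cont.comp (f := fun x => (x, t)) (by fun_prop) fun _ hx => ⟨hx, ht⟩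

lemma IsGraphFlow.ae_tangent (hf : IsGraphFlow f V u F E) {t : ℝ} (ht : t ∈ Ioo (-1 : ℝ) 1) :
    ∀ᵐ p ∂(V t).measure, p.1 ∈ graphOverBall (fun x => f x t) ∧
      IsGraphPlane p.2 (fderiv ℝ (fun x => f x t) (base p.1)) :=
  (hf.natural t ht).ae_tangent (hf.diff t ht) (hf.cont_slice ht)

lemma IsGraphFlow.lintegral_ball_le (hf : IsGraphFlow f V u F E) {t : ℝ} (ht : t ∈ Ioo (-1 : ℝ) 1)
    (G : EuclideanSpace ℝ (Fin k) → ℝ≥0∞) :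
    ∫⁻ x in Metric.ball 0 1, G x ≤ ∫⁻ z, G (base z) ∂(V t).mass := by
  rw [(hf.natural t ht).mass_eq]
  exact lintegral_ball_le_graph _ G

lemma IsGraphFlow.lintegral_mass_le (hf : IsGraphFlow f V u F E) {t : ℝ} (ht : t ∈ Ioo (-1 : ℝ) 1)
    (G : Ambient k m → ℝ≥0∞) :
    ∫⁻ z, G z ∂(V t).mass ≤ 2 ^ k * ∫⁻ x in Metric.ball 0 1, G (joinPt x (f x t)) := by
  rw [(hf.natural t ht).mass_eq]
  exact lintegral_graph_le (hf.lipschitz ht) G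

lemma IsGraphFlow.mass_univ_le (hf : IsGraphFlow f V u F E) {t : ℝ} (ht : t ∈ Ioo (-1 : ℝ) 1) :
    (V t).mass univ ≤ ENNReal.ofReal (massBound k) := by
  have := hf.lintegral_mass_le ht fun _ => 1
  rw [lintegral_one, lintegral_one, Measure.restrict_apply_univ] at this
  refine this.trans (le_of_eq ?_)
  rw [massBound, ENNReal.ofReal_mul (by positivity), ofReal_measureReal
    (measure_ball_lt_top).ne, ENNReal.ofReal_pow (by norm_num)]
  simp

lemma Varifold.mass_univ {k : ℕ} {E : Type*} [NormedAddCommGroup E] [InnerProductSpace ℝ E]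
    [MeasurableSpace E] {U : Set E} (V : Varifold E k U) : V.mass univ = V.measure univ := by
  rw [Varifold.mass, Measure.map_apply measurable_fst MeasurableSet.univ, preimage_univ]

lemma IsGraphFlow.isFiniteMeasure_mass (hf : IsGraphFlow f V u F E) {t : ℝ}
    (ht : t ∈ Ioo (-1 : ℝ) 1) : IsFiniteMeasure (V t).mass :=
  ⟨(hf.mass_univ_le ht).trans_lt ENNReal.ofReal_lt_top⟩

lemma IsGraphFlow.isFiniteMeasure (hf : IsGraphFlow f V u F E) {t : ℝ}
    (ht : t ∈ Ioo (-1 : ℝ) 1) : IsFiniteMeasure (V t).measure :=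
  ⟨(V t).mass_univ ▸ (hf.mass_univ_le ht).trans_lt ENNReal.ofReal_lt_top⟩

lemma IsGraphFlow.ae_mem_graph (hf : IsGraphFlow f V u F E) {t : ℝ} (ht : t ∈ Ioo (-1 : ℝ) 1) :
    ∀ᵐ z ∂(V t).mass, z ∈ graphOverBall (fun x => f x t) := by
  rw [(hf.natural t ht).mass_eq]
  exact ae_restrict_mem (measurableSet_graphOverBall (hf.diff t ht).continuousOn)

/-- Condition (B4) in real terms: any integrable majorant of Brakke's functional may be used. -/
lemma IsGraphFlow.integral_sub_le (hf : IsGraphFlow f V u F E) {φ : Ambient k m → ℝ → ℝ}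
    (hφ : IsTestFunction (cylinder k m 1) (Ioo (-1 : ℝ) 1) φ) {t₁ t₂ : ℝ}
    (h₁ : t₁ ∈ Ioo (-1 : ℝ) 1) (h₂ : t₂ ∈ Ioo (-1 : ℝ) 1) (h : t₁ < t₂) {G : ℝ → ℝ}
    (hB : ∀ t ∈ Ioo t₁ t₂, MemLp (fun x => u x t) 2 (V t).mass →
      (V t).brakke (fun x => u x t) (fun x => φ x t) ≤ (G t : EReal))
    (hG : IntegrableOn G (Ioo t₁ t₂)) :
    ∫ x, φ x t₂ ∂(V t₂).mass - ∫ x, φ x t₁ ∂(V t₁).mass ≤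
      (∫ t in Ioo t₁ t₂, G t) +
        ∫ t in Ioo t₁ t₂, ∫ x, deriv (fun s => φ x s) t ∂(V t).mass := by
  have hsub : Ioo t₁ t₂ ⊆ Ioo (-1 : ℝ) 1 := Ioo_subset_Ioo h₁.1.le h₂.2.le
  have h1 := hf.b4.2 φ hφ t₁ h₁ t₂ h₂ h
  have h2 := extIntegral_le (F := fun t => (V t).brakke (fun x => u x t) (fun x => φ x t)) (by
    filter_upwards [ae_restrict_of_ae_restrict_of_subset hsub hf.b4.1,
      ae_restrict_mem measurableSet_Ioo] with t ht htm
    exact hB t htm ht) hG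
  have h3 := h1.trans (add_le_add_left h2 _)
  rwa [← EReal.coe_add, EReal.coe_le_coe_iff] at h3

/-- The mass of a fixed test function grows at most linearly in time. -/
lemma IsGraphFlow.integral_sub_le_linear (hf : IsGraphFlow f V u F E) {φ : Ambient k m → ℝ}
    (hφ : ContDiff ℝ 2 φ) (hcs : HasCompactSupport φ) (hU : tsupport φ ⊆ cylinder k m 1)
    (h0 : ∀ x, 0 ≤ φ x) {K : ℝ} (hK : ∀ x, φ x / 4 + ‖gradient φ x‖ +
      Module.finrank ℝ (Ambient k m) * ‖fderiv ℝ (gradient φ) x‖ ≤ K) {t₁ t₂ : ℝ}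
    (h₁ : t₁ ∈ Ioo (-1 : ℝ) 1) (h₂ : t₂ ∈ Ioo (-1 : ℝ) 1) (h : t₁ < t₂) :
    ∫ x, φ x ∂(V t₂).mass - ∫ x, φ x ∂(V t₁).mass ≤ K * massBound k * (t₂ - t₁) := by
  have htest : IsTestFunction (cylinder k m 1) (Ioo (-1 : ℝ) 1) fun x (_ : ℝ) => φ x :=
    ⟨((hφ.of_le (by norm_num)).comp contDiff_fst).contDiffOn, fun x _ _ _ => h0 x,
      fun a b _ => ⟨tsupport φ, hcs, hU, fun t _ x hx => image_eq_zero_of_notMem_tsupport hx⟩⟩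
  have h3 := hf.integral_sub_le htest h₁ h₂ h (G := fun _ => K * massBound k) ?_
    (by unfold IntegrableOn; exact integrable_const _)
  · simpa [h.le, mul_comm] using h3
  intro t htm hu
  have ht : t ∈ Ioo (-1 : ℝ) 1 := ⟨h₁.1.trans htm.1, htm.2.trans h₂.2⟩
  have := hf.isFiniteMeasure ht
  have := hf.isFiniteMeasure_mass ht
  refine ((V t).brakke_le hu hφ hcs hU h0 (integrable_const K) ?_).trans
    (EReal.coe_le_coe_iff.2 ?_)
  · filter_upwards [hf.ae_tangent ht] with p hp
    have hU1 : ‖u p.1 t - p.2.1 (u p.1 t)‖ ≤ 1 :=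
      (p.2.norm_sub_apply_le _).trans ((hf.u_le t ht p.1 hp.1.1).trans hf.E_le)
    refine (Real.le_norm_self _).trans (le_trans ?_ (hK p.1))
    refine (norm_sub_le _ _).trans (add_le_add ((norm_add_le _ _).trans (add_le_add ?_ ?_)) ?_)
    · rw [Real.norm_of_nonneg (mul_nonneg (by linarith [h0 p.1]) (by positivity))]
      have h5 : ‖u p.1 t - p.2.1 (u p.1 t)‖ ^ 2 ≤ 1 := pow_le_one₀ (norm_nonneg _) hU1
      nlinarith [h0 p.1]
    · refine (norm_inner_le_norm _ _).trans ?_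
      nlinarith [norm_nonneg (gradient φ p.1)]
    · exact abs_hsInner_grass_le _ _
  · have hK0 : 0 ≤ K := le_trans (by have := h0 0; positivity) (hK 0)
    rw [integral_const, smul_eq_mul, mul_comm]
    refine mul_le_mul_of_nonneg_left ?_ hK0
    exact ENNReal.toReal_le_of_le_ofReal (massBound_nonneg k) (hf.mass_univ_le ht)

lemma exists_bound_derivatives {φ : Ambient k m → ℝ} (hφ : ContDiff ℝ 2 φ)
    (hcs : HasCompactSupport φ) : ∃ K, ∀ x, φ x / 4 + ‖gradient φ x‖ +
      Module.finrank ℝ (Ambient k m) * ‖fderiv ℝ (gradient φ) x‖ ≤ K := by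
  have hX := contDiff_gradient hφ
  have hXc : HasCompactSupport (gradient φ) :=
    hcs.of_isClosed_subset (isClosed_tsupport _) (tsupport_gradient_subset φ)
  obtain ⟨K0, h0⟩ := hφ.continuous.bounded_above_of_compact_support hcs
  obtain ⟨K1, h1⟩ := hX.continuous.bounded_above_of_compact_support hXc
  obtain ⟨K2, h2⟩ := (hX.continuous_fderiv (by norm_num)).bounded_above_of_compact_support
    (hXc.fderiv ℝ)
  refine ⟨K0 / 4 + K1 + Module.finrank ℝ (Ambient k m) * K2, fun x => ?_⟩
  have := (le_abs_self _).trans (h0 x)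
  gcongr
  · exact h1 x
  · exact h2 x

/-- The mass measures `‖V_t‖`, extended by zero to times outside `(-1, 1)`. -/
def flowMeasure (V : ℝ → Varifold (Ambient k m) k (cylinder k m 1)) (t : ℝ) :
    Measure (Ambient k m) :=
  open Classical in if t ∈ Ioo (-1 : ℝ) 1 then (V t).mass else 0

lemma flowMeasure_of_mem {t : ℝ} (ht : t ∈ Ioo (-1 : ℝ) 1) : flowMeasure V t = (V t).mass :=
  if_pos ht

lemma flowMeasure_of_notMem {t : ℝ} (ht : t ∉ Ioo (-1 : ℝ) 1) : flowMeasure V t = 0 :=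
  if_neg ht

lemma IsGraphFlow.flowMeasure_univ_le (hf : IsGraphFlow f V u F E) (t : ℝ) :
    flowMeasure V t univ ≤ ENNReal.ofReal (massBound k) := by
  by_cases ht : t ∈ Ioo (-1 : ℝ) 1
  · rw [flowMeasure_of_mem ht]; exact hf.mass_univ_le ht
  · rw [flowMeasure_of_notMem ht]; simp

lemma IsGraphFlow.isFiniteMeasure_flowMeasure (hf : IsGraphFlow f V u F E) (t : ℝ) :
    IsFiniteMeasure (flowMeasure V t) :=
  ⟨(hf.flowMeasure_univ_le t).trans_lt ENNReal.ofReal_lt_top⟩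

/-- Integrals of fixed test functions have bounded upper slope in time, so they are measurable. -/
lemma IsGraphFlow.measurable_integral (hf : IsGraphFlow f V u F E) {φ : Ambient k m → ℝ}
    (hφ : ContDiff ℝ 2 φ) (hcs : HasCompactSupport φ) (hU : tsupport φ ⊆ cylinder k m 1)
    (h0 : ∀ x, 0 ≤ φ x) : Measurable fun t => ∫ x, φ x ∂flowMeasure V t := by
  obtain ⟨K, hK⟩ := exists_bound_derivatives hφ hcs
  refine measurable_of_restrict_of_restrict_compl (measurableSet_Ioo (a := (-1 : ℝ)) (b := 1)) ?_ ?_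
  · have h1 : Antitone fun t : Ioo (-1 : ℝ) 1 =>
        ∫ x, φ x ∂(V t).mass - K * massBound k * (t : ℝ) := by
      intro s t hst
      rcases hst.eq_or_lt with rfl | hlt
      · rfl
      · have := hf.integral_sub_le_linear hφ hcs hU h0 hK s.2 t.2 hlt
        change _ - _ ≤ _ - _
        linarith
    have h2 := h1.measurable.add
      (measurable_subtype_coe.const_mul (K * massBound k) (f := fun t : Ioo (-1 : ℝ) 1 => (t : ℝ)))
    convert h2 using 1
    ext t
    simp [flowMeasure_of_mem t.2]
  · convert measurable_const (a := (0 : ℝ)) using 1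
    ext t
    simp [flowMeasure_of_notMem t.2]

lemma IsGraphFlow.flowMeasure_inter_cylinder (hf : IsGraphFlow f V u F E) (t : ℝ)
    (A : Set (Ambient k m)) : flowMeasure V t (A ∩ cylinder k m 1) = flowMeasure V t A := by
  by_cases ht : t ∈ Ioo (-1 : ℝ) 1
  · rw [flowMeasure_of_mem ht]
    refine measure_congr ?_
    filter_upwards [hf.ae_mem_graph ht] with z hz
    exact propext ⟨fun h => h.1, fun h => ⟨h, hz.1⟩⟩
  · simp [flowMeasure_of_notMem ht]

/-- The indicator of an open set is the pointwise limit of `C²` functions with compact support in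
the set and values in `[0, 1]`; hence it is enough to test measurability in time on such functions. -/
lemma exists_approx_indicator {A : Set (Ambient k m)} (hA : IsOpen A) :
    ∃ φ : ℕ → Ambient k m → ℝ, (∀ n, ContDiff ℝ 2 (φ n)) ∧ (∀ n, HasCompactSupport (φ n)) ∧
      (∀ n, tsupport (φ n) ⊆ A) ∧ (∀ n x, 0 ≤ φ n x ∧ φ n x ≤ 1) ∧
      ∀ x, Tendsto (fun n => φ n x) atTop (𝓝 (A.indicator (fun _ => (1 : ℝ)) x)) := by
  obtain ⟨p, hp1, hp2, hp3⟩ := hA.exists_contDiff_support_eq (n := 2)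
  have hp0 : ∀ x, 0 ≤ p x := fun x => (hp3 ⟨x, rfl⟩).1
  let φ : ℕ → Ambient k m → ℝ := fun n x =>
    Real.smoothTransition (n * p x - 1) * Real.smoothTransition (n - ‖x‖ ^ 2)
  have hsub : ∀ n, Function.support (φ n) ⊆ {x | 1 ≤ n * p x} ∩ Metric.closedBall 0 (n : ℝ) := by
    intro n x hx
    have hx' : φ n x ≠ 0 := hx
    constructor
    · by_contra hlt
      simp only [mem_ofPred_eq, not_le] at hlt
      exact hx' (by simp [φ, Real.smoothTransition.zero_of_nonpos
        (show (n : ℝ) * p x - 1 ≤ 0 by linarith)])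
    · by_contra hlt
      have hlt' : (n : ℝ) < ‖x‖ := by simpa using hlt
      have h1 : (n : ℝ) - ‖x‖ ^ 2 ≤ 0 := by
        rcases Nat.eq_zero_or_pos n with rfl | hn
        · simp
        · have : (1 : ℝ) ≤ n := by exact_mod_cast hn
          nlinarith
      exact hx' (by simp [φ, Real.smoothTransition.zero_of_nonpos h1])
  have hcl : ∀ n : ℕ, IsClosed ({x | 1 ≤ n * p x} ∩ Metric.closedBall (0 : Ambient k m) (n : ℝ)) :=
    fun n => (isClosed_le continuous_const (by have := hp2.continuous; fun_prop)).inter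
      Metric.isClosed_closedBall
  have hts : ∀ n, tsupport (φ n) ⊆ {x | 1 ≤ n * p x} ∩ Metric.closedBall 0 (n : ℝ) :=
    fun n => closure_minimal (hsub n) (hcl n)
  refine ⟨φ, fun n => ?_, fun n => ?_, fun n x hx => ?_, fun n x => ⟨?_, ?_⟩, fun x => ?_⟩
  · have h1 : ContDiff ℝ 2 fun x => (n : ℝ) * p x - 1 := (contDiff_const.mul hp2).sub contDiff_const
    have h2 : ContDiff ℝ 2 fun x : Ambient k m => (n : ℝ) - ‖x‖ ^ 2 :=
      contDiff_const.sub (contDiff_norm_sq ℝ)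
    have h3 : ContDiff ℝ 2 Real.smoothTransition := Real.smoothTransition.contDiff (n := 2)
    exact (h3.comp h1).mul (h3.comp h2)
  · exact (isCompact_closedBall (0 : Ambient k m) (n : ℝ)).of_isClosed_subset
      (isClosed_tsupport _) ((hts n).trans inter_subset_right)
  · have h1 : 1 ≤ n * p x := (hts n hx).1
    rw [← hp1, Function.mem_support]
    intro h2
    rw [h2, mul_zero] at h1
    linarith
  · exact mul_nonneg (Real.smoothTransition.nonneg _) (Real.smoothTransition.nonneg _)
  · exact mul_le_one₀ (Real.smoothTransition.le_one _) (Real.smoothTransition.nonneg _)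
      (Real.smoothTransition.le_one _)
  · by_cases hx : x ∈ A
    · have hpx : 0 < p x := lt_of_le_of_ne (hp0 x) (by
        rw [← hp1, Function.mem_support] at hx; exact hx.symm)
      rw [indicator_of_mem hx]
      refine tendsto_const_nhds.congr' ?_
      filter_upwards [tendsto_natCast_atTop_atTop.eventually_ge_atTop (2 / p x),
        tendsto_natCast_atTop_atTop.eventually_ge_atTop (‖x‖ ^ 2 + 1)] with n h1 h2
      rw [div_le_iff₀ hpx] at h1
      simp only [φ]
      rw [Real.smoothTransition.one_of_one_le (by linarith),
        Real.smoothTransition.one_of_one_le (by linarith), mul_one]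
    · rw [indicator_of_notMem hx]
      have hpx : p x = 0 := by
        rw [← hp1, Function.mem_support, not_not] at hx; exact hx
      refine tendsto_const_nhds.congr fun n => ?_
      simp [φ, hpx, Real.smoothTransition.zero_of_nonpos]

/-- The hypotheses contain no measurability in time. It follows from (B4), by which the integral of a
fixed test function is a monotone function of time up to a linear one. -/
lemma IsGraphFlow.measurable_flowMeasure (hf : IsGraphFlow f V u F E) :
    Measurable (flowMeasure V) := by
  have := hf.isFiniteMeasure_flowMeasure
  have hopen : ∀ A : Set (Ambient k m), IsOpen A → Measurable fun t => flowMeasure V t A := by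
    intro A hA
    obtain ⟨φ, h1, h2, h3, h4, h5⟩ := exists_approx_indicator (hA.inter (isOpen_cylinder 1))
    have hlim : ∀ t, Tendsto (fun n => ∫ x, φ n x ∂flowMeasure V t) atTop
        (𝓝 ((flowMeasure V t).real A)) := by
      intro t
      have h6 := tendsto_integral_of_dominated_convergence (μ := flowMeasure V t) (F := φ)
        (fun _ => (1 : ℝ)) (fun n => (h1 n).continuous.aestronglyMeasurable)
        (integrable_const _) (fun n => ae_of_all _ fun x => by
          rw [Real.norm_of_nonneg (h4 n x).1]; exact (h4 n x).2)
        (ae_of_all _ h5)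
      rw [integral_indicator_const _ (hA.inter (isOpen_cylinder 1)).measurableSet] at h6
      simpa [measureReal_def, hf.flowMeasure_inter_cylinder t A] using h6
    have h7 : Measurable fun t => (flowMeasure V t).real A :=
      measurable_of_tendsto_metrizable
        (fun n => hf.measurable_integral (h1 n) (h2 n) ((h3 n).trans inter_subset_right)
          fun x => (h4 n x).1) (tendsto_pi_nhds.2 hlim)
    simpa [measureReal_def, ENNReal.ofReal_toReal, measure_ne_top] using h7.ennreal_ofReal
  exact Measurable.measure_of_isPiSystem (BorelSpace.measurable_eq (α := Ambient k m))
    isPiSystem_isOpen hopen (hopen univ isOpen_univ)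

/-- The mass measures form a finite kernel in time; this supplies the measurability in `t` of all
integrals over `V_t`. -/
def IsGraphFlow.kernel (hf : IsGraphFlow f V u F E) :
    ProbabilityTheory.Kernel ℝ (Ambient k m) := ⟨flowMeasure V, hf.measurable_flowMeasure⟩

lemma IsGraphFlow.isFiniteKernel (hf : IsGraphFlow f V u F E) :
    ProbabilityTheory.IsFiniteKernel hf.kernel :=
  ⟨⟨_, ENNReal.ofReal_lt_top, hf.flowMeasure_univ_le⟩⟩

lemma IsGraphFlow.measurable_lintegral (hf : IsGraphFlow f V u F E)
    {G : ℝ → Ambient k m → ℝ≥0∞} (hG : Measurable (Function.uncurry G)) :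
    Measurable fun t => ∫⁻ z, G t z ∂flowMeasure V t := by
  have := hf.isFiniteKernel
  exact Measurable.lintegral_kernel_prod_right (κ := hf.kernel) hG

lemma IsGraphFlow.stronglyMeasurable_integral (hf : IsGraphFlow f V u F E)
    {G : ℝ → Ambient k m → ℝ} (hG : Measurable (Function.uncurry G)) :
    StronglyMeasurable fun t => ∫ z, G t z ∂flowMeasure V t := by
  have := hf.isFiniteKernel
  exact MeasureTheory.StronglyMeasurable.integral_kernel_prod_right (κ := hf.kernel)
    hG.stronglyMeasurable

/-- The integral in space of a bounded measurable function is integrable in time. -/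
lemma IsGraphFlow.integrableOn_integral (hf : IsGraphFlow f V u F E)
    {G : ℝ → Ambient k m → ℝ} (hG : Measurable (Function.uncurry G)) {C : ℝ} {a b : ℝ}
    (hC : ∀ t ∈ Ioo a b, ∀ᵐ z ∂flowMeasure V t, ‖G t z‖ ≤ C) :
    IntegrableOn (fun t => ∫ z, G t z ∂flowMeasure V t) (Ioo a b) := by
  have := hf.isFiniteMeasure_flowMeasure
  refine Measure.integrableOn_of_bounded (M := |C| * massBound k) (by simp)
    (hf.stronglyMeasurable_integral hG).aestronglyMeasurable ?_
  filter_upwards [ae_restrict_mem measurableSet_Ioo] with t ht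
  refine (norm_integral_le_of_norm_le_const (C := |C|)
    ((hC t ht).mono fun z hz => hz.trans (le_abs_self C))).trans ?_
  exact mul_le_mul_of_nonneg_left
    (ENNReal.toReal_le_of_le_ofReal (massBound_nonneg k) (hf.flowMeasure_univ_le t)) (abs_nonneg C)

/-- Nearby times have nearby heights: a bump around the later height would otherwise gain mass too
quickly. -/
lemma IsGraphFlow.exists_time_step (hf : IsGraphFlow f V u F E) :
    ∃ δ > 0, ∀ t₁ ∈ Ioo (-1 : ℝ) 1, ∀ t₂ ∈ Ioo (-1 : ℝ) 1, t₁ < t₂ → t₂ - t₁ < δ →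
      ‖f 0 t₂ - f 0 t₁‖ < 1 := by
  let ψ : ContDiffBump (0 : Ambient k m) := ⟨1 / 8, 1 / 4, by norm_num, by norm_num⟩
  have hψ : ContDiff ℝ 2 ψ := ψ.contDiff
  obtain ⟨K, hK⟩ := exists_bound_derivatives hψ ψ.hasCompactSupport
  set c : ℝ := volume.real (Metric.ball (0 : EuclideanSpace ℝ (Fin k)) (1 / 16))
  have hc : 0 < c :=
    ENNReal.toReal_pos (Metric.measure_ball_pos _ _ (by norm_num)).ne' measure_ball_lt_top.ne
  have hK0 : 0 ≤ K := le_trans (by have := ψ.nonneg (x := 0); positivity) (hK 0)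
  have hM := massBound_nonneg k
  refine ⟨c / (K * massBound k + 1), by positivity, fun t₁ h₁ t₂ h₂ hlt hδ => ?_⟩
  by_contra hge
  push Not at hge
  let y : Ambient k m := joinPt 0 (f 0 t₂)
  let φ : Ambient k m → ℝ := fun x => ψ (x - y)
  have hφ : ContDiff ℝ 2 φ := hψ.comp (contDiff_id.sub contDiff_const)
  have hsupp : ∀ x, φ x ≠ 0 → ‖x - y‖ < 1 / 4 := by
    intro x hx
    have : x - y ∈ Function.support ψ := hx
    rwa [ψ.support_eq, mem_ball_zero_iff] at this
  have hts : tsupport φ ⊆ Metric.closedBall y (1 / 4) :=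
    closure_minimal (fun x hx => by
      rw [Metric.mem_closedBall, dist_eq_norm]; exact (hsupp x hx).le) Metric.isClosed_closedBall
  have hcs : HasCompactSupport φ :=
    (isCompact_closedBall y (1 / 4)).of_isClosed_subset (isClosed_tsupport _) hts
  have hU : tsupport φ ⊆ cylinder k m 1 := by
    intro x hx
    have h1 := hts hx
    rw [Metric.mem_closedBall, dist_eq_norm] at h1
    have h2 := norm_base_le (x - y)
    simp only [base_sub, y, base_joinPt, sub_zero] at h2
    change ‖base x‖ < 1
    linarith
  have hgrad : ∀ x, gradient φ x = gradient ψ (x - y) := by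
    intro x
    simp only [gradient, φ, fderiv_comp_sub]
  have hK' : ∀ x, φ x / 4 + ‖gradient φ x‖ +
      Module.finrank ℝ (Ambient k m) * ‖fderiv ℝ (gradient φ) x‖ ≤ K := by
    intro x
    rw [show gradient φ = fun x => gradient ψ (x - y) from funext hgrad, fderiv_comp_sub]
    exact hK (x - y)
  have hmain := hf.integral_sub_le_linear hφ hcs hU (fun x => ψ.nonneg) hK' h₁ h₂ hlt
  have hzero : ∫ x, φ x ∂(V t₁).mass = 0 := by
    refine integral_eq_zero_of_ae ?_
    filter_upwards [hf.ae_mem_graph h₁] with z hz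
    by_contra hne
    have h1 := hsupp z hne
    have hz2 : height z = f (base z) t₁ := hz.2
    have h2 := norm_base_le (z - y)
    have h3 := norm_height_le (z - y)
    simp only [base_sub, height_sub, y, base_joinPt, height_joinPt, sub_zero] at h2 h3
    have h4 := (hf.lipschitz h₁).dist_le_mul (base z) (by simpa using hz.1) 0 (by simp)
    rw [dist_eq_norm, dist_eq_norm, sub_zero, NNReal.coe_one, one_mul, ← hz2] at h4
    have h5 : ‖f 0 t₂ - f 0 t₁‖ ≤ ‖height z - f 0 t₂‖ + ‖height z - f 0 t₁‖ := by
      rw [norm_sub_rev (height z) (f 0 t₂)]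
      simpa using norm_add_le (f 0 t₂ - height z) (height z - f 0 t₁)
    linarith
  have hpos : c ≤ ∫ x, φ x ∂(V t₂).mass := by
    have := hf.isFiniteMeasure_mass h₂
    have h1 : ENNReal.ofReal c ≤ ∫⁻ x, ENNReal.ofReal (φ x) ∂(V t₂).mass := by
      calc ENNReal.ofReal c = volume (Metric.ball (0 : EuclideanSpace ℝ (Fin k)) (1 / 16)) :=
            ofReal_measureReal (measure_ball_lt_top).ne
        _ = ∫⁻ x in Metric.ball (0 : EuclideanSpace ℝ (Fin k)) 1,
              (Metric.ball (0 : EuclideanSpace ℝ (Fin k)) (1 / 16)).indicator 1 x := by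
            rw [lintegral_indicator_one measurableSet_ball, Measure.restrict_apply
              measurableSet_ball, inter_eq_left.2 (Metric.ball_subset_ball (by norm_num))]
        _ ≤ _ := hf.lintegral_ball_le h₂ _
        _ ≤ _ := by
            refine lintegral_mono_ae ?_
            filter_upwards [hf.ae_mem_graph h₂] with z hz
            by_cases hzb : base z ∈ Metric.ball (0 : EuclideanSpace ℝ (Fin k)) (1 / 16)
            · rw [indicator_of_mem hzb]
              have hz2 : height z = f (base z) t₂ := hz.2
              have h4 := (hf.lipschitz h₂).dist_le_mul (base z) (by simpa using hz.1) 0 (by simp)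
              rw [dist_eq_norm, dist_eq_norm, sub_zero, NNReal.coe_one, one_mul, ← hz2] at h4
              have h5 : ‖base z‖ < 1 / 16 := by simpa using hzb
              have h6 := norm_sq_eq_base_add_height (z - y)
              simp only [base_sub, height_sub, y, base_joinPt, height_joinPt, sub_zero] at h6
              have h7 : ‖z - y‖ ≤ 1 / 8 := by
                refine le_of_sq_le_sq ?_ (by norm_num)
                have := norm_nonneg (height z - f 0 t₂)
                have := norm_nonneg (base z)
                change ‖z - joinPt 0 (f 0 t₂)‖ ^ 2 ≤ _
                rw [h6]
                nlinarith
              have h8 : φ z = 1 := ψ.one_of_mem_closedBall (mem_closedBall_zero_iff.2 h7)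
              simp [h8]
            · rw [indicator_of_notMem hzb]; simp
    obtain ⟨C, hC⟩ := hφ.continuous.bounded_above_of_compact_support hcs
    have hint : Integrable φ (V t₂).mass :=
      Integrable.of_bound hφ.continuous.aestronglyMeasurable C (ae_of_all _ hC)
    rw [← ofReal_integral_eq_lintegral_ofReal hint (ae_of_all _ fun x => ψ.nonneg)] at h1
    exact (ENNReal.ofReal_le_ofReal_iff (integral_nonneg fun x => ψ.nonneg)).1 h1
  rw [hzero, sub_zero] at hmain
  have h9 : c ≤ K * massBound k * (t₂ - t₁) := hpos.trans hmain
  rw [lt_div_iff₀ (by positivity)] at hδ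
  nlinarith

/-- The heights `f` are bounded on all of `B₁ × (-1, 1)`, although no bound is assumed: the Lipschitz
bound controls `f` in space, and finitely many time steps of fixed length cover `(-1, 1)`. -/
lemma IsGraphFlow.exists_height_bound (hf : IsGraphFlow f V u F E) :
    ∃ R > 0, ∀ t ∈ Ioo (-1 : ℝ) 1, ∀ x ∈ Metric.ball (0 : EuclideanSpace ℝ (Fin k)) 1,
      ‖f x t‖ < R := by
  obtain ⟨δ, hδ, hstep⟩ := hf.exists_time_step
  have hstep' : ∀ t₁ ∈ Ioo (-1 : ℝ) 1, ∀ t₂ ∈ Ioo (-1 : ℝ) 1, |t₂ - t₁| < δ →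
      ‖f 0 t₂‖ ≤ ‖f 0 t₁‖ + 1 := by
    intro t₁ h₁ t₂ h₂ h
    rcases lt_trichotomy t₁ t₂ with hlt | rfl | hlt
    · have := hstep t₁ h₁ t₂ h₂ hlt ((le_abs_self _).trans_lt h)
      have h2 := norm_sub_norm_le (f 0 t₂) (f 0 t₁)
      linarith
    · linarith
    · have := hstep t₂ h₂ t₁ h₁ hlt ((le_abs_self _).trans_lt (abs_sub_comm t₁ t₂ ▸ h))
      have h2 := norm_sub_norm_le (f 0 t₂) (f 0 t₁)
      rw [norm_sub_rev] at h2
      linarith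
  obtain ⟨N, hN⟩ := exists_nat_gt (1 / δ)
  have hN0 : 0 < (N : ℝ) := lt_trans (by positivity) hN
  have hind : ∀ n : ℕ, ∀ t ∈ Ioo (-1 : ℝ) 1, |t| < (n + 1) / N → ‖f 0 t‖ ≤ ‖f 0 0‖ + (n + 1) := by
    intro n
    induction n with
    | zero =>
      intro t ht h
      have h1 := hstep' 0 (by norm_num) t ht (by
        rw [sub_zero]
        refine h.trans ?_
        rw [div_lt_iff₀ hN0]
        rw [div_lt_iff₀ hδ] at hN
        push_cast; linarith)
      simpa using h1
    | succ n ih =>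
      intro t ht h
      set c : ℝ := (n + 1) / (n + 2)
      have hc0 : 0 < c := by positivity
      have hc1 : c < 1 := by rw [div_lt_one (by positivity)]; linarith
      have hct : |c * t| < (n + 1) / N := by
        rw [abs_mul, abs_of_pos hc0]
        calc c * |t| < c * ((↑(n + 1) + 1) / N) := by gcongr
          _ = _ := by simp only [c]; push_cast; field_simp; ring
      have hcI : c * t ∈ Ioo (-1 : ℝ) 1 := by
        rw [mem_Ioo, ← abs_lt, abs_mul, abs_of_pos hc0]
        have := abs_lt.2 ht
        nlinarith [abs_nonneg t]
      have h1 := ih (c * t) hcI hct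
      have h2 := hstep' (c * t) hcI t ht (by
        have h3 : t - c * t = (1 / (n + 2)) * t := by simp only [c]; field_simp; ring
        rw [h3, abs_mul, abs_of_pos (by positivity)]
        calc 1 / ((n : ℝ) + 2) * |t| < 1 / ((n : ℝ) + 2) * ((↑(n + 1) + 1) / N) := by gcongr
          _ = 1 / N := by push_cast; field_simp; ring
          _ < δ := by
            rw [div_lt_iff₀ hN0]
            rw [div_lt_iff₀ hδ] at hN
            linarith)
      push_cast
      linarith
  refine ⟨‖f 0 0‖ + (N + 1) + 2, by positivity, fun t ht x hx => ?_⟩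
  have h1 := hind N t ht (by
    have := abs_lt.2 ht
    refine this.trans ?_
    rw [lt_div_iff₀ hN0]; linarith)
  have h2 := (hf.lipschitz ht).dist_le_mul x hx 0 (by simp)
  rw [dist_eq_norm, dist_eq_norm, sub_zero, NNReal.coe_one, one_mul] at h2
  have h3 : ‖x‖ < 1 := by simpa using hx
  have h4 := norm_sub_norm_le (f x t) (f 0 t)
  linarith

end Flow

/-! ### Caloric quadratics and powers of the positive part -/

/-- The vector `(Σ_{ij} A_{lij} ξ_i ξ_j)_l`. -/
def quadTerm (A : Fin m → Fin k → Fin k → ℝ) (ξ : EuclideanSpace ℝ (Fin k)) :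
    EuclideanSpace ℝ (Fin m) := WithLp.toLp 2 fun l => ∑ i, ∑ j, A l i j * ξ i * ξ j

/-- The vector `(Σ_i A_{lii})_l`. -/
def traceTerm (A : Fin m → Fin k → Fin k → ℝ) : EuclideanSpace ℝ (Fin m) :=
  WithLp.toLp 2 fun l => ∑ i, A l i i

/-- The norm of the coefficients of the quadratic part. -/
def coeffNorm (A : Fin m → Fin k → Fin k → ℝ) : ℝ := √(∑ l, ∑ i, ∑ j, A l i j ^ 2)

/-- What is used of a caloric quadratic `g` with quadratic coefficients `A`: its dependence on time,
its exact second order Taylor formula along lines, and its Hessian. -/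
structure IsCaloric (g : EuclideanSpace ℝ (Fin k) → ℝ → EuclideanSpace ℝ (Fin m))
    (A : Fin m → Fin k → Fin k → ℝ) : Prop where
  time : ∀ x t, g x t = g x 0 + t • traceTerm A
  line : ∀ x ξ (s : ℝ), g (x + s • ξ) 0 =
    g x 0 + s • fderiv ℝ (fun y => g y 0) x ξ + (s ^ 2 / 2) • quadTerm A ξ
  smooth : ContDiff ℝ 2 fun x => g x 0
  hess : ∀ x t, hessNorm (fun y => g y t) x = coeffNorm A

lemma hasDerivAt_comp_line {E F : Type*} [NormedAddCommGroup E] [NormedSpace ℝ E]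
    [NormedAddCommGroup F] [NormedSpace ℝ F] {φ : E → F} (h : Differentiable ℝ φ) (x ξ : E)
    (s : ℝ) : HasDerivAt (fun s : ℝ => φ (x + s • ξ)) (fderiv ℝ φ (x + s • ξ) ξ) s := by
  have h1 : HasDerivAt (fun s : ℝ => x + s • ξ) ξ s := by
    simpa using ((hasDerivAt_id s).smul_const ξ).const_add x
  exact (h _).hasFDerivAt.comp_hasDerivAt s h1

lemma hasDerivAt_fderiv_line {E F : Type*} [NormedAddCommGroup E] [NormedSpace ℝ E]
    [NormedAddCommGroup F] [NormedSpace ℝ F] {φ : E → F} (h : ContDiff ℝ 2 φ) (x η ξ : E) :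
    HasDerivAt (fun s : ℝ => fderiv ℝ φ (x + s • η) ξ) (fderiv ℝ (fderiv ℝ φ) x η ξ) 0 := by
  have hc1 : ContDiff ℝ 1 (fderiv ℝ φ) := h.fderiv_right (by norm_num)
  have h1 := hasDerivAt_comp_line (hc1.differentiable (by norm_num)) x η 0
  rw [zero_smul, add_zero] at h1
  exact (h1.clm_apply (hasDerivAt_const (0 : ℝ) ξ)).congr_deriv (by simp)

/-- The second-order coefficients of `g` carry all the facts that the estimates use. -/
lemma CaloricQuadratic.exists_isCaloric
    {g : EuclideanSpace ℝ (Fin k) → ℝ → EuclideanSpace ℝ (Fin m)} (h : CaloricQuadratic g) :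
    ∃ A, IsCaloric g A := by
  obtain ⟨a, b, p, A, hA, hb, hg⟩ := h
  have htime : ∀ x t, g x t = g x 0 + t • traceTerm A := by
    intro x t
    ext l
    simp [hg, traceTerm, hb]
    ring
  have hsmooth : ContDiff ℝ 2 fun x => g x 0 := by
    rw [contDiff_euclidean]
    intro l
    simp only [hg]
    fun_prop
  let D : EuclideanSpace ℝ (Fin k) → EuclideanSpace ℝ (Fin k) → EuclideanSpace ℝ (Fin m) :=
    fun x ξ => WithLp.toLp 2 fun l =>
      ∑ i, p l i * ξ i + (1 / 2) * ∑ i, ∑ j, A l i j * (x i * ξ j + ξ i * x j)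
  have hline : ∀ x ξ (s : ℝ), g (x + s • ξ) 0 =
      g x 0 + s • D x ξ + (s ^ 2 / 2) • quadTerm A ξ := by
    intro x ξ s
    ext l
    simp only [hg, D, quadTerm, PiLp.add_apply, PiLp.smul_apply, smul_eq_mul, mul_zero, add_zero]
    have h1 : ∑ i, p l i * (x i + s * ξ i) = ∑ i, p l i * x i + s * ∑ i, p l i * ξ i := by
      rw [Finset.mul_sum, ← Finset.sum_add_distrib]
      exact Finset.sum_congr rfl fun i _ => by ring
    have h2 : ∑ i, ∑ j, A l i j * (x i + s * ξ i) * (x j + s * ξ j) =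
        ∑ i, ∑ j, A l i j * x i * x j + s * ∑ i, ∑ j, A l i j * (x i * ξ j + ξ i * x j) +
          s ^ 2 * ∑ i, ∑ j, A l i j * ξ i * ξ j := by
      simp only [Finset.mul_sum, ← Finset.sum_add_distrib]
      exact Finset.sum_congr rfl fun i _ => Finset.sum_congr rfl fun j _ => by ring
    rw [h1, h2]
    ring
  have hD : ∀ x ξ, fderiv ℝ (fun y => g y 0) x ξ = D x ξ := by
    intro x ξ
    have h2 := hasDerivAt_comp_line (hsmooth.differentiable (by norm_num)) x ξ 0
    rw [zero_smul, add_zero] at h2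
    have h4 : HasDerivAt (fun s : ℝ => g (x + s • ξ) 0) (D x ξ) 0 := by
      simp only [hline]
      have h5 : HasDerivAt (fun s : ℝ => s ^ 2 / 2) 0 0 := by
        simpa using ((hasDerivAt_id (0 : ℝ)).pow 2).div_const 2
      have h6 := (((hasDerivAt_id (0 : ℝ)).smul_const (D x ξ)).const_add (g x 0)).add
        (h5.smul_const (quadTerm A ξ))
      exact h6.congr_deriv (by simp)
    exact h2.unique h4
  refine ⟨A, htime, fun x ξ s => by rw [hline, hD], hsmooth, fun x t => ?_⟩
  have hgt : (fun y => g y t) = fun y => g y 0 + t • traceTerm A := funext fun y => htime y t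
  have hft : fderiv ℝ (fun y => g y t) = fderiv ℝ (fun y => g y 0) := by
    rw [hgt]; ext1 y; rw [fderiv_add_const]
  unfold hessNorm coeffNorm
  congr 1
  refine Finset.sum_congr rfl fun l _ => Finset.sum_congr rfl fun i _ =>
    Finset.sum_congr rfl fun j _ => ?_
  congr 1
  rw [iteratedFDeriv_two_apply, hft]
  simp only [Matrix.cons_val_zero, Matrix.cons_val_one]
  set e := fun i : Fin k => EuclideanSpace.single i (1 : ℝ)
  have h2 := hasDerivAt_fderiv_line hsmooth x (e i) (e j)
  have h6 : HasDerivAt (fun s : ℝ => fderiv ℝ (fun y => g y 0) (x + s • e i) (e j))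
      (WithLp.toLp 2 fun l => A l i j) 0 := by
    simp only [hD]
    have h7 : ∀ s : ℝ, D (x + s • e i) (e j) =
        D x (e j) + s • (WithLp.toLp 2 fun l => A l i j : EuclideanSpace ℝ (Fin m)) := by
      intro s
      ext l
      have h8 : ∀ y : EuclideanSpace ℝ (Fin k), D y (e j) l =
          p l j + (1 / 2) * (∑ i, A l i j * y i + ∑ i, A l j i * y i) := by
        intro y
        simp only [D, e, mul_add, Finset.sum_add_distrib]
        simp
      rw [PiLp.add_apply, h8, h8]
      simp only [PiLp.add_apply, PiLp.smul_apply, smul_eq_mul, mul_add, Finset.sum_add_distrib, e]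
      simp [hA l j i]
      ring
    simp only [h7]
    have h8 := ((hasDerivAt_id (0 : ℝ)).smul_const
      (WithLp.toLp 2 fun l => A l i j : EuclideanSpace ℝ (Fin m))).const_add (D x (e j))
    exact h8.congr_deriv (by simp)
  exact congrArg (fun y : EuclideanSpace ℝ (Fin m) => y l) (h2.unique h6)

section PosPow

/-- The `n`-th power of the positive part. -/
def posPow (n : ℕ) (y : ℝ) : ℝ := max y 0 ^ n

lemma posPow_nonneg (n : ℕ) (y : ℝ) : 0 ≤ posPow n y := pow_nonneg (le_max_right _ _) _

lemma posPow_of_nonpos {n : ℕ} (hn : n ≠ 0) {y : ℝ} (hy : y ≤ 0) : posPow n y = 0 := by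
  rw [posPow, max_eq_right hy, zero_pow hn]

lemma posPow_of_nonneg (n : ℕ) {y : ℝ} (hy : 0 ≤ y) : posPow n y = y ^ n := by
  rw [posPow, max_eq_left hy]

lemma continuous_posPow (n : ℕ) : Continuous (posPow n) := by unfold posPow; fun_prop

lemma hasDerivAt_posPow (n : ℕ) (y : ℝ) :
    HasDerivAt (posPow (n + 2)) ((n + 2) * posPow (n + 1) y) y := by
  rcases lt_trichotomy y 0 with h | rfl | h
  · rw [posPow_of_nonpos (by omega) h.le, mul_zero]
    refine (hasDerivAt_const y (0 : ℝ)).congr_of_eventuallyEq ?_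
    filter_upwards [Iio_mem_nhds h] with x hx
    exact posPow_of_nonpos (by omega) (le_of_lt hx)
  · rw [posPow_of_nonpos (by omega) le_rfl, mul_zero, hasDerivAt_iff_isLittleO_nhds_zero]
    simp only [zero_add, posPow_of_nonpos (show n + 2 ≠ 0 by omega) le_rfl, smul_zero, sub_zero]
    have h1 : (fun y : ℝ => posPow (n + 2) y) =O[𝓝 0] fun y : ℝ => y ^ (n + 2) := by
      refine Asymptotics.isBigO_of_le _ fun y => ?_
      rw [posPow, norm_pow, norm_pow]
      refine pow_le_pow_left₀ (norm_nonneg _) ?_ _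
      rw [Real.norm_of_nonneg (le_max_right _ _)]
      exact max_le (Real.le_norm_self y) (norm_nonneg y)
    exact h1.trans_isLittleO (by simpa using Asymptotics.isLittleO_pow_id (by omega : 1 < n + 2))
  · rw [posPow_of_nonneg _ h.le]
    have h1 : HasDerivAt (fun x : ℝ => x ^ (n + 2)) ((n + 2 : ℕ) * y ^ (n + 2 - 1)) y :=
      hasDerivAt_pow _ _
    rw [show n + 2 - 1 = n + 1 by omega] at h1
    push_cast at h1
    refine h1.congr_of_eventuallyEq ?_
    filter_upwards [Ioi_mem_nhds h] with x hx
    exact posPow_of_nonneg _ (le_of_lt hx)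

lemma contDiff_posPow (n j : ℕ) : ContDiff ℝ n (posPow (n + j + 1)) := by
  induction n generalizing j with
  | zero => exact contDiff_zero.2 (continuous_posPow _)
  | succ n ih =>
    have hd : deriv (posPow (n + 1 + j + 1)) = fun y => ((n + j : ℕ) + 2) * posPow (n + j + 1) y := by
      ext y
      have := (hasDerivAt_posPow (n + j) y).deriv
      rwa [show n + j + 2 = n + 1 + j + 1 by omega] at this
    push_cast
    rw [contDiff_succ_iff_deriv]
    refine ⟨fun y => ?_, by simp, ?_⟩
    · have := (hasDerivAt_posPow (n + j) y).differentiableAt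
      rwa [show n + j + 2 = n + 1 + j + 1 by omega] at this
    · rw [hd]
      exact contDiff_const.mul (ih j)

end PosPow

/-! ### The test functions and their derivatives -/

/-- The vertical distance vector of `z` to the graph of `g(·, t)`. -/
def offset (g : EuclideanSpace ℝ (Fin k) → ℝ → EuclideanSpace ℝ (Fin m)) (z : Ambient k m) (t : ℝ) :
    EuclideanSpace ℝ (Fin m) := height z - g (base z) t

lemma qDist_eq (g : EuclideanSpace ℝ (Fin k) → ℝ → EuclideanSpace ℝ (Fin m)) (z : Ambient k m)
    (t : ℝ) : qDist g z t = ‖offset g z t‖ ^ 2 / 2 := by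
  rw [qDist, EuclideanSpace.norm_sq_eq]
  simp [offset]
  ring

lemma qDist_nonneg (g : EuclideanSpace ℝ (Fin k) → ℝ → EuclideanSpace ℝ (Fin m)) (z : Ambient k m)
    (t : ℝ) : 0 ≤ qDist g z t := by rw [qDist_eq]; positivity

/-- The test function `(t - τ)₊² χ(height z) (r² - |base z|²)₊⁴ (Q_g + ε)^p`. -/
def testFn (g : EuclideanSpace ℝ (Fin k) → ℝ → EuclideanSpace ℝ (Fin m))
    (χ : EuclideanSpace ℝ (Fin m) → ℝ) (r τ p ε : ℝ) (z : Ambient k m) (t : ℝ) : ℝ :=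
  posPow 2 (t - τ) * (χ (height z) *
    (posPow 4 (r ^ 2 - ‖base z‖ ^ 2) * (qDist g z t + ε) ^ p))

section Calculus

variable {g : EuclideanSpace ℝ (Fin k) → ℝ → EuclideanSpace ℝ (Fin m)}
  {A : Fin m → Fin k → Fin k → ℝ} {χ : EuclideanSpace ℝ (Fin m) → ℝ} {r τ p ε : ℝ}

lemma IsCaloric.fderiv_eq (hg : IsCaloric g A) (t : ℝ) (x : EuclideanSpace ℝ (Fin k)) :
    fderiv ℝ (fun y => g y t) x = fderiv ℝ (fun y => g y 0) x := by
  rw [show (fun y => g y t) = fun y => g y 0 + t • traceTerm A from funext fun y => hg.time y t,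
    fderiv_add_const]

lemma IsCaloric.contDiff_offset (hg : IsCaloric g A) :
    ContDiff ℝ 2 fun q : Ambient k m × ℝ => offset g q.1 q.2 := by
  have h1 : (fun q : Ambient k m × ℝ => offset g q.1 q.2) =
      fun q => heightL k m q.1 - (g (baseL k m q.1) 0 + q.2 • traceTerm A) := by
    ext1 q
    rw [offset, hg.time, baseL_apply, heightL_apply]
  rw [h1]
  have h2 : ContDiff ℝ 2 fun q : Ambient k m × ℝ => g (baseL k m q.1) 0 :=
    hg.smooth.comp ((baseL k m).contDiff.comp contDiff_fst)
  exact ((heightL k m).contDiff.comp contDiff_fst).sub (h2.add (contDiff_snd.smul contDiff_const))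

lemma IsCaloric.contDiff_qDist (hg : IsCaloric g A) :
    ContDiff ℝ 2 fun q : Ambient k m × ℝ => qDist g q.1 q.2 := by
  simp only [qDist_eq]
  exact (hg.contDiff_offset.norm_sq ℝ).div_const 2

lemma IsCaloric.contDiff_power (hg : IsCaloric g A) (hε : 0 < ε) :
    ContDiff ℝ 2 fun q : Ambient k m × ℝ => (qDist g q.1 q.2 + ε) ^ p :=
  (hg.contDiff_qDist.add contDiff_const).rpow_const_of_ne
    fun q => (add_pos_of_nonneg_of_pos (qDist_nonneg g q.1 q.2) hε).ne'

lemma contDiff_cut : ContDiff ℝ 2 fun z : Ambient k m => posPow 4 (r ^ 2 - ‖base z‖ ^ 2) :=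
  (contDiff_posPow 2 1).comp (contDiff_const.sub ((baseL k m).contDiff.norm_sq ℝ))

lemma IsCaloric.contDiff_spatial (hg : IsCaloric g A) (hχ : ContDiff ℝ 2 χ) (hε : 0 < ε) :
    ContDiff ℝ 2 fun q : Ambient k m × ℝ => χ (height q.1) *
      (posPow 4 (r ^ 2 - ‖base q.1‖ ^ 2) * (qDist g q.1 q.2 + ε) ^ p) :=
  ((hχ.comp (heightL k m).contDiff).comp contDiff_fst).mul
    ((contDiff_cut.comp contDiff_fst).mul (hg.contDiff_power hε))

lemma IsCaloric.contDiff_testFn (hg : IsCaloric g A) (hχ : ContDiff ℝ 2 χ) (hε : 0 < ε) :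
    ContDiff ℝ 1 fun q : Ambient k m × ℝ => testFn g χ r τ p ε q.1 q.2 :=
  ((contDiff_posPow 1 0).comp (contDiff_snd.sub contDiff_const)).mul
    ((hg.contDiff_spatial hχ hε).of_le (by norm_num))

lemma IsCaloric.contDiff_testFn_slice (hg : IsCaloric g A) (hχ : ContDiff ℝ 2 χ) (hε : 0 < ε)
    (t : ℝ) : ContDiff ℝ 2 fun z : Ambient k m => testFn g χ r τ p ε z t :=
  contDiff_const.mul ((hg.contDiff_spatial hχ hε).comp (contDiff_id.prodMk contDiff_const))

lemma testFn_nonneg (hχ : ∀ y, 0 ≤ χ y) (hε : 0 < ε) (z : Ambient k m) (t : ℝ) :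
    0 ≤ testFn g χ r τ p ε z t := by
  have := qDist_nonneg g z t
  exact mul_nonneg (posPow_nonneg _ _) (mul_nonneg (hχ _)
    (mul_nonneg (posPow_nonneg _ _) (by positivity)))

/-- The time derivative of the test function. -/
def testFnDt (g : EuclideanSpace ℝ (Fin k) → ℝ → EuclideanSpace ℝ (Fin m))
    (A : Fin m → Fin k → Fin k → ℝ) (χ : EuclideanSpace ℝ (Fin m) → ℝ) (r τ p ε : ℝ)
    (z : Ambient k m) (t : ℝ) : ℝ :=
  χ (height z) * posPow 4 (r ^ 2 - ‖base z‖ ^ 2) *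
    (2 * posPow 1 (t - τ) * (qDist g z t + ε) ^ p -
      posPow 2 (t - τ) * (p * (qDist g z t + ε) ^ (p - 1)) * ⟪offset g z t, traceTerm A⟫)

lemma IsCaloric.hasDerivAt_testFn (hg : IsCaloric g A) (hε : 0 < ε) (z : Ambient k m) (t : ℝ) :
    HasDerivAt (fun s => testFn g χ r τ p ε z s) (testFnDt g A χ r τ p ε z t) t := by
  have h1 : HasDerivAt (fun s => posPow 2 (s - τ)) (2 * posPow 1 (t - τ)) t := by
    have := (hasDerivAt_posPow 0 (t - τ)).comp t ((hasDerivAt_id t).sub_const τ)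
    simpa [Function.comp_def] using this
  have h2 : HasDerivAt (fun s => offset g z s) (-traceTerm A) t := by
    have h3 : (fun s => offset g z s) = fun s => (height z - g (base z) 0) - s • traceTerm A := by
      ext1 s
      rw [offset, hg.time]; abel
    rw [h3]
    exact (((hasDerivAt_id t).smul_const (traceTerm A)).const_sub _).congr_deriv (by simp)
  have h4 : HasDerivAt (fun s => qDist g z s + ε) (-⟪offset g z t, traceTerm A⟫) t := by
    simp only [qDist_eq]
    exact ((h2.norm_sq.div_const 2).add_const ε).congr_deriv (by rw [inner_neg_right]; ring)
  have hpos : qDist g z t + ε ≠ 0 := (add_pos_of_nonneg_of_pos (qDist_nonneg g z t) hε).ne'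
  have h5 := h4.rpow_const (p := p) (Or.inl hpos)
  refine (h1.mul ((h5.const_mul (posPow 4 (r ^ 2 - ‖base z‖ ^ 2))).const_mul
    (χ (height z)))).congr_deriv ?_
  rw [testFnDt]; ring

lemma hasDerivAt_offset_line (hg : IsCaloric g A) (z v : Ambient k m) (t s : ℝ) :
    HasDerivAt (fun s : ℝ => offset g (z + s • v) t)
      ((height v - fderiv ℝ (fun y => g y 0) (base z) (base v)) - s • quadTerm A (base v)) s := by
  have h1 : (fun s : ℝ => offset g (z + s • v) t) = fun s => offset g z t +
      s • (height v - fderiv ℝ (fun y => g y 0) (base z) (base v)) -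
        (s ^ 2 / 2) • quadTerm A (base v) := by
    ext1 s
    rw [offset, offset, hg.time, hg.time (base z), base_add, base_smul, hg.line, height_add,
      height_smul, smul_sub]
    abel
  rw [h1]
  have h2 : HasDerivAt (fun s : ℝ => s ^ 2 / 2) s s := by
    exact (((hasDerivAt_id s).pow 2).div_const 2).congr_deriv (by simp)
  exact (((((hasDerivAt_id s).smul_const _).const_add _).sub
    (h2.smul_const (quadTerm A (base v))))).congr_deriv (by simp)

/-- First and second derivative of a product `y₊⁴ (q + ε)^p` along a line. -/
lemma hasDerivAt_cut_mul_power {Y Y' q q' : ℝ → ℝ} {Y'' q'' : ℝ} (hε : 0 < ε)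
    (hY : ∀ s, HasDerivAt Y (Y' s) s) (hY' : HasDerivAt Y' Y'' 0)
    (hq : ∀ s, HasDerivAt q (q' s) s) (hq' : HasDerivAt q' q'' 0) (hq0 : ∀ s, 0 ≤ q s) :
    (∀ s, HasDerivAt (fun s => posPow 4 (Y s) * (q s + ε) ^ p)
      (4 * posPow 3 (Y s) * Y' s * (q s + ε) ^ p +
        posPow 4 (Y s) * (p * (q s + ε) ^ (p - 1) * q' s)) s) ∧
    HasDerivAt (fun s => 4 * posPow 3 (Y s) * Y' s * (q s + ε) ^ p +
        posPow 4 (Y s) * (p * (q s + ε) ^ (p - 1) * q' s))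
      ((12 * posPow 2 (Y 0) * Y' 0 ^ 2 + 4 * posPow 3 (Y 0) * Y'') * (q 0 + ε) ^ p +
        2 * (4 * posPow 3 (Y 0) * Y' 0) * (p * (q 0 + ε) ^ (p - 1) * q' 0) +
        posPow 4 (Y 0) * (p * (p - 1) * (q 0 + ε) ^ (p - 2) * q' 0 ^ 2 +
          p * (q 0 + ε) ^ (p - 1) * q'')) 0 := by
  have hne : ∀ s, q s + ε ≠ 0 := fun s => (add_pos_of_nonneg_of_pos (hq0 s) hε).ne'
  have h4 : ∀ s, HasDerivAt (fun s => posPow 4 (Y s)) (4 * posPow 3 (Y s) * Y' s) s := fun s =>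
    ((hasDerivAt_posPow 2 (Y s)).comp s (hY s)).congr_deriv (by norm_num)
  have h3 : ∀ s, HasDerivAt (fun s => posPow 3 (Y s)) (3 * posPow 2 (Y s) * Y' s) s := fun s =>
    ((hasDerivAt_posPow 1 (Y s)).comp s (hY s)).congr_deriv (by norm_num)
  have hp : ∀ a s : ℝ, HasDerivAt (fun s => (q s + ε) ^ a) (a * (q s + ε) ^ (a - 1) * q' s) s :=
    fun a s => (((hq s).add_const ε).rpow_const (p := a) (Or.inl (hne s))).congr_deriv (by ring)
  refine ⟨fun s => (h4 s).mul (hp p s), ?_⟩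
  have h5 := ((((h3 0).const_mul 4).mul hY').mul (hp p 0)).add
    ((h4 0).mul (((hp (p - 1) 0).const_mul p).mul hq'))
  refine h5.congr_deriv ?_
  simp only [Pi.mul_apply]
  rw [show p - 1 - 1 = p - 2 by ring]
  ring

lemma hasDerivAt_norm_sq_line (x ξ : EuclideanSpace ℝ (Fin k)) (s : ℝ) :
    HasDerivAt (fun s : ℝ => r ^ 2 - ‖x + s • ξ‖ ^ 2) (-2 * ⟪x + s • ξ, ξ⟫) s := by
  have h1 : HasDerivAt (fun s : ℝ => x + s • ξ) ξ s :=
    (((hasDerivAt_id s).smul_const ξ).const_add x).congr_deriv (by simp)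
  exact (h1.norm_sq.const_sub (r ^ 2)).congr_deriv (by ring)

lemma hasDerivAt_inner_line (x ξ : EuclideanSpace ℝ (Fin k)) :
    HasDerivAt (fun s : ℝ => -2 * ⟪x + s • ξ, ξ⟫) (-2 * ‖ξ‖ ^ 2) 0 := by
  have h1 : HasDerivAt (fun s : ℝ => x + s • ξ) ξ 0 :=
    (((hasDerivAt_id (0 : ℝ)).smul_const ξ).const_add x).congr_deriv (by simp)
  refine ((h1.inner ℝ (hasDerivAt_const (0 : ℝ) ξ)).const_mul (-2)).congr_deriv ?_
  rw [inner_zero_right, zero_add, real_inner_self_eq_norm_sq]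

/-- First and second directional derivatives of the test function where `χ = 1`. -/
lemma IsCaloric.testFn_derivs (hg : IsCaloric g A) (hχ : ContDiff ℝ 2 χ) (hε : 0 < ε)
    {z : Ambient k m} (hχ1 : ∀ᶠ y in 𝓝 (height z), χ y = 1) (v : Ambient k m) (t : ℝ) :
    ⟪gradient (fun z => testFn g χ r τ p ε z t) z, v⟫ =
      posPow 2 (t - τ) * (-8 * posPow 3 (r ^ 2 - ‖base z‖ ^ 2) * ⟪base z, base v⟫ *
        (qDist g z t + ε) ^ p + posPow 4 (r ^ 2 - ‖base z‖ ^ 2) *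
        (p * (qDist g z t + ε) ^ (p - 1) *
          ⟪offset g z t, height v - fderiv ℝ (fun y => g y 0) (base z) (base v)⟫)) ∧
    ⟪fderiv ℝ (gradient fun z => testFn g χ r τ p ε z t) z v, v⟫ =
      posPow 2 (t - τ) * ((48 * posPow 2 (r ^ 2 - ‖base z‖ ^ 2) * ⟪base z, base v⟫ ^ 2 -
          8 * posPow 3 (r ^ 2 - ‖base z‖ ^ 2) * ‖base v‖ ^ 2) * (qDist g z t + ε) ^ p -
        16 * posPow 3 (r ^ 2 - ‖base z‖ ^ 2) * ⟪base z, base v⟫ *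
          (p * (qDist g z t + ε) ^ (p - 1) *
            ⟪offset g z t, height v - fderiv ℝ (fun y => g y 0) (base z) (base v)⟫) +
        posPow 4 (r ^ 2 - ‖base z‖ ^ 2) * (p * (p - 1) * (qDist g z t + ε) ^ (p - 2) *
            ⟪offset g z t, height v - fderiv ℝ (fun y => g y 0) (base z) (base v)⟫ ^ 2 +
          p * (qDist g z t + ε) ^ (p - 1) *
            (‖height v - fderiv ℝ (fun y => g y 0) (base z) (base v)‖ ^ 2 -
              ⟪offset g z t, quadTerm A (base v)⟫))) := by
  set x := base z
  set ξ := base v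
  set w := offset g z t with hw
  set B := height v - fderiv ℝ (fun y => g y 0) x ξ
  have hoff := hasDerivAt_offset_line hg z v t
  let q : ℝ → ℝ := fun s => qDist g (z + s • v) t
  let q' : ℝ → ℝ := fun s => ⟪offset g (z + s • v) t, B - s • quadTerm A ξ⟫
  have hq : ∀ s, HasDerivAt q (q' s) s := fun s => by
    simp only [q, qDist_eq]
    exact ((hoff s).norm_sq.div_const 2).congr_deriv (by simp only [q', B, x, ξ]; ring)
  have hq' : HasDerivAt q' (‖B‖ ^ 2 - ⟪w, quadTerm A ξ⟫) 0 := by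
    have h1 : HasDerivAt (fun s : ℝ => B - s • quadTerm A ξ) (-quadTerm A ξ) 0 :=
      (((hasDerivAt_id (0 : ℝ)).smul_const (quadTerm A ξ)).const_sub B).congr_deriv (by simp)
    refine ((hoff 0).inner ℝ h1).congr_deriv ?_
    simp only [zero_smul, add_zero, sub_zero, inner_neg_right]
    rw [← hw, real_inner_self_eq_norm_sq]
    ring
  obtain ⟨hN, hN'⟩ := hasDerivAt_cut_mul_power (p := p) hε (hasDerivAt_norm_sq_line (r := r) x ξ)
    (hasDerivAt_inner_line x ξ) hq hq' (fun s => qDist_nonneg g _ t)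
  have hq0 : q 0 = qDist g z t := by simp [q]
  have hq'0 : q' 0 = ⟪w, B⟫ := by simp [q', w]
  have hline : ∀ᶠ s in 𝓝 (0 : ℝ), testFn g χ r τ p ε (z + s • v) t =
      posPow 2 (t - τ) * (posPow 4 (r ^ 2 - ‖x + s • ξ‖ ^ 2) * (q s + ε) ^ p) := by
    have hc : Tendsto (fun s : ℝ => height (z + s • v)) (𝓝 0) (𝓝 (height z)) := by
      have : Continuous fun s : ℝ => height (z + s • v) := by fun_prop
      simpa using this.tendsto 0
    filter_upwards [hc.eventually hχ1] with s hs
    rw [testFn, hs, one_mul, base_add, base_smul]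
  have hC := hg.contDiff_testFn_slice (r := r) (τ := τ) (p := p) hχ hε t
  constructor
  · rw [gradient_inner]
    have h1 := hasDerivAt_comp_line (hC.differentiable (by norm_num)) z v 0
    have h2 := ((hN 0).const_mul (posPow 2 (t - τ))).congr_of_eventuallyEq hline
    have h3 := h1.unique h2
    rw [zero_smul, add_zero] at h3
    rw [h3, hq0, hq'0, zero_smul, add_zero]
    ring
  · rw [inner_fderiv_gradient hC hline
      (Eventually.of_forall fun s => (hN s).const_mul (posPow 2 (t - τ)))
      (hN'.const_mul (posPow 2 (t - τ))), hq0, hq'0, zero_smul, add_zero]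
    ring

end Calculus

/-! ### The pointwise differential inequality -/

/-- Absorbing the mixed term of a second derivative: the bad term `ρ³ c e` is split between the good
term `ρ⁴ g` and the zeroth order term `w²`. -/
lemma neg_second_deriv_le {ρ P D P₂ c d e g b W : ℝ} (hρ0 : 0 ≤ ρ) (hρ1 : ρ ≤ 1) (hP : 0 ≤ P)
    (hD : 0 ≤ D) (hP₂ : 0 ≤ P₂) (hd0 : 0 ≤ d) (hd : d ≤ 1) (hc : c ^ 2 ≤ 1) (he : e ^ 2 ≤ W * g)
    (hg : 0 ≤ g) (hW : 0 ≤ W) :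
    -((48 * ρ ^ 2 * c ^ 2 - 8 * ρ ^ 3 * d) * P - 16 * ρ ^ 3 * c * (D * e) +
        ρ ^ 4 * (P₂ * e ^ 2 + D * (g - b))) ≤
      8 * P + 128 * W * D - ρ ^ 4 * D * g / 2 + ρ ^ 4 * D * b := by
  have h1 : 16 * ρ * (c * e) ≤ ρ ^ 2 * g / 2 + 128 * W := by
    refine (le_abs_self _).trans (abs_le_of_sq_le_sq ?_ (by positivity))
    have h2 : (c * e) ^ 2 ≤ W * g := by
      rw [mul_pow]
      nlinarith [sq_nonneg e, sq_nonneg c]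
    have h3 : ρ ^ 2 * (c * e) ^ 2 ≤ ρ ^ 2 * (W * g) := by gcongr
    nlinarith [sq_nonneg (ρ ^ 2 * g / 2 - 128 * W)]
  have h4 : ρ ^ 2 * D * (16 * ρ * (c * e)) ≤ ρ ^ 2 * D * (ρ ^ 2 * g / 2 + 128 * W) := by gcongr
  have h5 : ρ ^ 2 * (128 * W * D) ≤ 128 * W * D :=
    mul_le_of_le_one_left (by positivity) (pow_le_one₀ hρ0 hρ1)
  have h6 : ρ ^ 3 * d * (8 * P) ≤ 8 * P :=
    mul_le_of_le_one_left (by positivity) (mul_le_one₀ (pow_le_one₀ hρ0 hρ1) hd0 hd)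
  have h7 : 0 ≤ 48 * ρ ^ 2 * c ^ 2 * P := by positivity
  have h8 : 0 ≤ ρ ^ 4 * (P₂ * e ^ 2) := by positivity
  nlinarith

/-- The constant of the local energy inequality. -/
def energyConst (k m : ℕ) : ℝ := 1100 * (k + m + 1)

lemma energyConst_pos (k m : ℕ) : 0 < energyConst k m := by unfold energyConst; positivity

/-- The good term `φ-weight · p s^{p-1} |∇f - ∇g|²` produced by the energy inequality; `N` stands for
`|∇f - ∇g|²`. -/
def goodTerm (g : EuclideanSpace ℝ (Fin k) → ℝ → EuclideanSpace ℝ (Fin m)) (r τ p ε : ℝ)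
    (z : Ambient k m) (t N : ℝ) : ℝ :=
  posPow 2 (t - τ) * posPow 4 (r ^ 2 - ‖base z‖ ^ 2) * (p * (qDist g z t + ε) ^ (p - 1)) * N

section Pointwise

variable {g : EuclideanSpace ℝ (Fin k) → ℝ → EuclideanSpace ℝ (Fin m)}
  {A : Fin m → Fin k → Fin k → ℝ} {χ : EuclideanSpace ℝ (Fin m) → ℝ} {r τ p ε F E : ℝ}

set_option maxHeartbeats 1000000 in
/-- The pointwise inequality behind the energy estimate: on a tangent plane `S = {(ξ, L ξ)}` the heat
operator `∂_t - S · ∇²` applied to the test function is at most a multiple of `p (Q_g + ε)^p` minus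
the good term, because `∂_t g = T · ∇²g` and `T - S` is quadratic in `L` on horizontal vectors. -/
lemma IsCaloric.pointwise_le (hg : IsCaloric g A) (hχ : ContDiff ℝ 2 χ) (hp : 1 ≤ p)
    (hr0 : 0 < r) (hr : r ≤ 1)
    (hε : 0 < ε) (hE : E ≤ 1) (hεE : E ^ 2 + (coeffNorm A * F ^ 2) ^ 2 ≤ ε)
    {z U : Ambient k m} (hχ1 : ∀ᶠ y in 𝓝 (height z), χ y = 1) {t : ℝ} (ht1 : t < 1) (hτ : -1 < τ)
    (hz : ‖base z‖ < 1)
    {S : Grass (Ambient k m) k} {L : EuclideanSpace ℝ (Fin k) →L[ℝ] EuclideanSpace ℝ (Fin m)}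
    (hS : IsGraphPlane S L) (hL : gradNorm L ≤ F) (hF : F ≤ 1) (hU : ‖U‖ ≤ E)
    (hDg : gradNorm (fderiv ℝ (fun y => g y 0) (base z)) ≤ 1) :
    testFn g χ r τ p ε z t / 4 * ‖U‖ ^ 2 + ⟪gradient (fun z => testFn g χ r τ p ε z t) z, U⟫ -
        hsInner (fderiv ℝ (gradient fun z => testFn g χ r τ p ε z t) z) S.1 ≤
      -testFnDt g A χ r τ p ε z t -
        goodTerm g r τ p ε z t (gradNorm (L - fderiv ℝ (fun y => g y 0) (base z)) ^ 2) / 4 +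
        (Metric.ball (0 : EuclideanSpace ℝ (Fin k)) r).indicator
          (fun _ => energyConst k m * p * (qDist g z t + ε) ^ p) (base z) := by
  have hder := fun v => hg.testFn_derivs (r := r) (τ := τ) (p := p) hχ hε hχ1 v t
  have hχz : χ (height z) = 1 := hχ1.self_of_nhds
  rw [hsInner_grass (EuclideanSpace.basisFun (Fin k ⊕ Fin m) ℝ), (hder U).1]
  simp only [(hder _).2]
  set x := base z with hx
  set Dg := fderiv ℝ (fun y => g y 0) x
  have hbase : ∀ a, base (S.1 (EuclideanSpace.basisFun (Fin k ⊕ Fin m) ℝ a)) = planeVec S a :=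
    fun a => rfl
  have hB : ∀ a, height (S.1 (EuclideanSpace.basisFun (Fin k ⊕ Fin m) ℝ a)) - Dg (planeVec S a) =
      (L - Dg) (planeVec S a) := by
    intro a
    rw [hS, hbase]; rfl
  simp only [hbase, hB]
  set M := L - Dg
  set w := offset g z t with hw
  set s := qDist g z t + ε with hs
  have hQ : ‖w‖ ^ 2 = 2 * qDist g z t := by rw [qDist_eq]; ring
  have hQ0 := qDist_nonneg g z t
  have hs0 : 0 < s := by positivity
  have hp0 : 0 < p := by linarith
  by_cases hxr : x ∈ Metric.ball (0 : EuclideanSpace ℝ (Fin k)) r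
  swap
  · have hρ : r ^ 2 - ‖x‖ ^ 2 ≤ 0 := by
      have : r ≤ ‖x‖ := by simpa using hxr
      linarith [pow_le_pow_left₀ hr0.le this 2]
    rw [indicator_of_notMem hxr]
    simp only [testFn, testFnDt, goodTerm, ← hx, posPow_of_nonpos (show 2 ≠ 0 by norm_num) hρ,
      posPow_of_nonpos (show 3 ≠ 0 by norm_num) hρ, posPow_of_nonpos (show 4 ≠ 0 by norm_num) hρ]
    simp
  rw [indicator_of_mem hxr]
  simp only [testFn, testFnDt, goodTerm, ← hx, hχz, posPow, ← hw, ← hs, one_mul, pow_one]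
  set ρ := max (r ^ 2 - ‖x‖ ^ 2) 0 with hρ
  set σ := max (t - τ) 0 with hσ
  have hρ0 : 0 ≤ ρ := le_max_right _ _
  have hρ1 : ρ ≤ 1 := max_le (by linarith [sq_nonneg ‖x‖, pow_le_one₀ (n := 2) hr0.le hr]) zero_le_one
  have hσ0 : 0 ≤ σ := le_max_right _ _
  have hσ2 : σ ≤ 2 := max_le (by linarith) zero_le_two
  set P := s ^ p with hP
  set D := p * s ^ (p - 1) with hD
  have hP0 : 0 < P := Real.rpow_pos_of_pos hs0 p
  have hD0 : 0 < D := mul_pos hp0 (Real.rpow_pos_of_pos hs0 _)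
  have hDs : D * s = p * P := by
    rw [hD, hP, Real.rpow_sub_one hs0.ne']; field_simp
  have hF0 : 0 ≤ F := (gradNorm_nonneg L).trans hL
  have hU0 := norm_nonneg U
  have hE0 : 0 ≤ E := hU0.trans hU
  set G := ∑ a, ‖M (planeVec S a)‖ ^ 2 with hG
  set b : ℝ := ∑ a, ⟪w, quadTerm A (planeVec S a)⟫ with hb
  -- the second derivatives along the projected basis vectors
  have hsum : -∑ a : Fin k ⊕ Fin m, σ ^ 2 * ((48 * ρ ^ 2 * ⟪x, planeVec S a⟫ ^ 2 -
        8 * ρ ^ 3 * ‖planeVec S a‖ ^ 2) * P -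
        16 * ρ ^ 3 * ⟪x, planeVec S a⟫ * (D * ⟪w, M (planeVec S a)⟫) +
        ρ ^ 4 * (p * (p - 1) * s ^ (p - 2) * ⟪w, M (planeVec S a)⟫ ^ 2 +
          D * (‖M (planeVec S a)‖ ^ 2 - ⟪w, quadTerm A (planeVec S a)⟫))) ≤
      σ ^ 2 * ((k + m) * (8 * P + 128 * ‖w‖ ^ 2 * D) - ρ ^ 4 * D * G / 2 + ρ ^ 4 * D * b) := by
    rw [← Finset.mul_sum, ← mul_neg, ← Finset.sum_neg_distrib]
    refine mul_le_mul_of_nonneg_left ?_ (by positivity)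
    refine (Finset.sum_le_sum fun a _ => neg_second_deriv_le (W := ‖w‖ ^ 2) hρ0 hρ1 hP0.le hD0.le
      ?_ (by positivity) ?_ ?_ ?_ (by positivity) (by positivity)).trans (le_of_eq ?_)
    · have := Real.rpow_pos_of_pos hs0 (p - 2)
      have : 0 ≤ p - 1 := by linarith
      positivity
    · exact pow_le_one₀ (norm_nonneg _) (norm_planeVec_le S a)
    · rw [sq_le_one_iff_abs_le_one]
      exact (abs_real_inner_le_norm _ _).trans
        (mul_le_one₀ hz.le (norm_nonneg _) (norm_planeVec_le S a))
    · rw [← mul_pow, ← sq_abs]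
      exact pow_le_pow_left₀ (abs_nonneg _) (abs_real_inner_le_norm _ _) 2
    · rw [Finset.sum_add_distrib, Finset.sum_sub_distrib, ← Finset.mul_sum, hG, hb,
        ← Finset.sum_div, ← Finset.mul_sum]
      simp [mul_add]
  -- the caloric defect
  have hdef : b - ⟪w, traceTerm A⟫ ≤ (‖w‖ ^ 2 + (coeffNorm A * F ^ 2) ^ 2) / 2 := by
    have h1 := hS.abs_trace_defect_le A w
    have h2 : b - ⟪w, traceTerm A⟫ = -∑ l, w l * (∑ i, A l i i -
        ∑ a, ∑ i, ∑ j, A l i j * planeVec S a i * planeVec S a j) := by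
      have hb' : b = ∑ l, w l *
          ∑ a, ∑ i, ∑ j, A l i j * planeVec S a i * planeVec S a j := by
        simp only [hb, quadTerm, PiLp.inner_apply]
        rw [Finset.sum_comm]
        refine Finset.sum_congr rfl fun l _ => ?_
        rw [Finset.mul_sum]
        exact Finset.sum_congr rfl fun a _ => mul_comm _ _
      have ht' : ⟪w, traceTerm A⟫ = ∑ l, w l * ∑ i, A l i i := by
        simp only [traceTerm, PiLp.inner_apply]
        exact Finset.sum_congr rfl fun l _ => mul_comm _ _
      rw [hb', ht']
      simp only [mul_sub, Finset.sum_sub_distrib]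
      ring
    have h3 : ‖w‖ * coeffNorm A * gradNorm L ^ 2 ≤ ‖w‖ * (coeffNorm A * F ^ 2) := by
      rw [mul_assoc]
      have : 0 ≤ coeffNorm A := Real.sqrt_nonneg _
      have := gradNorm_nonneg L
      gcongr
    rw [h2]
    refine (neg_le_abs _).trans (h1.trans (h3.trans ?_))
    linarith [two_mul_le_add_sq ‖w‖ (coeffNorm A * F ^ 2)]
  have hGM : gradNorm M ^ 2 / 2 ≤ G := hS.half_gradNorm_sq_le (hL.trans hF) M
  -- the terms with the vector field `U`
  have hUx : |⟪x, base U⟫| ≤ 1 :=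
    (abs_real_inner_le_norm _ _).trans
      (mul_le_one₀ hz.le (norm_nonneg _) ((norm_base_le U).trans (hU.trans hE)))
  have hUw : ⟪w, height U - Dg (base U)⟫ ≤ ‖w‖ ^ 2 + E ^ 2 := by
    have h1 : ‖height U - Dg (base U)‖ ≤ 2 * E := by
      have h2 := norm_apply_le_gradNorm Dg (base U)
      have h3 := norm_sub_le (height U) (Dg (base U))
      have h4 := norm_base_le U
      have h5 := norm_height_le U
      have h6 : gradNorm Dg * ‖base U‖ ≤ 1 * ‖base U‖ := by gcongr
      linarith
    refine (real_inner_le_norm _ _).trans ?_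
    have : ‖w‖ * ‖height U - Dg (base U)‖ ≤ ‖w‖ * (2 * E) := by gcongr
    linarith [two_mul_le_add_sq ‖w‖ E]
  have hσ4 : σ ^ 2 ≤ 4 := (pow_le_pow_left₀ hσ0 hσ2 2).trans (by norm_num)
  have hρ4 : ρ ^ 4 ≤ 1 := pow_le_one₀ hρ0 hρ1
  have hρ3 : ρ ^ 3 ≤ 1 := pow_le_one₀ hρ0 hρ1
  have hWs : ‖w‖ ^ 2 ≤ 2 * s := by rw [hQ, hs]; linarith
  have hEs : ‖w‖ ^ 2 + E ^ 2 ≤ 2 * s := by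
    rw [hQ, hs]; linarith [sq_nonneg (coeffNorm A * F ^ 2), sq_nonneg E]
  have hΛs : ‖w‖ ^ 2 + (coeffNorm A * F ^ 2) ^ 2 ≤ 2 * s := by
    rw [hQ, hs]; linarith [sq_nonneg (coeffNorm A * F ^ 2), sq_nonneg E]
  have hPp : P ≤ p * P := le_mul_of_one_le_left hP0.le hp
  have hn : (0 : ℝ) ≤ (k : ℝ) + m := by positivity
  have hσρ : σ ^ 2 * ρ ^ 4 ≤ 4 := by
    calc σ ^ 2 * ρ ^ 4 ≤ 4 * 1 := by gcongr
      _ = 4 := by norm_num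
  have t1 : σ ^ 2 * (ρ ^ 4 * P) / 4 * ‖U‖ ^ 2 ≤ p * P := by
    have h1 : ‖U‖ ^ 2 ≤ 1 := pow_le_one₀ hU0 (hU.trans hE)
    calc σ ^ 2 * (ρ ^ 4 * P) / 4 * ‖U‖ ^ 2 ≤ σ ^ 2 * (ρ ^ 4 * P) / 4 * 1 := by gcongr
      _ = σ ^ 2 * ρ ^ 4 * P / 4 := by ring
      _ ≤ 4 * P / 4 := by gcongr
      _ ≤ _ := by linarith
  have t2 : σ ^ 2 * (-8 * ρ ^ 3 * ⟪x, base U⟫ * P) ≤ 32 * (p * P) := by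
    have h1 : -⟪x, base U⟫ ≤ 1 := (neg_le_abs _).trans hUx
    calc σ ^ 2 * (-8 * ρ ^ 3 * ⟪x, base U⟫ * P) = σ ^ 2 * (8 * ρ ^ 3 * P) * -⟪x, base U⟫ := by ring
      _ ≤ σ ^ 2 * (8 * ρ ^ 3 * P) * 1 := by gcongr
      _ ≤ 4 * (8 * 1 * P) * 1 := by gcongr
      _ ≤ _ := by linarith
  have t3 : σ ^ 2 * (ρ ^ 4 * (D * ⟪w, height U - Dg (base U)⟫)) ≤ 8 * (p * P) := by
    calc σ ^ 2 * (ρ ^ 4 * (D * ⟪w, height U - Dg (base U)⟫))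
        = σ ^ 2 * ρ ^ 4 * (D * ⟪w, height U - Dg (base U)⟫) := by ring
      _ ≤ σ ^ 2 * ρ ^ 4 * (D * (2 * s)) := by gcongr; exact hUw.trans hEs
      _ ≤ 4 * (D * (2 * s)) := by gcongr
      _ = 8 * (D * s) := by ring
      _ = _ := by rw [hDs]
  have t4 : σ ^ 2 * ((k + m) * (8 * P + 128 * ‖w‖ ^ 2 * D)) ≤ (k + m) * (1056 * (p * P)) := by
    calc σ ^ 2 * ((k + m) * (8 * P + 128 * ‖w‖ ^ 2 * D))
        ≤ 4 * ((k + m) * (8 * (p * P) + 128 * (2 * s) * D)) := by gcongr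
      _ = (k + m) * (32 * (p * P) + 1024 * (D * s)) := by ring
      _ = _ := by rw [hDs]; ring
  have t5 : σ ^ 2 * (ρ ^ 4 * D * (b - ⟪w, traceTerm A⟫)) ≤ 4 * (p * P) := by
    calc σ ^ 2 * (ρ ^ 4 * D * (b - ⟪w, traceTerm A⟫))
        = σ ^ 2 * ρ ^ 4 * (D * (b - ⟪w, traceTerm A⟫)) := by ring
      _ ≤ σ ^ 2 * ρ ^ 4 * (D * s) := by gcongr; linarith
      _ ≤ 4 * (D * s) := by gcongr
      _ = _ := by rw [hDs]
  have t6 : ρ ^ 4 * (2 * σ * P) ≤ 4 * (p * P) := by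
    calc ρ ^ 4 * (2 * σ * P) ≤ 1 * (2 * 2 * (p * P)) := by gcongr
      _ = _ := by ring
  have t7 : σ ^ 2 * (ρ ^ 4 * D * (gradNorm M ^ 2 / 2)) ≤ σ ^ 2 * (ρ ^ 4 * D * G) := by gcongr
  have hCn : energyConst k m * p * P = 1100 * (k + m) * (p * P) + 1100 * (p * P) := by
    rw [energyConst]; ring
  have hnP : 0 ≤ (k + m) * (p * P) := by positivity
  have hpP : 0 ≤ p * P := by positivity
  rw [hCn]
  rw [sub_eq_add_neg (_ + _) (Finset.sum _ _)]
  refine (add_le_add_right hsum _).trans ?_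
  linarith

end Pointwise

/-! ### The local energy inequality -/

/-- `|∇f - ∇g|²` on `B₁ᵏ × (-1, 1)`, extended by zero; the gradient of `g` does not depend on time. -/
def gradDiffSq (f g : EuclideanSpace ℝ (Fin k) → ℝ → EuclideanSpace ℝ (Fin m))
    (x : EuclideanSpace ℝ (Fin k)) (t : ℝ) : ℝ :=
  (Metric.ball (0 : EuclideanSpace ℝ (Fin k)) 1 ×ˢ Ioo (-1 : ℝ) 1).indicator
    (fun q => gradNorm (fderiv ℝ (fun y => f y q.2) q.1 - fderiv ℝ (fun y => g y 0) q.1) ^ 2) (x, t)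

lemma gradDiffSq_nonneg (f g : EuclideanSpace ℝ (Fin k) → ℝ → EuclideanSpace ℝ (Fin m))
    (x : EuclideanSpace ℝ (Fin k)) (t : ℝ) : 0 ≤ gradDiffSq f g x t :=
  indicator_nonneg (fun _ _ => sq_nonneg _) _

section Flow

variable {f : EuclideanSpace ℝ (Fin k) → ℝ → EuclideanSpace ℝ (Fin m)}
    {V : ℝ → Varifold (Ambient k m) k (cylinder k m 1)} {u : Ambient k m → ℝ → Ambient k m}
    {F E : ℝ} {g : EuclideanSpace ℝ (Fin k) → ℝ → EuclideanSpace ℝ (Fin m)}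
    {A : Fin m → Fin k → Fin k → ℝ}

lemma gradDiffSq_eq {x : EuclideanSpace ℝ (Fin k)} {t : ℝ} (hx : ‖x‖ < 1)
    (ht : t ∈ Ioo (-1 : ℝ) 1) : gradDiffSq f g x t =
      gradNorm (fderiv ℝ (fun y => f y t) x - fderiv ℝ (fun y => g y 0) x) ^ 2 :=
  indicator_of_mem (mk_mem_prod (by simpa using hx) ht) _

lemma gradNorm_sub_sq_le (L M : EuclideanSpace ℝ (Fin k) →L[ℝ] EuclideanSpace ℝ (Fin m)) :
    gradNorm (L - M) ^ 2 ≤ 2 * gradNorm L ^ 2 + 2 * gradNorm M ^ 2 := by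
  have h : ∀ L : EuclideanSpace ℝ (Fin k) →L[ℝ] EuclideanSpace ℝ (Fin m),
      gradNorm L ^ 2 = ∑ l, ∑ i, (L (EuclideanSpace.single i 1) l) ^ 2 := fun L =>
    Real.sq_sqrt (Finset.sum_nonneg fun _ _ => Finset.sum_nonneg fun _ _ => sq_nonneg _)
  rw [h, h, h, Finset.mul_sum, Finset.mul_sum, ← Finset.sum_add_distrib]
  refine Finset.sum_le_sum fun l _ => ?_
  rw [Finset.mul_sum, Finset.mul_sum, ← Finset.sum_add_distrib]
  refine Finset.sum_le_sum fun i _ => ?_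
  simp only [sub_apply, PiLp.sub_apply]
  nlinarith [sq_nonneg (L (EuclideanSpace.single i 1) l + M (EuclideanSpace.single i 1) l)]

lemma IsGraphFlow.gradDiffSq_le (hf : IsGraphFlow f V u F E)
    (hDg : ∀ x ∈ Metric.ball (0 : EuclideanSpace ℝ (Fin k)) 1,
      gradNorm (fderiv ℝ (fun y => g y 0) x) ≤ 1) (x : EuclideanSpace ℝ (Fin k)) (t : ℝ) :
    gradDiffSq f g x t ≤ 4 := by
  refine indicator_le' (f := fun q : EuclideanSpace ℝ (Fin k) × ℝ =>
    gradNorm (fderiv ℝ (fun y => f y q.2) q.1 - fderiv ℝ (fun y => g y 0) q.1) ^ 2)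
    (g := fun _ => 4) (fun q hq => ?_) (fun _ _ => by norm_num) (x, t)
  have h1 := (hf.grad_le q.2 hq.2 q.1 hq.1).trans hf.F_le
  have h2 := hDg q.1 hq.1
  have h3 := pow_le_one₀ (n := 2) (gradNorm_nonneg _) h1
  have h4 := pow_le_one₀ (n := 2) (gradNorm_nonneg _) h2
  have h5 := gradNorm_sub_sq_le (fderiv ℝ (fun y => f y q.2) q.1) (fderiv ℝ (fun y => g y 0) q.1)
  change _ ≤ (4 : ℝ)
  linarith

lemma IsGraphFlow.measurable_gradDiffSq (hf : IsGraphFlow f V u F E) (hg : IsCaloric g A) :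
    Measurable (Function.uncurry (gradDiffSq f g)) := by
  have h1 : ContinuousOn (fun q : EuclideanSpace ℝ (Fin k) × ℝ =>
      gradNorm (fderiv ℝ (fun y => f y q.2) q.1 - fderiv ℝ (fun y => g y 0) q.1) ^ 2)
      (Metric.ball 0 1 ×ˢ Ioo (-1 : ℝ) 1) := by
    have h2 : Continuous (fderiv ℝ (fun y => g y 0)) := hg.smooth.continuous_fderiv (by norm_num)
    exact (continuous_gradNorm.comp_continuousOn
      (hf.cont.sub (h2.comp continuous_fst).continuousOn)).pow 2
  classical
  have h3 := h1.measurable_piecewise (g := 0) continuousOn_const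
    (measurableSet_ball.prod measurableSet_Ioo)
  rw [piecewise_eq_indicator] at h3
  exact h3

/-- On the graphs a continuous function is bounded, uniformly in time. -/
lemma IsGraphFlow.exists_bound_of_continuous (hf : IsGraphFlow f V u F E)
    {h : Ambient k m × ℝ → ℝ} (hc : Continuous h) :
    ∃ C, ∀ t, ∀ᵐ z ∂flowMeasure V t, ‖h (z, t)‖ ≤ C := by
  obtain ⟨R, hR0, hR⟩ := hf.exists_height_bound
  obtain ⟨C, hC⟩ := ((isCompact_closedBall (0 : Ambient k m) (R + 1)).prod
    (isCompact_Icc (a := (-1 : ℝ)) (b := 1))).exists_bound_of_continuousOn hc.continuousOn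
  refine ⟨C, fun t => ?_⟩
  by_cases ht : t ∈ Ioo (-1 : ℝ) 1
  · rw [flowMeasure_of_mem ht]
    filter_upwards [hf.ae_mem_graph ht] with z hz
    refine hC _ ⟨mem_closedBall_zero_iff.2 ?_, Ioo_subset_Icc_self ht⟩
    have h1 := norm_sq_eq_base_add_height z
    have h2 : ‖height z‖ < R := by rw [hz.2]; exact hR t ht _ (by simpa using hz.1)
    have h3 : ‖base z‖ < 1 := hz.1
    refine le_of_sq_le_sq ?_ (by positivity)
    nlinarith [norm_nonneg (base z), norm_nonneg (height z)]
  · rw [flowMeasure_of_notMem ht]; simp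

lemma IsGraphFlow.integrable_slice (hf : IsGraphFlow f V u F E)
    {G : ℝ → Ambient k m → ℝ} (hG : Measurable (Function.uncurry G)) {C t : ℝ}
    (hC : ∀ᵐ z ∂flowMeasure V t, ‖G t z‖ ≤ C) : Integrable (G t) (flowMeasure V t) := by
  have := hf.isFiniteMeasure_flowMeasure t
  exact Integrable.of_bound (hG.comp measurable_prodMk_left).aestronglyMeasurable C hC

lemma IsCaloric.continuous_power (hg : IsCaloric g A) {ε : ℝ} (hε : 0 < ε) (p : ℝ) :
    Continuous fun q : Ambient k m × ℝ => (qDist g q.1 q.2 + ε) ^ p :=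
  (hg.contDiff_power hε).continuous

lemma IsCaloric.continuous_testFnDt (hg : IsCaloric g A) {χ : EuclideanSpace ℝ (Fin m) → ℝ}
    (hχ : Continuous χ) {ε : ℝ} (hε : 0 < ε) (r τ p : ℝ) :
    Continuous fun q : Ambient k m × ℝ => testFnDt g A χ r τ p ε q.1 q.2 := by
  have h1 := hg.contDiff_offset.continuous
  have h2 := hg.continuous_power hε p
  have h3 := hg.continuous_power hε (p - 1)
  have h4 : Continuous fun q : Ambient k m × ℝ => base q.1 := continuous_base.comp continuous_fst
  have h5 : Continuous fun q : Ambient k m × ℝ => height q.1 :=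
    continuous_height.comp continuous_fst
  have hp := continuous_posPow
  unfold testFnDt
  have h6 : Continuous fun q : Ambient k m × ℝ => posPow 4 (r ^ 2 - ‖base q.1‖ ^ 2) :=
    (hp 4).comp (by fun_prop)
  have h7 : Continuous fun q : Ambient k m × ℝ => posPow 1 (q.2 - τ) := (hp 1).comp (by fun_prop)
  have h8 : Continuous fun q : Ambient k m × ℝ => posPow 2 (q.2 - τ) := (hp 2).comp (by fun_prop)
  fun_prop

/-- The weight of `|∇f - ∇g|²` in the good term. -/
lemma IsCaloric.continuous_goodTerm_one (hg : IsCaloric g A) {ε : ℝ} (hε : 0 < ε) (r τ p : ℝ) :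
    Continuous fun q : Ambient k m × ℝ => goodTerm g r τ p ε q.1 q.2 1 := by
  have h3 := hg.continuous_power hε (p - 1)
  have h4 : Continuous fun q : Ambient k m × ℝ => base q.1 := continuous_base.comp continuous_fst
  have hp := continuous_posPow
  unfold goodTerm
  have h6 : Continuous fun q : Ambient k m × ℝ => posPow 4 (r ^ 2 - ‖base q.1‖ ^ 2) :=
    (hp 4).comp (by fun_prop)
  have h8 : Continuous fun q : Ambient k m × ℝ => posPow 2 (q.2 - τ) := (hp 2).comp (by fun_prop)
  fun_prop

lemma goodTerm_eq_mul (r τ p ε : ℝ) (z : Ambient k m) (t N : ℝ) :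
    goodTerm g r τ p ε z t N = goodTerm g r τ p ε z t 1 * N := by
  simp [goodTerm]

lemma goodTerm_nonneg {r τ p ε : ℝ} (hp : 0 ≤ p) (hε : 0 < ε) (z : Ambient k m) (t : ℝ) {N : ℝ}
    (hN : 0 ≤ N) : 0 ≤ goodTerm g r τ p ε z t N := by
  have := qDist_nonneg g z t
  have h1 := posPow_nonneg 2 (t - τ)
  have h2 := posPow_nonneg 4 (r ^ 2 - ‖base z‖ ^ 2)
  unfold goodTerm
  positivity

lemma IsCaloric.isTestFunction_testFn (hg : IsCaloric g A) {χ : EuclideanSpace ℝ (Fin m) → ℝ}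
    (hχ : ContDiff ℝ 2 χ) (hχ0 : ∀ y, 0 ≤ χ y) {R : ℝ} (hχR : ∀ y, R < ‖y‖ → χ y = 0)
    {ε : ℝ} (hε : 0 < ε) {r : ℝ} (hr0 : 0 < r) (hr : r < 1) (τ p : ℝ) :
    IsTestFunction (cylinder k m 1) (Ioo (-1 : ℝ) 1) (testFn g χ r τ p ε) ∧
    ∀ t, HasCompactSupport (fun z => testFn g χ r τ p ε z t) ∧
      tsupport (fun z => testFn g χ r τ p ε z t) ⊆ cylinder k m 1 := by
  let K : Set (Ambient k m) := {z | ‖base z‖ ≤ r} ∩ {z | ‖height z‖ ≤ R}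
  have hKc : IsClosed K := (isClosed_le (by have := continuous_base (k := k) (m := m); fun_prop)
    continuous_const).inter (isClosed_le (by have := continuous_height (k := k) (m := m); fun_prop)
    continuous_const)
  have hK : IsCompact K := by
    refine (isCompact_closedBall (0 : Ambient k m) (r + |R|)).of_isClosed_subset hKc ?_
    rintro z ⟨h1, h2⟩
    rw [mem_closedBall_zero_iff]
    have h3 := norm_sq_eq_base_add_height z
    simp only [mem_ofPred_eq] at h1 h2
    have h4 := h2.trans (le_abs_self R)
    refine le_of_sq_le_sq ?_ (by positivity)
    nlinarith [norm_nonneg (base z), norm_nonneg (height z)]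
  have hKU : K ⊆ cylinder k m 1 := fun z hz => lt_of_le_of_lt hz.1 hr
  have h0 : ∀ t, ∀ z ∉ K, testFn g χ r τ p ε z t = 0 := by
    intro t z hz
    by_cases h1 : ‖base z‖ ≤ r
    · have h2 : R < ‖height z‖ := by
        by_contra h
        exact hz ⟨h1, not_lt.1 h⟩
      simp [testFn, hχR _ h2]
    · have h2 : r ^ 2 - ‖base z‖ ^ 2 ≤ 0 := by
        push Not at h1
        nlinarith
      simp [testFn, posPow_of_nonpos (by norm_num : (4 : ℕ) ≠ 0) h2]
  refine ⟨⟨(hg.contDiff_testFn hχ hε).contDiffOn, fun z _ t _ => testFn_nonneg hχ0 hε z t,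
    fun a b _ => ⟨K, hK, hKU, fun t _ z hz => h0 t z hz⟩⟩, fun t => ?_⟩
  have h1 : tsupport (fun z => testFn g χ r τ p ε z t) ⊆ K :=
    closure_minimal (fun z hz => by
      by_contra h
      exact hz (h0 t z h)) hKc
  exact ⟨hK.of_isClosed_subset (isClosed_tsupport _) h1, h1.trans hKU⟩

/-- Condition (B4) for a test function `φ` with time derivative `D`, when Brakke's functional is
bounded by the integral of `-D - N + I`. -/
lemma IsGraphFlow.integral_add_le_of_brakke_le (hf : IsGraphFlow f V u F E)
    {φ : Ambient k m → ℝ → ℝ} (hφ : IsTestFunction (cylinder k m 1) (Ioo (-1 : ℝ) 1) φ)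
    {τ T : ℝ} (hτ : -1 < τ) (hτT : τ < T) (hT : T < 1) {D N I : ℝ → Ambient k m → ℝ}
    (hDm : Measurable (Function.uncurry D)) (hNm : Measurable (Function.uncurry N))
    (hIm : Measurable (Function.uncurry I)) {CD CN CI : ℝ}
    (hCD : ∀ t, ∀ᵐ z ∂flowMeasure V t, ‖D t z‖ ≤ CD)
    (hCN : ∀ t, ∀ᵐ z ∂flowMeasure V t, ‖N t z‖ ≤ CN)
    (hCI : ∀ t, ∀ᵐ z ∂flowMeasure V t, ‖I t z‖ ≤ CI)
    (hd : ∀ z t, HasDerivAt (fun s => φ z s) (D t z) t) (h0 : ∀ z, φ z τ = 0)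
    (hB : ∀ t ∈ Ioo τ T, MemLp (fun x => u x t) 2 (V t).mass →
      Integrable (fun z => -D t z - N t z + I t z) (V t).mass →
      (V t).brakke (fun x => u x t) (fun x => φ x t) ≤
        ((∫ z, (-D t z - N t z + I t z) ∂(V t).mass : ℝ) : EReal)) :
    ∫ z, φ z T ∂flowMeasure V T + ∫ t in Ioo τ T, ∫ z, N t z ∂flowMeasure V t ≤
      ∫ t in Ioo τ T, ∫ z, I t z ∂flowMeasure V t := by
  have hmem : ∀ t ∈ Ioo τ T, t ∈ Ioo (-1 : ℝ) 1 := fun t ht => ⟨hτ.trans ht.1, ht.2.trans hT⟩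
  have hτm : τ ∈ Ioo (-1 : ℝ) 1 := ⟨hτ, hτT.trans hT⟩
  have hTm : T ∈ Ioo (-1 : ℝ) 1 := ⟨hτ.trans hτT, hT⟩
  have iD := fun t => hf.integrable_slice hDm (hCD t)
  have iN := fun t => hf.integrable_slice hNm (hCN t)
  have iI := fun t => hf.integrable_slice hIm (hCI t)
  have jD := hf.integrableOn_integral hDm (a := τ) (b := T) fun t _ => hCD t
  have jN := hf.integrableOn_integral hNm (a := τ) (b := T) fun t _ => hCN t
  have jI := hf.integrableOn_integral hIm (a := τ) (b := T) fun t _ => hCI t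
  have hsum : ∀ t, ∫ z, (-D t z - N t z + I t z) ∂flowMeasure V t =
      -∫ z, D t z ∂flowMeasure V t - ∫ z, N t z ∂flowMeasure V t +
        ∫ z, I t z ∂flowMeasure V t := by
    intro t
    rw [integral_add (f := fun z => -D t z - N t z) ((iD t).neg.sub (iN t)) (iI t),
      integral_sub (f := fun z => -D t z) (iD t).neg (iN t), integral_neg]
  have hmain := hf.integral_sub_le hφ hτm hTm hτT
    (G := fun t => -∫ z, D t z ∂flowMeasure V t - ∫ z, N t z ∂flowMeasure V t +
        ∫ z, I t z ∂flowMeasure V t) (fun t ht hu => by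
      have h1 := flowMeasure_of_mem (V := V) (hmem t ht)
      have h2 := hB t ht hu (h1 ▸ ((iD t).neg.sub (iN t)).add (iI t))
      rwa [← h1, hsum] at h2) ((jD.neg.sub jN).add jI)
  have h3 : ∫ t in Ioo τ T, ∫ z, deriv (fun s => φ z s) t ∂(V t).mass =
      ∫ t in Ioo τ T, ∫ z, D t z ∂flowMeasure V t := by
    refine setIntegral_congr_fun measurableSet_Ioo fun t ht => ?_
    simp only [flowMeasure_of_mem (hmem t ht)]
    exact integral_congr_ae (ae_of_all _ fun z => (hd z t).deriv)
  rw [h3, integral_add (f := fun t => -∫ z, D t z ∂flowMeasure V t -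
      ∫ z, N t z ∂flowMeasure V t) (jD.neg.sub jN) jI,
    integral_sub (f := fun t => -∫ z, D t z ∂flowMeasure V t) jD.neg jN, integral_neg,
    ← flowMeasure_of_mem hTm] at hmain
  simp only [h0, integral_zero] at hmain
  linarith

lemma IsGraphFlow.measurable_goodTerm (hf : IsGraphFlow f V u F E) (hg : IsCaloric g A) {ε : ℝ}
    (hε : 0 < ε) (r τ p : ℝ) : Measurable (Function.uncurry fun t (z : Ambient k m) =>
      goodTerm g r τ p ε z t (gradDiffSq f g (base z) t)) := by
  have h1 := (hf.measurable_gradDiffSq hg).comp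
    ((measurable_base (k := k) (m := m)).comp (measurable_snd (α := ℝ)) |>.prodMk measurable_fst)
  have h2 := ((hg.continuous_goodTerm_one hε r τ p).measurable.comp measurable_swap).mul h1
  convert h2 using 1
  ext1 ⟨t, z⟩
  simp only [Function.uncurry_apply_pair, Pi.mul_apply, Function.comp_apply, Prod.swap_prod_mk]
  rw [goodTerm_eq_mul]

lemma IsCaloric.measurable_ballPower (hg : IsCaloric g A) {ε : ℝ} (hε : 0 < ε) (r p : ℝ) :
    Measurable (Function.uncurry fun t (z : Ambient k m) =>
      (Metric.ball (0 : EuclideanSpace ℝ (Fin k)) r).indicator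
        (fun _ => energyConst k m * p * (qDist g z t + ε) ^ p) (base z)) := by
  have h1 := (((hg.continuous_power hε p).const_mul (energyConst k m * p)).measurable.comp
    measurable_swap).indicator (((measurable_base (k := k) (m := m)).comp (measurable_snd (α := ℝ)))
      (measurableSet_ball (x := (0 : EuclideanSpace ℝ (Fin k))) (ε := r)))
  convert h1 using 1
  ext1 ⟨t, z⟩
  classical
  rw [Function.uncurry_apply_pair, indicator_apply, indicator_apply]
  rfl

lemma IsGraphFlow.exists_bound_goodTerm (hf : IsGraphFlow f V u F E) (hg : IsCaloric g A)
    (hDg : ∀ x ∈ Metric.ball (0 : EuclideanSpace ℝ (Fin k)) 1,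
      gradNorm (fderiv ℝ (fun y => g y 0) x) ≤ 1) {ε : ℝ} (hε : 0 < ε) (r τ p : ℝ) :
    ∃ C, ∀ t, ∀ᵐ z ∂flowMeasure V t,
      ‖goodTerm g r τ p ε z t (gradDiffSq f g (base z) t)‖ ≤ C := by
  obtain ⟨C, hC⟩ := hf.exists_bound_of_continuous (hg.continuous_goodTerm_one hε r τ p)
  refine ⟨C * 4, fun t => ?_⟩
  filter_upwards [hC t] with z hz
  rw [goodTerm_eq_mul, norm_mul, Real.norm_of_nonneg (gradDiffSq_nonneg f g _ _)]
  exact mul_le_mul hz (hf.gradDiffSq_le hDg _ _) (gradDiffSq_nonneg f g _ _)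
    ((norm_nonneg _).trans hz)

lemma IsGraphFlow.exists_bound_ballPower (hf : IsGraphFlow f V u F E) (hg : IsCaloric g A)
    {ε : ℝ} (hε : 0 < ε) (r p : ℝ) :
    ∃ C, ∀ t, ∀ᵐ z ∂flowMeasure V t, ‖(Metric.ball (0 : EuclideanSpace ℝ (Fin k)) r).indicator
        (fun _ => energyConst k m * p * (qDist g z t + ε) ^ p) (base z)‖ ≤ C := by
  obtain ⟨C, hC⟩ := hf.exists_bound_of_continuous
    ((hg.continuous_power hε p).const_mul (energyConst k m * p))
  refine ⟨C, fun t => ?_⟩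
  filter_upwards [hC t] with z hz
  exact (norm_indicator_le_norm_self _ _).trans hz

/-- Local energy inequality. -/
lemma IsGraphFlow.energy_real (hf : IsGraphFlow f V u F E) (hg : IsCaloric g A)
    (hDg : ∀ x ∈ Metric.ball (0 : EuclideanSpace ℝ (Fin k)) 1,
      gradNorm (fderiv ℝ (fun y => g y 0) x) ≤ 1) {ε : ℝ} (hε : 0 < ε)
    (hεE : E ^ 2 + (coeffNorm A * F ^ 2) ^ 2 ≤ ε) {p r τ T : ℝ} (hp : 1 ≤ p) (hr0 : 0 < r)
    (hr : r < 1) (hτ : -1 < τ) (hτT : τ < T) (hT : T < 1) :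
    ∫ z, posPow 2 (T - τ) * (posPow 4 (r ^ 2 - ‖base z‖ ^ 2) * (qDist g z T + ε) ^ p)
        ∂flowMeasure V T +
      ∫ t in Ioo τ T, ∫ z, goodTerm g r τ p ε z t (gradDiffSq f g (base z) t) / 4
        ∂flowMeasure V t ≤
    ∫ t in Ioo τ T, ∫ z, (Metric.ball (0 : EuclideanSpace ℝ (Fin k)) r).indicator
          (fun _ => energyConst k m * p * (qDist g z t + ε) ^ p) (base z) ∂flowMeasure V t := by
  obtain ⟨R, hR0, hR⟩ := hf.exists_height_bound
  obtain ⟨χ, hχ, hχ0, hχR, hχ1⟩ : ∃ χ : EuclideanSpace ℝ (Fin m) → ℝ, ContDiff ℝ 2 χ ∧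
      (∀ y, 0 ≤ χ y) ∧ (∀ y, R + 1 < ‖y‖ → χ y = 0) ∧ ∀ t ∈ Ioo (-1 : ℝ) 1,
        ∀ z ∈ graphOverBall (fun x => f x t), ∀ᶠ y in 𝓝 (height z), χ y = 1 := by
    let χ : ContDiffBump (0 : EuclideanSpace ℝ (Fin m)) := ⟨R, R + 1, hR0, by linarith⟩
    refine ⟨χ, χ.contDiff, fun y => χ.nonneg, fun y hy =>
      χ.zero_of_le_dist (by rw [dist_zero_right]; exact hy.le), fun t ht z hz => ?_⟩
    refine χ.eventuallyEq_one_of_mem_ball ?_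
    rw [mem_ball_zero_iff, hz.2]
    exact hR t ht _ (by simpa using hz.1)
  have hmem : ∀ t ∈ Ioo τ T, t ∈ Ioo (-1 : ℝ) 1 := fun t ht => ⟨hτ.trans ht.1, ht.2.trans hT⟩
  have hTm : T ∈ Ioo (-1 : ℝ) 1 := ⟨hτ.trans hτT, hT⟩
  obtain ⟨htest, hsupp⟩ := hg.isTestFunction_testFn hχ hχ0 hχR hε hr0 hr τ p
  have hDc := hg.continuous_testFnDt (χ := χ) hχ.continuous hε r τ p
  obtain ⟨CD, hCD⟩ := hf.exists_bound_of_continuous hDc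
  obtain ⟨CN, hCN⟩ := hf.exists_bound_goodTerm hg hDg hε r τ p
  obtain ⟨CI, hCI⟩ := hf.exists_bound_ballPower hg hε r p
  have h2 : ∫ z, testFn g χ r τ p ε z T ∂flowMeasure V T = ∫ z, posPow 2 (T - τ) *
      (posPow 4 (r ^ 2 - ‖base z‖ ^ 2) * (qDist g z T + ε) ^ p) ∂flowMeasure V T := by
    rw [flowMeasure_of_mem hTm]
    refine integral_congr_ae ?_
    filter_upwards [hf.ae_mem_graph hTm] with z hz
    rw [testFn, (hχ1 T hTm z hz).self_of_nhds, one_mul]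
  rw [← h2]
  refine hf.integral_add_le_of_brakke_le htest hτ hτT hT
    (D := fun t z => testFnDt g A χ r τ p ε z t)
    (hDc.measurable.comp measurable_swap) ((hf.measurable_goodTerm hg hε r τ p).div_const 4)
    (hg.measurable_ballPower hε r p) hCD (CN := CN) (fun t => ?_) hCI
    (fun z t => hg.hasDerivAt_testFn hε z t)
    (fun z => by simp [testFn, posPow_of_nonpos]) fun t ht hu hi => ?_
  · filter_upwards [hCN t] with z hz
    rw [norm_div, show ‖(4 : ℝ)‖ = 4 by norm_num]
    linarith [norm_nonneg (goodTerm g r τ p ε z t (gradDiffSq f g (base z) t))]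
  · have ht' := hmem t ht
    have := hf.isFiniteMeasure ht'
    refine (V t).brakke_le hu (hg.contDiff_testFn_slice hχ hε t) (hsupp t).1 (hsupp t).2
      (fun z => testFn_nonneg hχ0 hε z t) hi ?_
    filter_upwards [hf.ae_tangent ht'] with q hq
    have hb : ‖base q.1‖ < 1 := hq.1.1
    have hbm : base q.1 ∈ Metric.ball (0 : EuclideanSpace ℝ (Fin k)) 1 := by simpa using hb
    have h2 := hg.pointwise_le (r := r) (τ := τ) hχ hp hr0 hr.le hε hf.E_le hεE
      (hχ1 t ht' q.1 hq.1) ht'.2 hτ hb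
      hq.2 (hf.grad_le t ht' _ hbm) hf.F_le (U := u q.1 t - q.2.1 (u q.1 t))
      ((q.2.norm_sub_apply_le _).trans (hf.u_le t ht' q.1 hb)) (hDg _ hbm)
    rw [gradDiffSq_eq hb ht']
    exact h2

/-- `∫∫ (Q_g + ε)^p d‖V_t‖ dt` over the cylinder of radius `r` and the times `(τ, T)`. -/
def powInt (g : EuclideanSpace ℝ (Fin k) → ℝ → EuclideanSpace ℝ (Fin m))
    (V : ℝ → Varifold (Ambient k m) k (cylinder k m 1)) (ε p r τ T : ℝ) : ℝ≥0∞ :=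
  ∫⁻ t in Ioo τ T, ∫⁻ z in base ⁻¹' Metric.ball 0 r, ENNReal.ofReal ((qDist g z t + ε) ^ p)
    ∂flowMeasure V t

lemma IsGraphFlow.lintegral_lintegral_ofReal (hf : IsGraphFlow f V u F E)
    {G : ℝ → Ambient k m → ℝ} (hG : Measurable (Function.uncurry G)) {C : ℝ}
    (hC : ∀ t, ∀ᵐ z ∂flowMeasure V t, ‖G t z‖ ≤ C) (h0 : ∀ t z, 0 ≤ G t z) (a b : ℝ) :
    ∫⁻ t in Ioo a b, ∫⁻ z, ENNReal.ofReal (G t z) ∂flowMeasure V t =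
      ENNReal.ofReal (∫ t in Ioo a b, ∫ z, G t z ∂flowMeasure V t) := by
  rw [ofReal_integral_eq_lintegral_ofReal (hf.integrableOn_integral hG fun t _ => hC t)
    (ae_of_all _ fun t => integral_nonneg (h0 t))]
  refine lintegral_congr fun t => ?_
  rw [ofReal_integral_eq_lintegral_ofReal (hf.integrable_slice hG (hC t)) (ae_of_all _ (h0 t))]

lemma IsGraphFlow.powInt_eq (hf : IsGraphFlow f V u F E) (hg : IsCaloric g A) {ε : ℝ} (hε : 0 < ε)
    {p : ℝ} (hp : 0 ≤ p) (r τ T : ℝ) :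
    ENNReal.ofReal (∫ t in Ioo τ T, ∫ z, (Metric.ball (0 : EuclideanSpace ℝ (Fin k)) r).indicator
      (fun _ => energyConst k m * p * (qDist g z t + ε) ^ p) (base z) ∂flowMeasure V t) =
    ENNReal.ofReal (energyConst k m * p) * powInt g V ε p r τ T := by
  have hc : 0 ≤ energyConst k m * p := mul_nonneg (energyConst_pos k m).le hp
  have h0 : ∀ t (z : Ambient k m), 0 ≤ (qDist g z t + ε) ^ p := fun t z => by
    have := qDist_nonneg g z t
    positivity
  obtain ⟨C, hC⟩ := hf.exists_bound_ballPower hg hε r p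
  rw [← hf.lintegral_lintegral_ofReal (hg.measurable_ballPower hε r p) hC
    (fun t z => indicator_nonneg (fun _ _ => mul_nonneg hc (h0 t z)) _), powInt,
    ← lintegral_const_mul' _ _ ENNReal.ofReal_ne_top]
  refine lintegral_congr fun t => ?_
  rw [← lintegral_const_mul' _ _ ENNReal.ofReal_ne_top,
    ← lintegral_indicator (measurable_base measurableSet_ball)]
  refine lintegral_congr fun z => ?_
  by_cases hz : base z ∈ Metric.ball (0 : EuclideanSpace ℝ (Fin k)) r
  · rw [indicator_of_mem hz, indicator_of_mem (by exact hz), ENNReal.ofReal_mul hc]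
  · rw [indicator_of_notMem hz, indicator_of_notMem (by exact hz), ENNReal.ofReal_zero]

lemma IsGraphFlow.powInt_ne_top (hf : IsGraphFlow f V u F E) (hg : IsCaloric g A) {ε : ℝ}
    (hε : 0 < ε) {p : ℝ} (hp : 0 < p) (r τ T : ℝ) : powInt g V ε p r τ T ≠ ∞ := by
  intro h
  have h1 := hf.powInt_eq hg hε hp.le r τ T
  rw [h, ENNReal.mul_top (by
    simpa using mul_pos (energyConst_pos k m) hp)] at h1
  exact ENNReal.ofReal_ne_top h1

lemma IsGraphFlow.lintegral_ofReal_slice (hf : IsGraphFlow f V u F E)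
    {h : Ambient k m × ℝ → ℝ} (hc : Continuous h) (h0 : ∀ q, 0 ≤ h q) (t : ℝ) :
    ∫⁻ z, ENNReal.ofReal (h (z, t)) ∂flowMeasure V t =
      ENNReal.ofReal (∫ z, h (z, t) ∂flowMeasure V t) := by
  obtain ⟨C, hC⟩ := hf.exists_bound_of_continuous hc
  have := hf.isFiniteMeasure_flowMeasure t
  have hi : Integrable (fun z => h (z, t)) (flowMeasure V t) :=
    Integrable.of_bound (by fun_prop : Continuous fun z => h (z, t)).aestronglyMeasurable C (hC t)
  exact (ofReal_integral_eq_lintegral_ofReal hi (ae_of_all _ fun z => h0 _)).symm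

/-- The energy inequality bounds the integrals of `(Q_g + ε)^p` at single times. -/
lemma IsGraphFlow.energy_slice_le (hf : IsGraphFlow f V u F E) (hg : IsCaloric g A)
    (hDg : ∀ x ∈ Metric.ball (0 : EuclideanSpace ℝ (Fin k)) 1,
      gradNorm (fderiv ℝ (fun y => g y 0) x) ≤ 1) {ε : ℝ} (hε : 0 < ε)
    (hεE : E ^ 2 + (coeffNorm A * F ^ 2) ^ 2 ≤ ε) {p r τ T : ℝ} (hp : 1 ≤ p) (hr0 : 0 < r)
    (hr : r < 1) (hτ : -1 < τ) (hτT : τ < T) (hT : T < 1) :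
    ENNReal.ofReal ((T - τ) ^ 2) * ∫⁻ z, ENNReal.ofReal
        (posPow 4 (r ^ 2 - ‖base z‖ ^ 2) * (qDist g z T + ε) ^ p) ∂flowMeasure V T ≤
      ENNReal.ofReal (energyConst k m * p) * powInt g V ε p r τ T := by
  have h1 := hf.energy_real hg hDg hε hεE hp hr0 hr hτ hτT hT
  have h2 : 0 ≤ ∫ t in Ioo τ T, ∫ z, goodTerm g r τ p ε z t (gradDiffSq f g (base z) t) / 4
      ∂flowMeasure V t := integral_nonneg fun t => integral_nonneg fun z =>
    div_nonneg (goodTerm_nonneg (by linarith) hε z t (gradDiffSq_nonneg f g _ _)) (by norm_num)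
  rw [← hf.powInt_eq hg hε (by linarith)]
  refine le_trans (le_of_eq ?_) (ENNReal.ofReal_le_ofReal ((le_add_of_nonneg_right h2).trans h1))
  have hc : Continuous fun q : Ambient k m × ℝ =>
      posPow 4 (r ^ 2 - ‖base q.1‖ ^ 2) * (qDist g q.1 q.2 + ε) ^ p :=
    ((contDiff_cut.continuous).comp continuous_fst).mul (hg.continuous_power hε p)
  have h3 := hf.lintegral_ofReal_slice hc (fun q => by
    have := qDist_nonneg g q.1 q.2
    exact mul_nonneg (posPow_nonneg _ _) (by positivity)) T
  rw [integral_const_mul, ENNReal.ofReal_mul (posPow_nonneg _ _),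
    posPow_of_nonneg _ (by linarith)]
  congr 1

/-- The energy inequality bounds the weighted integral of `|∇f - ∇g|²`. -/
lemma IsGraphFlow.energy_good_le (hf : IsGraphFlow f V u F E) (hg : IsCaloric g A)
    (hDg : ∀ x ∈ Metric.ball (0 : EuclideanSpace ℝ (Fin k)) 1,
      gradNorm (fderiv ℝ (fun y => g y 0) x) ≤ 1) {ε : ℝ} (hε : 0 < ε)
    (hεE : E ^ 2 + (coeffNorm A * F ^ 2) ^ 2 ≤ ε) {p r τ T : ℝ} (hp : 1 ≤ p) (hr0 : 0 < r)
    (hr : r < 1) (hτ : -1 < τ) (hτT : τ < T) (hT : T < 1) :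
    ∫⁻ t in Ioo τ T, ∫⁻ z, ENNReal.ofReal (goodTerm g r τ p ε z t (gradDiffSq f g (base z) t))
        ∂flowMeasure V t ≤
      4 * (ENNReal.ofReal (energyConst k m * p) * powInt g V ε p r τ T) := by
  have h1 := hf.energy_real hg hDg hε hεE hp hr0 hr hτ hτT hT
  have h2 : 0 ≤ ∫ z, posPow 2 (T - τ) *
      (posPow 4 (r ^ 2 - ‖base z‖ ^ 2) * (qDist g z T + ε) ^ p) ∂flowMeasure V T :=
    integral_nonneg fun z => by
      have := qDist_nonneg g z T
      exact mul_nonneg (posPow_nonneg _ _) (mul_nonneg (posPow_nonneg _ _) (by positivity))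
  obtain ⟨C, hC⟩ := hf.exists_bound_goodTerm hg hDg hε r τ p
  rw [← hf.powInt_eq hg hε (by linarith), hf.lintegral_lintegral_ofReal
    (hf.measurable_goodTerm hg hε r τ p) hC
    (fun t z => goodTerm_nonneg (by linarith) hε z t (gradDiffSq_nonneg f g _ _)),
    show (4 : ℝ≥0∞) = ENNReal.ofReal 4 by norm_num, ← ENNReal.ofReal_mul (by norm_num)]
  refine ENNReal.ofReal_le_ofReal ?_
  simp only [integral_div] at h1
  linarith

end Flow

/-! ### A Sobolev inequality -/

/-- A function bounded by `H` which is also bounded by the integrals of `H` along all coordinate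
lines satisfies a Sobolev inequality; this is the grid-lines lemma. -/
lemma lintegral_rpow_le_of_le_lines {ι : Type*} [Fintype ι] [Nonempty ι] [DecidableEq ι]
    {φ H : (ι → ℝ) → ℝ≥0∞} (hH : Measurable H) (h0 : ∀ x, φ x ≤ H x)
    (h1 : ∀ x i, φ x ≤ ∫⁻ s, H (Function.update x i s)) :
    ∫⁻ x, φ x ^ (1 + 1 / (Fintype.card ι : ℝ)) ≤
      (∫⁻ x, H x) ^ (1 + 1 / (Fintype.card ι : ℝ)) := by
  set n : ℝ := (Fintype.card ι : ℝ) with hn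
  have hn0 : 0 < n := by
    have : 0 < Fintype.card ι := Fintype.card_pos
    rw [hn]; exact_mod_cast this
  have he : 1 - (n - 1) * (1 / n) = 1 / n := by field_simp; ring
  have hmain := lintegral_mul_prod_lintegral_pow_le (fun _ : ι => (volume : Measure ℝ))
    (p := 1 / n) (by positivity) (by
      rw [mul_one_div, div_le_one hn0, ← hn]; linarith) hH
  rw [← hn, he, ← volume_pi] at hmain
  refine le_trans (lintegral_mono fun x => ?_) hmain
  have h2 : φ x ^ (1 + 1 / n) = φ x ^ (1 / n) * ∏ _i : ι, φ x ^ (1 / n) := by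
    rw [Finset.prod_const, Finset.card_univ, ← ENNReal.rpow_natCast, ← ENNReal.rpow_mul, ← hn,
      one_div_mul_cancel hn0.ne', add_comm, ENNReal.rpow_add_of_nonneg _ _ (by positivity)
      zero_le_one]
  rw [h2]
  gcongr with i
  · exact h0 x
  · exact h1 x i

/-- A parabolic interpolation inequality in one time slice. -/
lemma lintegral_rpow_le_mul_lintegral {k : ℕ} (hk : 0 < k) {φ : EuclideanSpace ℝ (Fin k) → ℝ}
    (hφ : ContDiff ℝ 1 φ) (hcs : HasCompactSupport φ) {H : EuclideanSpace ℝ (Fin k) → ℝ≥0∞}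
    (hH : Measurable H) (h0 : ∀ x, ‖φ x‖ₑ ≤ H x) (h1 : ∀ x, ‖fderiv ℝ φ x‖ₑ ≤ H x) :
    ∫⁻ x, ‖φ x‖ₑ ^ (1 + 1 / ((k : ℝ) + 1)) ≤
      (∫⁻ x, ‖φ x‖ₑ) ^ (1 / ((k : ℝ) + 1)) * ∫⁻ x, H x := by
  have hk0 : (0 : ℝ) < k := by exact_mod_cast hk
  have : Nonempty (Fin k) := ⟨⟨0, hk⟩⟩
  have hpres := PiLp.volume_preserving_toLp (Fin k)
  have hline : ∀ (x : Fin k → ℝ) (i : Fin k), ‖φ (WithLp.toLp 2 x)‖ₑ ≤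
      ∫⁻ s, H (WithLp.toLp 2 (Function.update x i s)) := by
    intro x i
    set ψ : ℝ → ℝ := fun s => φ (WithLp.toLp 2 (Function.update x i s)) with hψ
    let e : EuclideanSpace ℝ (Fin k) := EuclideanSpace.single i 1
    have hψe : ∀ s, ψ s = φ (WithLp.toLp 2 x + (s - x i) • e) := by
      intro s
      refine congrArg φ ?_
      ext j
      by_cases hj : j = i
      · subst hj; simp [e]
      · simp [e, hj]
    have hψc : ContDiff ℝ 1 ψ := by
      rw [funext hψe]
      exact hφ.comp (contDiff_const.add ((contDiff_id.sub contDiff_const).smul contDiff_const))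
    have hψcs : HasCompactSupport ψ :=
      hcs.comp_isClosedEmbedding ((PiLp.homeomorph 2 (fun _ : Fin k => ℝ)).symm.isClosedEmbedding.comp
        (isClosedEmbedding_update x i))
    have hd : ∀ s, deriv ψ s = fderiv ℝ φ (WithLp.toLp 2 (Function.update x i s)) e := by
      intro s
      have h2 : HasDerivAt (fun s : ℝ => WithLp.toLp 2 x + (s - x i) • e) e s :=
        ((((hasDerivAt_id s).sub_const (x i)).smul_const e).const_add _).congr_deriv (by simp)
      have h3 : WithLp.toLp 2 x + (s - x i) • e = WithLp.toLp 2 (Function.update x i s) := by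
        ext j
        by_cases hj : j = i
        · subst hj; simp [e]
        · simp [e, hj]
      have h4 := ((hφ.differentiable one_ne_zero) _).hasFDerivAt.comp_hasDerivAt s h2
      rw [h3] at h4
      rw [funext hψe]
      exact h4.deriv
    calc ‖φ (WithLp.toLp 2 x)‖ₑ = ‖ψ (x i)‖ₑ := by simp [hψ]
      _ ≤ ∫⁻ s in Iic (x i), ‖deriv ψ s‖ₑ := HasCompactSupport.enorm_le_lintegral_Ici_deriv hψc hψcs _
      _ ≤ ∫⁻ s, ‖deriv ψ s‖ₑ := setLIntegral_le_lintegral _ _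
      _ ≤ _ := by
        refine lintegral_mono fun s => ?_
        rw [hd]
        refine (ContinuousLinearMap.le_opENorm _ _).trans ?_
        have h5 : ‖e‖ₑ = 1 := by simp [e, ← ofReal_norm]
        rw [h5, mul_one]
        exact h1 _
  have hsob := lintegral_rpow_le_of_le_lines (φ := fun x => ‖φ (WithLp.toLp 2 x)‖ₑ)
    (H := fun x => H (WithLp.toLp 2 x)) (hH.comp hpres.measurable) (fun x => h0 _) hline
  have hφm : Measurable fun x => ‖φ x‖ₑ := hφ.continuous.enorm.measurable
  rw [hpres.lintegral_comp (f := fun x => ‖φ x‖ₑ ^ (1 + 1 / (Fintype.card (Fin k) : ℝ)))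
    (hφm.pow_const _), hpres.lintegral_comp hH, Fintype.card_fin] at hsob
  have hholder := ENNReal.lintegral_mul_norm_pow_le (μ := volume) hφm.aemeasurable
    (hφm.pow_const (1 + 1 / (k : ℝ))).aemeasurable (p := 1 / ((k : ℝ) + 1))
    (q := (k : ℝ) / (k + 1)) (by positivity) (by positivity) (by field_simp; ring)
  calc ∫⁻ x, ‖φ x‖ₑ ^ (1 + 1 / ((k : ℝ) + 1)) =
        ∫⁻ x, ‖φ x‖ₑ ^ (1 / ((k : ℝ) + 1)) *
          (‖φ x‖ₑ ^ (1 + 1 / (k : ℝ))) ^ ((k : ℝ) / (k + 1)) := by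
        refine lintegral_congr fun x => ?_
        rw [← ENNReal.rpow_mul, ← ENNReal.rpow_add_of_nonneg _ _ (by positivity) (by positivity)]
        congr 1
        field_simp
        ring
    _ ≤ _ := hholder
    _ ≤ (∫⁻ x, ‖φ x‖ₑ) ^ (1 / ((k : ℝ) + 1)) *
          ((∫⁻ x, H x) ^ (1 + 1 / (k : ℝ))) ^ ((k : ℝ) / (k + 1)) := by gcongr
    _ = _ := by
        rw [← ENNReal.rpow_mul, show (1 + 1 / (k : ℝ)) * ((k : ℝ) / (k + 1)) = 1 by field_simp,
          ENNReal.rpow_one]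

/-! ### Cut-off powers of `|f - g|²` -/

/-- The function `(r² - |x|²)₊⁴ (|w|²/2 + ε)^p` on `ℝᵏ`. -/
def cutPower (w : EuclideanSpace ℝ (Fin k) → EuclideanSpace ℝ (Fin m)) (r p ε : ℝ)
    (x : EuclideanSpace ℝ (Fin k)) : ℝ :=
  posPow 4 (r ^ 2 - ‖x‖ ^ 2) * (‖w x‖ ^ 2 / 2 + ε) ^ p

section CutPower

variable {w : EuclideanSpace ℝ (Fin k) → EuclideanSpace ℝ (Fin m)} {r p ε : ℝ}

lemma cutPower_nonneg (hε : 0 < ε) (x : EuclideanSpace ℝ (Fin k)) : 0 ≤ cutPower w r p ε x :=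
  mul_nonneg (posPow_nonneg _ _) (by positivity)

lemma cutPower_eq_zero (hr : 0 ≤ r) {x : EuclideanSpace ℝ (Fin k)} (hx : r ≤ ‖x‖) :
    cutPower w r p ε x = 0 := by
  rw [cutPower, posPow_of_nonpos (by norm_num) (by nlinarith), zero_mul]

lemma hasCompactSupport_cutPower (hr : 0 ≤ r) : HasCompactSupport (cutPower w r p ε) :=
  HasCompactSupport.intro (isCompact_closedBall (0 : EuclideanSpace ℝ (Fin k)) r) fun x hx =>
    cutPower_eq_zero hr (by
      rw [mem_closedBall_zero_iff, not_le] at hx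
      exact hx.le)

lemma contDiff_cutPower (hε : 0 < ε) (hr0 : 0 ≤ r) (hr : r < 1)
    (hd : DifferentiableOn ℝ w (Metric.ball 0 1))
    (hc : ContinuousOn (fderiv ℝ w) (Metric.ball 0 1)) : ContDiff ℝ 1 (cutPower w r p ε) := by
  have hw : ContDiffOn ℝ 1 w (Metric.ball 0 1) := by
    rw [show (1 : WithTop ℕ∞) = 0 + 1 by norm_num,
      contDiffOn_succ_iff_fderiv_of_isOpen Metric.isOpen_ball]
    exact ⟨hd, by simp, contDiffOn_zero.2 hc⟩
  rw [contDiff_iff_contDiffAt]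
  intro x
  by_cases hx : x ∈ Metric.ball (0 : EuclideanSpace ℝ (Fin k)) 1
  · have h1 := hw.contDiffAt (Metric.isOpen_ball.mem_nhds hx)
    have h2 : ContDiffAt ℝ 1 (fun x : EuclideanSpace ℝ (Fin k) => posPow 4 (r ^ 2 - ‖x‖ ^ 2)) x :=
      ((contDiff_posPow 1 2).comp (contDiff_const.sub (contDiff_norm_sq ℝ))).contDiffAt
    have h3 : ContDiffAt ℝ 1 (fun x => ‖w x‖ ^ 2 / 2 + ε) x :=
      ((h1.norm_sq ℝ).div_const 2).add contDiffAt_const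
    exact h2.mul (h3.rpow_const_of_ne (by positivity))
  · refine (contDiffAt_const (c := (0 : ℝ))).congr_of_eventuallyEq ?_
    have h1 : r < ‖x‖ := by
      rw [mem_ball_zero_iff, not_lt] at hx
      linarith
    filter_upwards [(isOpen_lt continuous_const continuous_norm).mem_nhds h1] with y hy
    exact cutPower_eq_zero hr0 (le_of_lt hy)

lemma norm_fderiv_cutPower_le (hε : 0 < ε) (hp : 0 ≤ p) {x : EuclideanSpace ℝ (Fin k)}
    (hw : DifferentiableAt ℝ w x) :
    ‖fderiv ℝ (cutPower w r p ε) x‖ ≤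
      8 * posPow 3 (r ^ 2 - ‖x‖ ^ 2) * ‖x‖ * (‖w x‖ ^ 2 / 2 + ε) ^ p +
        posPow 4 (r ^ 2 - ‖x‖ ^ 2) * (p * (‖w x‖ ^ 2 / 2 + ε) ^ (p - 1)) *
          (‖w x‖ * ‖fderiv ℝ w x‖) := by
  have h1 : HasFDerivAt (fun x : EuclideanSpace ℝ (Fin k) => r ^ 2 - ‖x‖ ^ 2)
      (-((2 : ℝ) • innerSL ℝ x)) x := by
    have := (hasStrictFDerivAt_norm_sq x).hasFDerivAt.const_sub (r ^ 2)
    simpa [two_smul] using this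
  have h2 := (hasDerivAt_posPow 2 (r ^ 2 - ‖x‖ ^ 2)).comp_hasFDerivAt x h1
  have h3 : HasFDerivAt (fun x => ‖w x‖ ^ 2 / 2 + ε) ((innerSL ℝ (w x)).comp (fderiv ℝ w x)) x := by
    have := ((hw.hasFDerivAt.norm_sq).mul_const (1 / 2 : ℝ)).add_const ε
    refine (this.congr_fderiv ?_).congr_of_eventuallyEq (Eventually.of_forall fun y => ?_)
    · ext v; simp
    · simp [div_eq_mul_inv]
  have h4 := h3.rpow_const (p := p) (Or.inl (by positivity))
  have h5 := (h2.mul h4).fderiv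
  have h6 : cutPower w r p ε =
      (posPow (2 + 2) ∘ fun x : EuclideanSpace ℝ (Fin k) => r ^ 2 - ‖x‖ ^ 2) *
        fun x => (‖w x‖ ^ 2 / 2 + ε) ^ p := rfl
  rw [h6, h5]
  have hs : 0 ≤ (‖w x‖ ^ 2 / 2 + ε) ^ p := by positivity
  have hs' : 0 ≤ (‖w x‖ ^ 2 / 2 + ε) ^ (p - 1) := by positivity
  have h3' := posPow_nonneg 3 (r ^ 2 - ‖x‖ ^ 2)
  have h4' := posPow_nonneg 4 (r ^ 2 - ‖x‖ ^ 2)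
  rw [add_comm (8 * _ * _ * _)]
  refine (norm_add_le _ _).trans (add_le_add ?_ ?_)
  · rw [norm_smul, norm_smul]
    simp only [Function.comp_apply]
    rw [Real.norm_of_nonneg h4', Real.norm_of_nonneg (mul_nonneg hp hs')]
    have h7 := ContinuousLinearMap.opNorm_comp_le (innerSL ℝ (w x)) (fderiv ℝ w x)
    rw [innerSL_apply_norm] at h7
    exact (mul_assoc _ _ _).symm.le.trans (mul_le_mul_of_nonneg_left h7 (by positivity))
  · rw [norm_smul, norm_smul, norm_neg, norm_smul, innerSL_apply_norm, Real.norm_of_nonneg hs,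
      Real.norm_of_nonneg (mul_nonneg (by norm_num) h3')]
    norm_num
    exact le_of_eq (by ring)

end CutPower

section Flow

variable {f : EuclideanSpace ℝ (Fin k) → ℝ → EuclideanSpace ℝ (Fin m)}
    {V : ℝ → Varifold (Ambient k m) k (cylinder k m 1)} {u : Ambient k m → ℝ → Ambient k m}
    {F E : ℝ} {g : EuclideanSpace ℝ (Fin k) → ℝ → EuclideanSpace ℝ (Fin m)}
    {A : Fin m → Fin k → Fin k → ℝ}

lemma qDist_eq_of_mem_graph {z : Ambient k m} {t : ℝ} (hz : z ∈ graphOverBall (fun x => f x t)) :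
    qDist g z t = ‖f (base z) t - g (base z) t‖ ^ 2 / 2 := by
  rw [qDist_eq, offset, hz.2]

lemma IsCaloric.contDiff_slice (hg : IsCaloric g A) (t : ℝ) : ContDiff ℝ 2 fun x => g x t := by
  rw [show (fun y => g y t) = fun y => g y 0 + t • traceTerm A from funext fun y => hg.time y t]
  exact hg.smooth.add contDiff_const

lemma IsGraphFlow.fderiv_sub (hf : IsGraphFlow f V u F E) (hg : IsCaloric g A) {t : ℝ}
    (ht : t ∈ Ioo (-1 : ℝ) 1) {x : EuclideanSpace ℝ (Fin k)} (hx : ‖x‖ < 1) :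
    DifferentiableAt ℝ (fun x => f x t - g x t) x ∧ fderiv ℝ (fun x => f x t - g x t) x =
      fderiv ℝ (fun x => f x t) x - fderiv ℝ (fun x => g x 0) x := by
  have h1 : DifferentiableAt ℝ (fun x => f x t) x :=
    (hf.diff t ht).differentiableAt (Metric.isOpen_ball.mem_nhds (by simpa using hx))
  have h2 : DifferentiableAt ℝ (fun x => g x t) x :=
    ((hg.contDiff_slice t).differentiable (by norm_num)).differentiableAt
  exact ⟨h1.sub h2, by rw [← hg.fderiv_eq t, ← fderiv_fun_sub h1 h2]⟩

/-- The integrand that dominates `cutPower` and its gradient. -/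
def cutMajorant (f g : EuclideanSpace ℝ (Fin k) → ℝ → EuclideanSpace ℝ (Fin m)) (r p ε t : ℝ)
    (x : EuclideanSpace ℝ (Fin k)) : ℝ≥0∞ :=
  (Metric.ball (0 : EuclideanSpace ℝ (Fin k)) r).indicator (fun x =>
    ENNReal.ofReal (9 * p * (‖f x t - g x t‖ ^ 2 / 2 + ε) ^ p) +
      ENNReal.ofReal (posPow 4 (r ^ 2 - ‖x‖ ^ 2) *
        (p * (‖f x t - g x t‖ ^ 2 / 2 + ε) ^ (p - 1)) * gradDiffSq f g x t)) x

lemma IsGraphFlow.measurable_gradDiffSq_slice (hf : IsGraphFlow f V u F E) (hg : IsCaloric g A)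
    (t : ℝ) : Measurable fun x => gradDiffSq f g x t := by
  have h := (hf.measurable_gradDiffSq hg).comp
    (measurable_prodMk_right (α := EuclideanSpace ℝ (Fin k)) (y := t))
  simpa only [Function.comp_def, Function.uncurry_apply_pair] using h

lemma IsGraphFlow.measurable_cutMajorant (hf : IsGraphFlow f V u F E) (hg : IsCaloric g A) {t : ℝ}
    (ht : t ∈ Ioo (-1 : ℝ) 1) {r p ε : ℝ} (hε : 0 < ε) (hr : r ≤ 1) :
    Measurable (cutMajorant f g r p ε t) := by
  have h1 : ContinuousOn (fun x => ‖f x t - g x t‖ ^ 2 / 2 + ε)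
      (Metric.ball (0 : EuclideanSpace ℝ (Fin k)) r) := by
    have h2 := ((hf.diff t ht).continuousOn).mono (Metric.ball_subset_ball hr)
    have h3 := (hg.contDiff_slice t).continuous
    fun_prop
  have hpow : ∀ a : ℝ, Measurable ((Metric.ball (0 : EuclideanSpace ℝ (Fin k)) r).indicator
      fun x => (‖f x t - g x t‖ ^ 2 / 2 + ε) ^ a) := by
    intro a
    have h2 : ContinuousOn (fun x => (‖f x t - g x t‖ ^ 2 / 2 + ε) ^ a)
      (Metric.ball (0 : EuclideanSpace ℝ (Fin k)) r) :=
        h1.rpow_const fun x _ => Or.inl (by positivity)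
    classical
    rw [← piecewise_eq_indicator]
    exact h2.measurable_piecewise continuousOn_const measurableSet_ball
  have hcut : Measurable fun x : EuclideanSpace ℝ (Fin k) => posPow 4 (r ^ 2 - ‖x‖ ^ 2) :=
    ((continuous_posPow 4).comp (by fun_prop)).measurable
  have h4 := ((((hpow p).const_mul (9 * p)).ennreal_ofReal).add
    (((hcut.mul ((hpow (p - 1)).const_mul p)).mul
      (hf.measurable_gradDiffSq_slice hg t)).ennreal_ofReal)).indicator
      (measurableSet_ball (x := (0 : EuclideanSpace ℝ (Fin k))) (ε := r))
  convert h4 using 1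
  ext1 x
  rw [cutMajorant]
  by_cases hx : x ∈ Metric.ball (0 : EuclideanSpace ℝ (Fin k)) r
  · rw [indicator_of_mem hx, indicator_of_mem hx]
    simp only [Pi.add_apply, Pi.mul_apply, indicator_of_mem hx]
  · rw [indicator_of_notMem hx, indicator_of_notMem hx]

end Flow

/-! ### One step of the iteration -/

section Flow

variable {f : EuclideanSpace ℝ (Fin k) → ℝ → EuclideanSpace ℝ (Fin m)}
    {V : ℝ → Varifold (Ambient k m) k (cylinder k m 1)} {u : Ambient k m → ℝ → Ambient k m}
    {F E : ℝ} {g : EuclideanSpace ℝ (Fin k) → ℝ → EuclideanSpace ℝ (Fin m)}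
    {A : Fin m → Fin k → Fin k → ℝ} {r p ε : ℝ}

lemma posPow_cut_le_one (n : ℕ) (hr0 : 0 ≤ r) (hr : r ≤ 1) (x : EuclideanSpace ℝ (Fin k)) :
    posPow n (r ^ 2 - ‖x‖ ^ 2) ≤ 1 :=
  pow_le_one₀ (le_max_right _ _) (max_le (by nlinarith [sq_nonneg ‖x‖]) zero_le_one)

lemma enorm_cutPower_le (hp : 1 ≤ p) (hε : 0 < ε) (hr0 : 0 ≤ r) (hr : r ≤ 1) (t : ℝ)
    (x : EuclideanSpace ℝ (Fin k)) :
    ‖cutPower (fun x => f x t - g x t) r p ε x‖ₑ ≤ cutMajorant f g r p ε t x := by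
  by_cases hx : x ∈ Metric.ball (0 : EuclideanSpace ℝ (Fin k)) r
  · rw [cutMajorant, indicator_of_mem hx, Real.enorm_of_nonneg (cutPower_nonneg hε x)]
    refine le_trans (ENNReal.ofReal_le_ofReal ?_) le_self_add
    have h1 : 0 ≤ (‖f x t - g x t‖ ^ 2 / 2 + ε) ^ p := by positivity
    rw [cutPower]
    nlinarith [posPow_cut_le_one 4 hr0 hr x]
  · rw [cutPower_eq_zero hr0 (by simpa using hx)]
    simp

lemma IsGraphFlow.enorm_fderiv_cutPower_le (hf : IsGraphFlow f V u F E) (hg : IsCaloric g A)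
    (hp : 1 ≤ p) (hε : 0 < ε) (hr0 : 0 ≤ r) (hr : r < 1) {t : ℝ} (ht : t ∈ Ioo (-1 : ℝ) 1)
    (x : EuclideanSpace ℝ (Fin k)) :
    ‖fderiv ℝ (cutPower (fun x => f x t - g x t) r p ε) x‖ₑ ≤ cutMajorant f g r p ε t x := by
  by_cases hx1 : ‖x‖ < 1
  swap
  · have h1 : x ∉ tsupport (cutPower (fun x => f x t - g x t) r p ε) := by
      intro h2
      have h3 : tsupport (cutPower (fun x => f x t - g x t) r p ε) ⊆ Metric.closedBall 0 r :=
        closure_minimal (fun y hy => by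
          rw [mem_closedBall_zero_iff]
          by_contra h
          exact hy (cutPower_eq_zero hr0 (not_le.1 h).le)) Metric.isClosed_closedBall
      have h4 := mem_closedBall_zero_iff.1 (h3 h2)
      linarith
    rw [show fderiv ℝ (cutPower (fun x => f x t - g x t) r p ε) x = 0 from
      Function.notMem_support.1 fun h => h1 (support_fderiv_subset ℝ h), ← ofReal_norm, norm_zero,
      ENNReal.ofReal_zero]
    exact zero_le
  obtain ⟨hd, hD⟩ := hf.fderiv_sub hg ht hx1
  have hle := norm_fderiv_cutPower_le (r := r) (p := p) hε (by linarith) hd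
  by_cases hx : x ∈ Metric.ball (0 : EuclideanSpace ℝ (Fin k)) r
  swap
  · have h1 : r ^ 2 - ‖x‖ ^ 2 ≤ 0 := by
      have : r ≤ ‖x‖ := by simpa using hx
      nlinarith
    rw [posPow_of_nonpos (by norm_num) h1, posPow_of_nonpos (by norm_num) h1] at hle
    have h2 : fderiv ℝ (cutPower (fun x => f x t - g x t) r p ε) x = 0 := by
      rw [← norm_le_zero_iff]
      simpa using hle
    rw [h2, ← ofReal_norm, norm_zero, ENNReal.ofReal_zero]
    exact zero_le
  rw [cutMajorant, indicator_of_mem hx, ← ofReal_norm, gradDiffSq_eq hx1 ht, ← hD]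
  set W := ‖f x t - g x t‖
  set D := fderiv ℝ (fun x => f x t - g x t) x
  have hs0 : 0 < W ^ 2 / 2 + ε := by positivity
  have hs : (W ^ 2 / 2 + ε) ^ p = (W ^ 2 / 2 + ε) ^ (p - 1) * (W ^ 2 / 2 + ε) := by
    rw [← Real.rpow_add_one hs0.ne', sub_add_cancel]
  have h1 := posPow_cut_le_one 3 hr0 hr.le x
  have h2 := posPow_cut_le_one 4 hr0 hr.le x
  have h3 := posPow_nonneg 3 (r ^ 2 - ‖x‖ ^ 2)
  have h4 := posPow_nonneg 4 (r ^ 2 - ‖x‖ ^ 2)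
  have h5 : W * ‖D‖ ≤ (W ^ 2 / 2 + ε) + gradNorm D ^ 2 := by
    have h6 := opNorm_le_gradNorm D
    have h7 := mul_le_mul_of_nonneg_left h6 (norm_nonneg (f x t - g x t))
    change W * ‖D‖ ≤ W * gradNorm D at h7
    nlinarith [sq_nonneg (W - gradNorm D), sq_nonneg (gradNorm D)]
  have hs' : 0 ≤ (W ^ 2 / 2 + ε) ^ (p - 1) := by positivity
  have hsp : 0 ≤ (W ^ 2 / 2 + ε) ^ p := by positivity
  rw [← ENNReal.ofReal_add (by positivity) (by positivity)]
  refine ENNReal.ofReal_le_ofReal (hle.trans ?_)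
  have h8 : 8 * posPow 3 (r ^ 2 - ‖x‖ ^ 2) * ‖x‖ * (W ^ 2 / 2 + ε) ^ p ≤
      8 * p * (W ^ 2 / 2 + ε) ^ p := by
    refine mul_le_mul_of_nonneg_right ?_ hsp
    have h9 : posPow 3 (r ^ 2 - ‖x‖ ^ 2) * ‖x‖ ≤ 1 := mul_le_one₀ h1 (norm_nonneg _) hx1.le
    linarith
  have h9 : posPow 4 (r ^ 2 - ‖x‖ ^ 2) * (p * (W ^ 2 / 2 + ε) ^ (p - 1)) * (W * ‖D‖) ≤
      posPow 4 (r ^ 2 - ‖x‖ ^ 2) * (p * (W ^ 2 / 2 + ε) ^ (p - 1)) *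
        ((W ^ 2 / 2 + ε) + gradNorm D ^ 2) := by gcongr
  have h10 : posPow 4 (r ^ 2 - ‖x‖ ^ 2) * (p * (W ^ 2 / 2 + ε) ^ p) ≤
      p * (W ^ 2 / 2 + ε) ^ p := mul_le_of_le_one_left (by positivity) h2
  rw [hs] at h8 h10 ⊢
  linarith

/-- The majorant of `cutPower` and of its gradient, integrated over the base, is controlled by the
two integrals over the graph that the energy inequality bounds. -/
lemma IsGraphFlow.lintegral_cutMajorant_le (hf : IsGraphFlow f V u F E) (hg : IsCaloric g A)
    (hp : 0 ≤ p) (hε : 0 < ε) (hr : r ≤ 1) {t : ℝ} (ht : t ∈ Ioo (-1 : ℝ) 1) :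
    ∫⁻ x, cutMajorant f g r p ε t x ≤
      ENNReal.ofReal (9 * p) * (∫⁻ z in base ⁻¹' Metric.ball 0 r,
        ENNReal.ofReal ((qDist g z t + ε) ^ p) ∂flowMeasure V t) +
      ∫⁻ z, ENNReal.ofReal (posPow 4 (r ^ 2 - ‖base z‖ ^ 2) * (p * (qDist g z t + ε) ^ (p - 1)) *
        gradDiffSq f g (base z) t) ∂flowMeasure V t := by
  have hball : ∫⁻ x, cutMajorant f g r p ε t x =
      ∫⁻ x in Metric.ball 0 1, cutMajorant f g r p ε t x := by
    rw [← lintegral_indicator measurableSet_ball]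
    refine lintegral_congr fun x => ?_
    by_cases hx : x ∈ Metric.ball (0 : EuclideanSpace ℝ (Fin k)) 1
    · rw [indicator_of_mem hx]
    · rw [indicator_of_notMem hx, cutMajorant,
        indicator_of_notMem fun h => hx (Metric.ball_subset_ball hr h)]
  rw [hball, flowMeasure_of_mem ht]
  refine (hf.lintegral_ball_le ht _).trans ?_
  have hm : Measurable fun z : Ambient k m => ENNReal.ofReal ((qDist g z t + ε) ^ p) := by
    have h1 := (hg.continuous_power hε p).comp (continuous_id.prodMk (continuous_const (y := t)))
    simp only [Function.comp_def, id] at h1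
    exact h1.measurable.ennreal_ofReal
  rw [← lintegral_const_mul _ hm, ← lintegral_indicator (measurable_base measurableSet_ball),
    ← lintegral_add_left ((hm.const_mul _).indicator (measurable_base measurableSet_ball))]
  refine lintegral_mono_ae ?_
  filter_upwards [hf.ae_mem_graph ht] with z hz
  by_cases hx : base z ∈ Metric.ball (0 : EuclideanSpace ℝ (Fin k)) r
  · rw [cutMajorant, indicator_of_mem hx, indicator_of_mem (by exact hx),
      qDist_eq_of_mem_graph hz, ENNReal.ofReal_mul (by positivity)]
  · rw [cutMajorant, indicator_of_notMem hx]
    exact zero_le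

lemma IsGraphFlow.measurable_setLIntegral (hf : IsGraphFlow f V u F E)
    {G : ℝ → Ambient k m → ℝ≥0∞} (hG : Measurable (Function.uncurry G)) {s : Set (Ambient k m)}
    (hs : MeasurableSet s) : Measurable fun t => ∫⁻ z in s, G t z ∂flowMeasure V t := by
  have h1 : Measurable (Function.uncurry fun t => s.indicator (G t)) := by
    have h2 := hG.indicator (measurable_snd (α := ℝ) hs)
    convert h2 using 1
    ext1 ⟨t, z⟩
    rfl
  simpa only [lintegral_indicator hs] using hf.measurable_lintegral h1

lemma ENNReal.le_ofReal_div_mul {X J : ℝ≥0∞} {b c : ℝ} (hc : 0 < c)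
    (h : ENNReal.ofReal c * X ≤ ENNReal.ofReal b * J) : X ≤ ENNReal.ofReal (b / c) * J := by
  have hc' : ENNReal.ofReal c ≠ 0 := by simpa using hc
  rw [ENNReal.ofReal_div_of_pos hc, ENNReal.div_eq_inv_mul, mul_assoc,
    ← ENNReal.div_eq_inv_mul, ENNReal.le_div_iff_mul_le (Or.inl hc') (Or.inl ENNReal.ofReal_ne_top),
    mul_comm X]
  exact h

lemma powInt_mono {τ τ' T T' : ℝ} (hτ : τ ≤ τ') (hT : T' ≤ T) (r p ε : ℝ) :
    powInt g V ε p r τ' T' ≤ powInt g V ε p r τ T :=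
  lintegral_mono_set (Ioo_subset_Ioo hτ hT)

/-- The energy inequality bounds the spatial integral of `cutPower`. -/
lemma IsGraphFlow.lintegral_cutPower_le (hf : IsGraphFlow f V u F E) (hg : IsCaloric g A)
    (hDg : ∀ x ∈ Metric.ball (0 : EuclideanSpace ℝ (Fin k)) 1,
      gradNorm (fderiv ℝ (fun y => g y 0) x) ≤ 1) (hε : 0 < ε)
    (hεE : E ^ 2 + (coeffNorm A * F ^ 2) ^ 2 ≤ ε) {τ t d : ℝ} (hp : 1 ≤ p) (hr0 : 0 < r)
    (hr : r < 1) (hd : 0 < d) (hτ : -1 < τ) (hdt : d ≤ t - τ) (ht : t < 1) :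
    ∫⁻ x, ‖cutPower (fun x => f x t - g x t) r p ε x‖ₑ ≤
      ENNReal.ofReal (energyConst k m * p / d ^ 2) * powInt g V ε p r τ t := by
  have htm : t ∈ Ioo (-1 : ℝ) 1 := ⟨by linarith, ht⟩
  have h1 := hf.energy_slice_le hg hDg hε hεE hp hr0 hr hτ (by linarith) ht
  refine ENNReal.le_ofReal_div_mul (by positivity) (le_trans ?_ h1)
  refine mul_le_mul' (ENNReal.ofReal_le_ofReal (by gcongr)) ?_
  have hball : ∫⁻ x, ‖cutPower (fun x => f x t - g x t) r p ε x‖ₑ =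
      ∫⁻ x in Metric.ball 0 1, ‖cutPower (fun x => f x t - g x t) r p ε x‖ₑ := by
    rw [← lintegral_indicator measurableSet_ball]
    refine lintegral_congr fun x => ?_
    by_cases hx : x ∈ Metric.ball (0 : EuclideanSpace ℝ (Fin k)) 1
    · rw [indicator_of_mem hx]
    · rw [indicator_of_notMem hx, cutPower_eq_zero hr0.le, enorm_zero]
      rw [mem_ball_zero_iff, not_lt] at hx
      linarith
  rw [hball, flowMeasure_of_mem htm]
  refine (hf.lintegral_ball_le htm _).trans (lintegral_mono_ae ?_)
  filter_upwards [hf.ae_mem_graph htm] with z hz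
  rw [Real.enorm_of_nonneg (cutPower_nonneg hε _), cutPower, qDist_eq_of_mem_graph hz]

/-- The energy inequality bounds the integral of the majorant over space and time; the distance `d`
to the initial time absorbs the weight `(t - τ)₊²`. -/
lemma IsGraphFlow.lintegral_lintegral_cutMajorant_le (hf : IsGraphFlow f V u F E)
    (hg : IsCaloric g A)
    (hDg : ∀ x ∈ Metric.ball (0 : EuclideanSpace ℝ (Fin k)) 1,
      gradNorm (fderiv ℝ (fun y => g y 0) x) ≤ 1) (hε : 0 < ε)
    (hεE : E ^ 2 + (coeffNorm A * F ^ 2) ^ 2 ≤ ε) {τ τ' T d : ℝ} (hp : 1 ≤ p) (hr0 : 0 < r)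
    (hr : r < 1) (hd : 0 < d) (hτ : -1 < τ) (hdτ : d ≤ τ' - τ) (hτT : τ' < T) (hT : T < 1) :
    ∫⁻ t in Ioo τ' T, ∫⁻ x, cutMajorant f g r p ε t x ≤
      ENNReal.ofReal (9 * p) * powInt g V ε p r τ T +
        ENNReal.ofReal (4 * (energyConst k m * p) / d ^ 2) * powInt g V ε p r τ T := by
  have hp0 : 0 ≤ p := by linarith
  have hsub : Ioo τ' T ⊆ Ioo τ T := Ioo_subset_Ioo (by linarith) le_rfl
  have hC := energyConst_pos k m
  have hm : Measurable fun t => ENNReal.ofReal (9 * p) * ∫⁻ z in base ⁻¹' Metric.ball 0 r,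
      ENNReal.ofReal ((qDist g z t + ε) ^ p) ∂flowMeasure V t := by
    have h1 := ((hg.continuous_power hε p).measurable.comp measurable_swap).ennreal_ofReal
    refine (hf.measurable_setLIntegral (G := fun t z => ENNReal.ofReal ((qDist g z t + ε) ^ p)) ?_
      (measurable_base measurableSet_ball)).const_mul _
    convert h1 using 1
    ext1 ⟨t, z⟩
    simp only [Function.uncurry_apply_pair, Function.comp_apply, Prod.swap_prod_mk]
  refine (setLIntegral_mono' measurableSet_Ioo fun t ht =>
    hf.lintegral_cutMajorant_le hg hp0 hε hr.le
      (show t ∈ Ioo (-1 : ℝ) 1 from ⟨by linarith [ht.1], ht.2.trans hT⟩)).trans ?_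
  rw [lintegral_add_left hm, lintegral_const_mul' _ _ ENNReal.ofReal_ne_top]
  refine add_le_add (mul_le_mul' le_rfl (lintegral_mono_set hsub)) ?_
  refine ENNReal.le_ofReal_div_mul (by positivity) ?_
  have h2 := hf.energy_good_le hg hDg hε hεE hp hr0 hr hτ (by linarith : τ < T) hT
  rw [ENNReal.ofReal_mul (by norm_num), show ENNReal.ofReal 4 = 4 by norm_num, mul_assoc]
  refine le_trans ?_ h2
  rw [← lintegral_const_mul' _ _ ENNReal.ofReal_ne_top]
  refine le_trans (setLIntegral_mono' measurableSet_Ioo fun t ht => ?_) (lintegral_mono_set hsub)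
  rw [← lintegral_const_mul' _ _ ENNReal.ofReal_ne_top]
  refine lintegral_mono fun z => ?_
  rw [← ENNReal.ofReal_mul (by positivity), goodTerm]
  refine ENNReal.ofReal_le_ofReal ?_
  have h3 := qDist_nonneg g z t
  have h4 := gradDiffSq_nonneg f g (base z) t
  have h5 := posPow_nonneg 4 (r ^ 2 - ‖base z‖ ^ 2)
  have h6 : d ^ 2 ≤ posPow 2 (t - τ) := by
    rw [posPow_of_nonneg _ (by linarith [ht.1])]
    have : d ≤ t - τ := by linarith [ht.1]
    gcongr
  have h7 : 0 ≤ posPow 4 (r ^ 2 - ‖base z‖ ^ 2) * (p * (qDist g z t + ε) ^ (p - 1)) *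
      gradDiffSq f g (base z) t := by positivity
  calc _ ≤ posPow 2 (t - τ) * (posPow 4 (r ^ 2 - ‖base z‖ ^ 2) *
      (p * (qDist g z t + ε) ^ (p - 1)) * gradDiffSq f g (base z) t) :=
        mul_le_mul_of_nonneg_right h6 h7
    _ = _ := by ring

/-- On the smaller ball the cut-off is at least `d⁴`, so that the `χ`-th power of `cutPower` controls
the integral of `(Q_g + ε)^{pχ}` over the graph; `2ᵏ` bounds the area factor of a `1`-Lipschitz graph. -/
lemma IsGraphFlow.setLIntegral_power_le (hf : IsGraphFlow f V u F E) (hε : 0 < ε) {χ r' t d : ℝ}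
    (hχ : 0 ≤ χ) (hd : 0 < d) (hr0 : 0 < r') (hdr : d ≤ r ^ 2 - r' ^ 2)
    (ht : t ∈ Ioo (-1 : ℝ) 1) :
    ENNReal.ofReal (d ^ 4) ^ χ * ∫⁻ z in base ⁻¹' Metric.ball 0 r',
        ENNReal.ofReal ((qDist g z t + ε) ^ (p * χ)) ∂flowMeasure V t ≤
      2 ^ k * ∫⁻ x, ‖cutPower (fun x => f x t - g x t) r p ε x‖ₑ ^ χ := by
  rw [← lintegral_const_mul' _ _ (ENNReal.rpow_ne_top_of_nonneg hχ ENNReal.ofReal_ne_top),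
    ← lintegral_indicator (measurable_base measurableSet_ball), flowMeasure_of_mem ht]
  refine (hf.lintegral_mass_le ht _).trans (mul_le_mul' le_rfl ?_)
  refine (setLIntegral_mono' measurableSet_ball fun x hx => ?_).trans
    (setLIntegral_le_lintegral (Metric.ball 0 1) _)
  by_cases hx' : x ∈ Metric.ball (0 : EuclideanSpace ℝ (Fin k)) r'
  swap
  · rw [indicator_of_notMem (by simpa using hx')]
    exact zero_le
  rw [indicator_of_mem (by simpa using hx')]
  have hz : joinPt x (f x t) ∈ graphOverBall (fun x => f x t) := by
    refine ⟨by simpa using hx, by simp⟩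
  have hs : 0 < ‖f x t - g x t‖ ^ 2 / 2 + ε := by positivity
  rw [qDist_eq_of_mem_graph hz, base_joinPt, Real.rpow_mul hs.le,
    ← ENNReal.ofReal_rpow_of_nonneg (by positivity) hχ, ← ENNReal.mul_rpow_of_nonneg _ _ hχ,
    ← ENNReal.ofReal_mul (by positivity), Real.enorm_of_nonneg (cutPower_nonneg hε _), cutPower]
  refine ENNReal.rpow_le_rpow (ENNReal.ofReal_le_ofReal ?_) hχ
  refine mul_le_mul_of_nonneg_right ?_ (by positivity)
  have h1 : ‖x‖ < r' := by simpa using hx'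
  have h2 : d ≤ r ^ 2 - ‖x‖ ^ 2 := by nlinarith [norm_nonneg x]
  rw [posPow_of_nonneg _ (by linarith)]
  gcongr

/-- One step of Moser's iteration: combining the two halves of the energy inequality with the
interpolation inequality raises the exponent by the factor `1 + 1 / (k + 1)`. -/
lemma IsGraphFlow.powInt_step (hf : IsGraphFlow f V u F E) (hk : 0 < k) (hg : IsCaloric g A)
    (hDg : ∀ x ∈ Metric.ball (0 : EuclideanSpace ℝ (Fin k)) 1,
      gradNorm (fderiv ℝ (fun y => g y 0) x) ≤ 1) (hε : 0 < ε)
    (hεE : E ^ 2 + (coeffNorm A * F ^ 2) ^ 2 ≤ ε) {r' τ τ' T d : ℝ} (hp : 1 ≤ p) (hr0 : 0 < r')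
    (hrr : r' ≤ r) (hr : r < 1) (hd : 0 < d) (hd1 : d ≤ 1) (hdr : d ≤ r ^ 2 - r' ^ 2) (hτ : -1 < τ)
    (hdτ : d ≤ τ' - τ) (hτT : τ' < T) (hT : T < 1) :
    powInt g V ε (p * (1 + 1 / ((k : ℝ) + 1))) r' τ' T ≤
      (ENNReal.ofReal (2 ^ k * (9 + 4 * energyConst k m) * p / d ^ 6) *
        powInt g V ε p r τ T) ^ (1 + 1 / ((k : ℝ) + 1)) := by
  set q : ℝ := 1 / ((k : ℝ) + 1) with hq
  have hq0 : 0 < q := by positivity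
  set J := powInt g V ε p r τ T with hJ
  have hC := energyConst_pos k m
  set K : ℝ := (9 + 4 * energyConst k m) * p / d ^ 2 with hK
  have hd2 : d ^ 2 ≤ 1 := pow_le_one₀ hd.le hd1
  set X : ℝ≥0∞ := ENNReal.ofReal (d ^ 4) with hX
  have hX0 : X ≠ 0 := (ENNReal.ofReal_pos.2 (by positivity)).ne'
  have hXt : X ≠ ∞ := ENNReal.ofReal_ne_top
  have hmain : X ^ (1 + q) * powInt g V ε (p * (1 + q)) r' τ' T ≤
      (ENNReal.ofReal (2 ^ k * K) * J) ^ (1 + q) := by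
    rw [powInt, ← lintegral_const_mul' _ _ (ENNReal.rpow_ne_top_of_nonneg (by positivity) hXt)]
    calc _ ≤ ∫⁻ t in Ioo τ' T, (2 ^ k * (ENNReal.ofReal K * J) ^ q) *
          ∫⁻ x, cutMajorant f g r p ε t x := by
          refine setLIntegral_mono' measurableSet_Ioo fun t ht => ?_
          have htm : t ∈ Ioo (-1 : ℝ) 1 := ⟨by linarith [ht.1], ht.2.trans hT⟩
          refine (hf.setLIntegral_power_le hε (by positivity) hd hr0 hdr htm).trans ?_
          rw [mul_assoc]
          refine mul_le_mul' le_rfl ((lintegral_rpow_le_mul_lintegral hk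
            (contDiff_cutPower hε (by linarith) hr (fun x hx => ?_) ?_)
            (hasCompactSupport_cutPower (by linarith))
            (hf.measurable_cutMajorant hg htm hε hr.le)
            (enorm_cutPower_le hp hε (by linarith) hr.le t)
            (hf.enorm_fderiv_cutPower_le hg hp hε (by linarith) hr htm)).trans
            (mul_le_mul' (ENNReal.rpow_le_rpow ?_ hq0.le) le_rfl))
          · exact (hf.fderiv_sub hg htm (by simpa using hx)).1.differentiableWithinAt
          · exact ((hf.cont_slice htm).sub
              (hg.smooth.continuous_fderiv (by norm_num)).continuousOn).congr fun x hx =>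
                (hf.fderiv_sub hg htm (by simpa using hx)).2
          · refine (hf.lintegral_cutPower_le hg hDg hε hεE hp (by linarith) hr hd hτ
              (by linarith [ht.1]) htm.2).trans (mul_le_mul' (ENNReal.ofReal_le_ofReal ?_)
              (powInt_mono le_rfl ht.2.le _ _ _))
            rw [hK]
            gcongr
            linarith
      _ = (2 ^ k * (ENNReal.ofReal K * J) ^ q) *
            ∫⁻ t in Ioo τ' T, ∫⁻ x, cutMajorant f g r p ε t x := by
          rw [lintegral_const_mul']
          exact ENNReal.mul_ne_top (by simp) (ENNReal.rpow_ne_top_of_nonneg hq0.le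
            (ENNReal.mul_ne_top ENNReal.ofReal_ne_top
              (hf.powInt_ne_top hg hε (by linarith) _ _ _)))
      _ ≤ (2 ^ k * (ENNReal.ofReal K * J) ^ q) * (ENNReal.ofReal K * J) := by
          refine mul_le_mul' le_rfl ((hf.lintegral_lintegral_cutMajorant_le hg hDg hε hεE hp
            (by linarith) hr hd hτ hdτ hτT hT).trans ?_)
          rw [← add_mul, ← ENNReal.ofReal_add (by positivity) (by positivity)]
          refine mul_le_mul' (ENNReal.ofReal_le_ofReal ?_) le_rfl
          rw [hK, add_mul, add_div]
          refine add_le_add ?_ (by rw [mul_assoc])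
          rw [le_div_iff₀ (by positivity)]
          exact mul_le_of_le_one_right (by positivity) hd2
      _ = 2 ^ k * (ENNReal.ofReal K * J) ^ (1 + q) := by
          rw [mul_assoc, add_comm, ENNReal.rpow_add_of_nonneg _ _ hq0.le zero_le_one,
            ENNReal.rpow_one]
      _ ≤ (2 ^ k : ℝ≥0∞) ^ (1 + q) * (ENNReal.ofReal K * J) ^ (1 + q) := by
          refine mul_le_mul' ?_ le_rfl
          calc (2 ^ k : ℝ≥0∞) = (2 ^ k : ℝ≥0∞) ^ (1 : ℝ) := (ENNReal.rpow_one _).symm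
            _ ≤ _ := ENNReal.rpow_le_rpow_of_exponent_le (one_le_pow₀ (by norm_num)) (by linarith)
      _ = _ := by
          rw [← ENNReal.mul_rpow_of_nonneg _ _ (by positivity), ← mul_assoc]
          congr 3
          rw [ENNReal.ofReal_mul (by positivity), ENNReal.ofReal_pow (by norm_num)]
          simp
  calc powInt g V ε (p * (1 + q)) r' τ' T =
        (X⁻¹) ^ (1 + q) * (X ^ (1 + q) * powInt g V ε (p * (1 + q)) r' τ' T) := by
        rw [← mul_assoc, ← ENNReal.mul_rpow_of_nonneg _ _ (by positivity),
          ENNReal.inv_mul_cancel hX0 hXt, ENNReal.one_rpow, one_mul]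
    _ ≤ (X⁻¹) ^ (1 + q) * (ENNReal.ofReal (2 ^ k * K) * J) ^ (1 + q) := mul_le_mul' le_rfl hmain
    _ = _ := by
        rw [← ENNReal.mul_rpow_of_nonneg _ _ (by positivity), ← mul_assoc, hX,
          ← ENNReal.ofReal_inv_of_pos (by positivity), ← ENNReal.ofReal_mul (by positivity)]
        congr 3
        rw [hK]
        field_simp

end Flow

/-! ### Moser's iteration and the mean value inequality -/

/-- Moser's iteration for a sequence of integrals. The prefactors on the left are chosen so that the
bound reproduces itself exactly under the recursion. -/
lemma iteration_le {a : ℕ → ℝ≥0∞} {C b : ℝ≥0∞} {n : ℕ} (hn : 0 < n)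
    (h : ∀ j, a (j + 1) ≤ (C * b ^ j * a j) ^ (1 + 1 / (n : ℝ))) (j : ℕ) :
    C ^ (n + 1) * b ^ (n * (n + 1)) * b ^ ((n + 1) * j) * a j ≤
      (C ^ (n + 1) * b ^ (n * (n + 1)) * a 0) ^ ((1 + 1 / (n : ℝ)) ^ j) := by
  have hn0 : (0 : ℝ) < n := by exact_mod_cast hn
  have hpow : ∀ y : ℝ≥0∞, (y ^ n) ^ (1 + 1 / (n : ℝ)) = y ^ (n + 1) := by
    intro y
    rw [← ENNReal.rpow_natCast, ← ENNReal.rpow_mul, ← ENNReal.rpow_natCast]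
    congr 1
    push_cast
    field_simp
  induction j with
  | zero => simp
  | succ j ih =>
    calc _ ≤ C ^ (n + 1) * b ^ (n * (n + 1)) * b ^ ((n + 1) * (j + 1)) *
          (C * b ^ j * a j) ^ (1 + 1 / (n : ℝ)) := mul_le_mul' le_rfl (h j)
      _ = (C * b ^ (n + 1 + j)) ^ (n + 1) * (C * b ^ j * a j) ^ (1 + 1 / (n : ℝ)) := by
        congr 1
        ring
      _ = ((C * b ^ (n + 1 + j)) ^ n * (C * b ^ j * a j)) ^ (1 + 1 / (n : ℝ)) := by
        rw [← hpow, ENNReal.mul_rpow_of_nonneg ((C * b ^ (n + 1 + j)) ^ n) _ (by positivity)]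
      _ = (C ^ (n + 1) * b ^ (n * (n + 1)) * b ^ ((n + 1) * j) * a j) ^ (1 + 1 / (n : ℝ)) := by
        congr 1
        ring
      _ ≤ ((C ^ (n + 1) * b ^ (n * (n + 1)) * a 0) ^ ((1 + 1 / (n : ℝ)) ^ j)) ^
          (1 + 1 / (n : ℝ)) := ENNReal.rpow_le_rpow ih (by positivity)
      _ = _ := by rw [← ENNReal.rpow_mul, ← pow_succ (1 + 1 / (n : ℝ)) j]

/-- Bounds on `L^p` norms that are uniform up to a constant factor give a pointwise bound for a
continuous function, as `p → ∞`. -/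
lemma le_of_lintegral_rpow_le {X : Type*} [TopologicalSpace X] [MeasurableSpace X] [BorelSpace X]
    {μ : Measure X} [μ.IsOpenPosMeasure] {s : Set X} (hs : IsOpen s) {h : X → ℝ≥0∞}
    (hh : ContinuousOn h s) {c M : ℝ≥0∞} (hc : c ≠ ∞) {p : ℕ → ℝ} (hp0 : ∀ j, 0 ≤ p j)
    (hp : Tendsto p atTop atTop) (hle : ∀ j, ∫⁻ x in s, h x ^ p j ∂μ ≤ c * M ^ p j) :
    ∀ x ∈ s, h x ≤ M := by
  intro x hx
  by_contra hlt
  obtain ⟨M', h1, h2⟩ := exists_between (not_le.1 hlt)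
  have hM'0 : M' ≠ 0 := (zero_le.trans_lt h1).ne'
  have hM't : M' ≠ ∞ := (h2.trans_le le_top).ne
  have hU : IsOpen (s ∩ h ⁻¹' Ioi M') := hh.isOpen_inter_preimage hs isOpen_Ioi
  have hpos : 0 < μ (s ∩ h ⁻¹' Ioi M') := hU.measure_pos μ ⟨x, hx, h2⟩
  have hρ : M / M' < 1 := by
    rw [ENNReal.div_lt_iff (Or.inl hM'0) (Or.inl hM't), one_mul]
    exact h1
  have hj : ∀ j, μ (s ∩ h ⁻¹' Ioi M') ≤ c * (M / M') ^ p j := by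
    intro j
    have h3 : M' ^ p j ≠ 0 := by
      simp [ENNReal.rpow_eq_zero_iff, hM'0, hM't]
    have h4 : M' ^ p j ≠ ∞ := ENNReal.rpow_ne_top_of_nonneg (hp0 j) hM't
    rw [← ENNReal.mul_le_mul_iff_left h3 h4, mul_assoc, ← ENNReal.mul_rpow_of_nonneg _ _ (hp0 j),
      ENNReal.div_mul_cancel hM'0 hM't]
    refine le_trans ?_ (hle j)
    calc μ (s ∩ h ⁻¹' Ioi M') * M' ^ p j = ∫⁻ _ in s ∩ h ⁻¹' Ioi M', M' ^ p j ∂μ := by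
          rw [setLIntegral_const, mul_comm]
      _ ≤ ∫⁻ x in s ∩ h ⁻¹' Ioi M', h x ^ p j ∂μ :=
          setLIntegral_mono' hU.measurableSet fun y hy =>
            ENNReal.rpow_le_rpow (le_of_lt hy.2) (hp0 j)
      _ ≤ _ := lintegral_mono_set inter_subset_left
  have hlim : Tendsto (fun j => c * (M / M') ^ p j) atTop (𝓝 (c * 0)) :=
    ENNReal.Tendsto.const_mul ((ENNReal.tendsto_rpow_atTop_of_base_lt_one hρ).comp hp)
      (Or.inr hc)
  rw [mul_zero] at hlim
  exact absurd (ge_of_tendsto' hlim hj) (not_le.2 hpos)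

/-- The constant in one step of the iteration. The factor `2 ^ 24 = 16 ^ 6` comes from the gaps
`d = 2⁻ʲ / 16` between consecutive radii and times, which enter to the power `-6`. -/
def stepConst (k m : ℕ) : ℝ≥0∞ := ENNReal.ofReal (2 ^ k * (9 + 4 * energyConst k m) * 2 ^ 24)

/-- The constant of the mean value inequality. The base `128 = 2 · 2 ^ 6` collects the growth of the
exponents, at most `2 ^ j`, and of the gaps to the power `-6`; the exponents `k + 2` and
`(k + 1) (k + 2)` are those of `iteration_le` with `n = k + 1`. -/
def meanConst (k m : ℕ) : ℝ≥0∞ := stepConst k m ^ (k + 2) * 128 ^ ((k + 1) * (k + 2))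

lemma one_le_meanConst (k m : ℕ) : 1 ≤ meanConst k m := by
  have h1 : 1 ≤ stepConst k m := by
    rw [stepConst, ENNReal.one_le_ofReal]
    have := energyConst_pos k m
    have h2 : (1 : ℝ) ≤ 2 ^ k := one_le_pow₀ (by norm_num)
    nlinarith
  exact one_le_mul (one_le_pow₀ h1) (one_le_pow₀ (by norm_num))

lemma meanConst_ne_top (k m : ℕ) : meanConst k m ≠ ∞ := by
  unfold meanConst stepConst
  exact ENNReal.mul_ne_top (ENNReal.pow_ne_top ENNReal.ofReal_ne_top)
    (ENNReal.pow_ne_top (by norm_num))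

section Flow

variable {f : EuclideanSpace ℝ (Fin k) → ℝ → EuclideanSpace ℝ (Fin m)}
    {V : ℝ → Varifold (Ambient k m) k (cylinder k m 1)} {u : Ambient k m → ℝ → Ambient k m}
    {F E : ℝ} {g : EuclideanSpace ℝ (Fin k) → ℝ → EuclideanSpace ℝ (Fin m)}
    {A : Fin m → Fin k → Fin k → ℝ} {ε : ℝ}

/-- Mean value inequality for `|f - g|²`. The iteration uses the exponents `χ ^ j`, the radii
`1/2 + 2⁻ʲ / 4` and the initial times `-3/4 - 2⁻ʲ / 8`, all with the final time `T`. At each `j` the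
energy inequality turns the integral over space and time into one at time `T`, over the half ball, so
that a limit `j → ∞` gives the bound at every point of that slice. -/
lemma IsGraphFlow.mean_value (hf : IsGraphFlow f V u F E) (hk : 0 < k) (hg : IsCaloric g A)
    (hDg : ∀ x ∈ Metric.ball (0 : EuclideanSpace ℝ (Fin k)) 1,
      gradNorm (fderiv ℝ (fun y => g y 0) x) ≤ 1) (hε : 0 < ε)
    (hεE : E ^ 2 + (coeffNorm A * F ^ 2) ^ 2 ≤ ε) {T : ℝ} (hT0 : -3 / 4 < T) (hT : T < 1) :
    ∀ x ∈ Metric.ball (0 : EuclideanSpace ℝ (Fin k)) (1 / 2),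
      ENNReal.ofReal (‖f x T - g x T‖ ^ 2 / 2 + ε) ≤
        meanConst k m * powInt g V ε 1 (3 / 4) (-7 / 8) T := by
  have hTm : T ∈ Ioo (-1 : ℝ) 1 := ⟨by linarith, hT⟩
  have hC := energyConst_pos k m
  set χ : ℝ := 1 + 1 / ((k : ℝ) + 1) with hχ
  have hχ1 : 1 < χ := by
    have : 0 < 1 / ((k : ℝ) + 1) := by positivity
    linarith
  have hχ2 : χ ≤ 2 := by
    have : 1 / ((k : ℝ) + 1) ≤ 1 := by
      rw [div_le_one (by positivity)]
      have : (0 : ℝ) ≤ k := by positivity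
      linarith
    linarith
  have hp1 : ∀ j : ℕ, 1 ≤ χ ^ j := fun j => one_le_pow₀ hχ1.le
  have hp2 : ∀ j : ℕ, χ ^ j ≤ 2 ^ j := fun j => pow_le_pow_left₀ (by linarith) hχ2 j
  -- `y j = 2⁻ʲ`
  let y : ℕ → ℝ := fun j => (1 / 2) ^ j
  have hy0 : ∀ j, 0 < y j := fun j => by positivity
  have hy1 : ∀ j, y j ≤ 1 := fun j => pow_le_one₀ (by norm_num) (by norm_num)
  have hys : ∀ j, y (j + 1) = y j / 2 := fun j => by simp only [y, pow_succ]; ring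
  have hy2 : ∀ j, 2 ^ j * y j = 1 := fun j => by simp only [y, ← mul_pow]; norm_num
  have hy7 : ∀ j, (2 : ℝ) ^ j = (128 : ℝ) ^ j * y j ^ 6 := fun j => by
    rw [show (128 : ℝ) = 2 * 2 ^ 6 by norm_num, mul_pow, ← pow_mul, mul_comm 6 j, pow_mul,
      mul_assoc, ← mul_pow, hy2, one_pow, mul_one]
  let a : ℕ → ℝ≥0∞ := fun j =>
    powInt g V ε (χ ^ j) (1 / 2 + y j / 4) (-3 / 4 - y j / 8) T
  have hstep : ∀ j, a (j + 1) ≤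
      (stepConst k m * 128 ^ j * a j) ^ (1 + 1 / (((k + 1 : ℕ) : ℝ))) := by
    intro j
    have h1 := hf.powInt_step hk hg hDg hε hεE (p := χ ^ j) (r := 1 / 2 + y j / 4)
      (r' := 1 / 2 + y (j + 1) / 4) (τ := -3 / 4 - y j / 8) (τ' := -3 / 4 - y (j + 1) / 8) (T := T)
      (d := y j / 16) (hp1 j) (by linarith [hy0 (j + 1)]) (by linarith [hys j, hy0 j])
      (by linarith [hy1 j]) (by linarith [hy0 j]) (by linarith [hy1 j])
      (by rw [hys]; nlinarith [hy0 j]) (by linarith [hy1 j]) (by linarith [hys j])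
      (by linarith [hy0 (j + 1)]) hT
    refine le_trans (by simp only [a, pow_succ, hχ]; exact h1) ?_
    push_cast
    refine ENNReal.rpow_le_rpow (mul_le_mul' ?_ le_rfl) (by positivity)
    rw [stepConst, show (128 : ℝ≥0∞) ^ j = ENNReal.ofReal (128 ^ j) by
      rw [ENNReal.ofReal_pow (by norm_num)]; norm_num, ← ENNReal.ofReal_mul (by positivity)]
    refine ENNReal.ofReal_le_ofReal ?_
    have h2 := hy0 j
    rw [div_le_iff₀ (by positivity)]
    calc 2 ^ k * (9 + 4 * energyConst k m) * χ ^ j ≤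
          2 ^ k * (9 + 4 * energyConst k m) * 2 ^ j := by gcongr
      _ = _ := by rw [hy7 j]; ring
  have hiter := iteration_le (Nat.succ_pos k) hstep
  have ha0 : a 0 = powInt g V ε 1 (3 / 4) (-7 / 8) T := by
    simp only [a, y, pow_zero]
    norm_num
  rw [← ha0]
  refine le_of_lintegral_rpow_le (μ := volume) Metric.isOpen_ball ?_
    (c := ENNReal.ofReal (energyConst k m * 2 ^ 14)) ENNReal.ofReal_ne_top
    (p := fun j => χ ^ j) (fun j => by positivity) (tendsto_pow_atTop_atTop_of_one_lt hχ1)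
    fun j => ?_
  · have h1 := ((hf.diff T hTm).continuousOn).mono (Metric.ball_subset_ball (x := 0)
      (by norm_num : (1 / 2 : ℝ) ≤ 1))
    have h2 := (hg.contDiff_slice T).continuous
    exact ENNReal.continuous_ofReal.comp_continuousOn (by fun_prop)
  have hy := hy0 j
  have h3 := hf.lintegral_cutPower_le hg hDg hε hεE (p := χ ^ j) (r := 1 / 2 + y j / 4)
    (τ := -3 / 4 - y j / 8) (t := T) (d := y j / 8) (hp1 j) (by linarith)
    (by linarith [hy1 j]) (by linarith) (by linarith [hy1 j]) (by linarith) hT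
  have h4 : ENNReal.ofReal ((y j / 4) ^ 4) *
      ∫⁻ x in Metric.ball (0 : EuclideanSpace ℝ (Fin k)) (1 / 2),
        ENNReal.ofReal (‖f x T - g x T‖ ^ 2 / 2 + ε) ^ (χ ^ j) ≤
      ∫⁻ x, ‖cutPower (fun x => f x T - g x T) (1 / 2 + y j / 4) (χ ^ j) ε x‖ₑ := by
    rw [← lintegral_const_mul' _ _ ENNReal.ofReal_ne_top]
    refine (setLIntegral_mono' measurableSet_ball fun x hx => ?_).trans
      (setLIntegral_le_lintegral (Metric.ball 0 (1 / 2)) _)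
    rw [ENNReal.ofReal_rpow_of_nonneg (by positivity) (by positivity),
      ← ENNReal.ofReal_mul (by positivity), Real.enorm_of_nonneg (cutPower_nonneg hε _), cutPower]
    refine ENNReal.ofReal_le_ofReal (mul_le_mul_of_nonneg_right ?_ (by positivity))
    have h5 : ‖x‖ < 1 / 2 := by simpa using hx
    have h6 : y j / 4 ≤ (1 / 2 + y j / 4) ^ 2 - ‖x‖ ^ 2 := by nlinarith [norm_nonneg x]
    rw [posPow_of_nonneg _ (by linarith)]
    gcongr
  have h5 := ENNReal.le_ofReal_div_mul (by positivity) (h4.trans h3)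
  have h6 : (128 : ℝ≥0∞) ^ j * a j ≤ (meanConst k m * a 0) ^ (χ ^ j) := by
    have h7 := hiter j
    push_cast at h7
    refine le_trans (mul_le_mul' ?_ le_rfl) h7
    have h8 := one_le_meanConst k m
    unfold meanConst at h8
    calc (128 : ℝ≥0∞) ^ j ≤ 128 ^ ((k + 1 + 1) * j) :=
          pow_le_pow_right₀ (by norm_num) (Nat.le_mul_of_pos_left j (by omega))
      _ ≤ _ := le_mul_of_one_le_left' h8
  refine h5.trans (le_trans ?_ (mul_le_mul' le_rfl h6))
  rw [← mul_assoc, show (128 : ℝ≥0∞) ^ j = ENNReal.ofReal (128 ^ j) by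
      rw [ENNReal.ofReal_pow (by norm_num)]; norm_num, ← ENNReal.ofReal_mul (by positivity)]
  refine mul_le_mul' (ENNReal.ofReal_le_ofReal ?_) le_rfl
  rw [div_le_iff₀ (by positivity), div_le_iff₀ (by positivity)]
  calc energyConst k m * χ ^ j ≤ energyConst k m * 2 ^ j := by gcongr
    _ = _ := by rw [hy7 j]; ring

end Flow

/-! ### Gradient estimate and conclusion -/

section Flow

variable {f : EuclideanSpace ℝ (Fin k) → ℝ → EuclideanSpace ℝ (Fin m)}
    {V : ℝ → Varifold (Ambient k m) k (cylinder k m 1)} {u : Ambient k m → ℝ → Ambient k m}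
    {F E : ℝ} {g : EuclideanSpace ℝ (Fin k) → ℝ → EuclideanSpace ℝ (Fin m)}
    {A : Fin m → Fin k → Fin k → ℝ} {ε : ℝ}

/-- The energy inequality with exponent `p = 1`: on the half ball and after time `-3/4` the weights
in the good term are bounded below by `(1/8)² (5/16)⁴`. -/
lemma IsGraphFlow.lintegral_gradDiffSq_le (hf : IsGraphFlow f V u F E) (hg : IsCaloric g A)
    (hDg : ∀ x ∈ Metric.ball (0 : EuclideanSpace ℝ (Fin k)) 1,
      gradNorm (fderiv ℝ (fun y => g y 0) x) ≤ 1) (hε : 0 < ε)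
    (hεE : E ^ 2 + (coeffNorm A * F ^ 2) ^ 2 ≤ ε) {T : ℝ} (hT0 : -3 / 4 < T) (hT : T < 1) :
    ∫⁻ t in Ioo (-3 / 4) T, ∫⁻ x in Metric.ball (0 : EuclideanSpace ℝ (Fin k)) (1 / 2),
        ENNReal.ofReal (gradDiffSq f g x t) ≤
      ENNReal.ofReal (32768 * energyConst k m) * powInt g V ε 1 (3 / 4) (-7 / 8) T := by
  have h1 := hf.energy_good_le hg hDg hε hεE (p := 1) (r := 3 / 4) (τ := -7 / 8) (T := T) le_rfl
    (by norm_num) (by norm_num) (by norm_num) (by linarith) hT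
  have h2 : ENNReal.ofReal (1 / 8192) * ∫⁻ t in Ioo (-3 / 4) T,
      ∫⁻ x in Metric.ball (0 : EuclideanSpace ℝ (Fin k)) (1 / 2),
        ENNReal.ofReal (gradDiffSq f g x t) ≤
      ENNReal.ofReal (4 * energyConst k m) * powInt g V ε 1 (3 / 4) (-7 / 8) T := by
    rw [mul_one, ← mul_assoc, show (4 : ℝ≥0∞) = ENNReal.ofReal 4 by norm_num,
      ← ENNReal.ofReal_mul (by norm_num)] at h1
    refine le_trans ?_ h1
    rw [← lintegral_const_mul' _ _ ENNReal.ofReal_ne_top]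
    refine le_trans (setLIntegral_mono' measurableSet_Ioo fun t ht => ?_)
      (lintegral_mono_set (Ioo_subset_Ioo (by norm_num) le_rfl))
    have htm : t ∈ Ioo (-1 : ℝ) 1 := ⟨by linarith [ht.1], ht.2.trans hT⟩
    have hball : ENNReal.ofReal (1 / 8192) *
        ∫⁻ x in Metric.ball (0 : EuclideanSpace ℝ (Fin k)) (1 / 2),
          ENNReal.ofReal (gradDiffSq f g x t) =
        ∫⁻ x in Metric.ball 0 1, (Metric.ball (0 : EuclideanSpace ℝ (Fin k)) (1 / 2)).indicator
          (fun x => ENNReal.ofReal (1 / 8192) * ENNReal.ofReal (gradDiffSq f g x t)) x := by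
      rw [← lintegral_const_mul' _ _ ENNReal.ofReal_ne_top, setLIntegral_indicator
        measurableSet_ball, inter_eq_left.2 (Metric.ball_subset_ball (by norm_num))]
    rw [hball, flowMeasure_of_mem htm]
    refine (hf.lintegral_ball_le htm _).trans (lintegral_mono fun z => ?_)
    by_cases hz : base z ∈ Metric.ball (0 : EuclideanSpace ℝ (Fin k)) (1 / 2)
    swap
    · rw [indicator_of_notMem hz]
      exact zero_le
    rw [indicator_of_mem hz, ← ENNReal.ofReal_mul (by norm_num), goodTerm, sub_self,
      Real.rpow_zero, mul_one, mul_one]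
    refine ENNReal.ofReal_le_ofReal (mul_le_mul_of_nonneg_right ?_ (gradDiffSq_nonneg f g _ _))
    have hb : ‖base z‖ < 1 / 2 := by simpa using hz
    have h3 : 5 / 16 ≤ (3 / 4 : ℝ) ^ 2 - ‖base z‖ ^ 2 := by nlinarith [norm_nonneg (base z)]
    have h4 : 1 / 8 ≤ t - -7 / 8 := by linarith [ht.1]
    rw [posPow_of_nonneg _ (by linarith), posPow_of_nonneg _ (by linarith)]
    calc (1 / 8192 : ℝ) ≤ (1 / 8) ^ 2 * (5 / 16) ^ 4 := by norm_num
      _ ≤ _ := by gcongr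
  have h5 := ENNReal.le_ofReal_div_mul (by norm_num) h2
  rwa [show 4 * energyConst k m / (1 / 8192) = 32768 * energyConst k m by ring] at h5

/-- With exponent `p = 1` the integral of `Q_g + ε` splits; the time interval has length `2` and each
slice has mass at most `massBound k`. -/
lemma IsGraphFlow.powInt_one_le (hf : IsGraphFlow f V u F E) (hε : 0 < ε)
    {r τ T : ℝ} (hτ : -1 ≤ τ) (hT : T ≤ 1) :
    powInt g V ε 1 r τ T ≤
      (∫⁻ t in Ioo (-1 : ℝ) 1, ∫⁻ z, ENNReal.ofReal (qDist g z t) ∂(V t).mass) +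
        ENNReal.ofReal (2 * massBound k * ε) := by
  have hsub : Ioo τ T ⊆ Ioo (-1 : ℝ) 1 := Ioo_subset_Ioo hτ hT
  have hM := massBound_nonneg k
  calc powInt g V ε 1 r τ T ≤ ∫⁻ t in Ioo (-1 : ℝ) 1, ∫⁻ z in base ⁻¹' Metric.ball 0 r,
        ENNReal.ofReal ((qDist g z t + ε) ^ (1 : ℝ)) ∂flowMeasure V t := lintegral_mono_set hsub
    _ ≤ ∫⁻ t in Ioo (-1 : ℝ) 1, ((∫⁻ z, ENNReal.ofReal (qDist g z t) ∂(V t).mass) +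
          ENNReal.ofReal (massBound k * ε)) := by
        refine setLIntegral_mono' measurableSet_Ioo fun t ht => ?_
        rw [flowMeasure_of_mem ht]
        refine (setLIntegral_le_lintegral _ _).trans ?_
        simp only [Real.rpow_one, ENNReal.ofReal_add (qDist_nonneg g _ _) hε.le]
        rw [lintegral_add_right _ measurable_const, lintegral_const]
        refine add_le_add le_rfl ?_
        rw [mul_comm (massBound k), ENNReal.ofReal_mul hε.le]
        exact mul_le_mul' le_rfl (hf.mass_univ_le ht)
    _ = _ := by
        rw [lintegral_add_right _ measurable_const, setLIntegral_const, Real.volume_Ioo,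
          ← ENNReal.ofReal_mul (by positivity)]
        congr 2
        ring

/-- The estimate with the error term `ε`. -/
lemma IsGraphFlow.sup_add_gradient_le (hf : IsGraphFlow f V u F E) (hk : 0 < k)
    (hg : IsCaloric g A)
    (hDg : ∀ x ∈ Metric.ball (0 : EuclideanSpace ℝ (Fin k)) 1,
      gradNorm (fderiv ℝ (fun y => g y 0) x) ≤ 1) (hε : 0 < ε)
    (hεE : E ^ 2 + (coeffNorm A * F ^ 2) ^ 2 ≤ ε) :
    supNorm (Metric.ball 0 (1 / 2)) (-3 / 4) 1 (fun x t => ‖f x t - g x t‖ ^ 2) +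
        ∫⁻ t in Ioo (-3 / 4 : ℝ) 1, ∫⁻ x in Metric.ball (0 : EuclideanSpace ℝ (Fin k)) (1 / 2),
          ENNReal.ofReal (gradNorm (fderiv ℝ (fun y => f y t) x -
            fderiv ℝ (fun y => g y t) x) ^ 2) ∂μHE[k] ≤
      (2 * meanConst k m + ENNReal.ofReal (32768 * energyConst k m)) *
        ((∫⁻ t in Ioo (-1 : ℝ) 1, ∫⁻ z, ENNReal.ofReal (qDist g z t) ∂(V t).mass) +
          ENNReal.ofReal (2 * massBound k * ε)) := by
  have hJ : ∀ T < 1, powInt g V ε 1 (3 / 4) (-7 / 8) T ≤ _ := fun T hT =>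
    hf.powInt_one_le hε (r := 3 / 4) (by norm_num : (-1 : ℝ) ≤ -7 / 8) hT.le
  rw [add_mul]
  refine add_le_add ?_ ?_
  · refine iSup₂_le fun x hx => iSup₂_le fun t ht => ?_
    have h1 := hf.mean_value hk hg hDg hε hεE ht.1 ht.2 x hx
    calc ENNReal.ofReal (‖f x t - g x t‖ ^ 2) ≤
          ENNReal.ofReal (2 * (‖f x t - g x t‖ ^ 2 / 2 + ε)) :=
            ENNReal.ofReal_le_ofReal (by linarith)
      _ = 2 * ENNReal.ofReal (‖f x t - g x t‖ ^ 2 / 2 + ε) := by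
            rw [ENNReal.ofReal_mul (by norm_num)]; norm_num
      _ ≤ 2 * (meanConst k m * _) := mul_le_mul' le_rfl (h1.trans (mul_le_mul' le_rfl (hJ t ht.2)))
      _ = _ := (mul_assoc _ _ _).symm
  · rw [EuclideanSpace.euclideanHausdorffMeasure_eq_volume]
    have h1 : ∫⁻ t in Ioo (-3 / 4 : ℝ) 1,
        ∫⁻ x in Metric.ball (0 : EuclideanSpace ℝ (Fin k)) (1 / 2),
          ENNReal.ofReal (gradNorm (fderiv ℝ (fun y => f y t) x -
            fderiv ℝ (fun y => g y t) x) ^ 2) =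
        ∫⁻ t in Ioo (-3 / 4 : ℝ) 1, ∫⁻ x in Metric.ball (0 : EuclideanSpace ℝ (Fin k)) (1 / 2),
          ENNReal.ofReal (gradDiffSq f g x t) := by
      refine setLIntegral_congr_fun measurableSet_Ioo fun t ht => ?_
      refine setLIntegral_congr_fun measurableSet_ball fun x hx => ?_
      have hx' : ‖x‖ < 1 / 2 := by simpa using hx
      rw [gradDiffSq_eq (by linarith) ⟨by linarith [ht.1], ht.2⟩, hg.fderiv_eq t]
    have hU : Ioo (-3 / 4 : ℝ) 1 = ⋃ n : ℕ, Ioo (-3 / 4 : ℝ) (1 - 1 / (n + 1)) := by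
      ext t
      simp only [mem_iUnion, mem_Ioo, exists_and_left]
      refine and_congr_right fun _ => ⟨fun ht => ?_, fun ⟨n, hn⟩ => ?_⟩
      · obtain ⟨n, hn⟩ := exists_nat_one_div_lt (sub_pos.2 ht)
        exact ⟨n, by linarith⟩
      · have : (0 : ℝ) < 1 / (n + 1) := by positivity
        linarith
    have hdir : Directed (· ⊆ ·) fun n : ℕ => Ioo (-3 / 4 : ℝ) (1 - 1 / (n + 1)) :=
      Monotone.directed_le fun a b hab => Ioo_subset_Ioo le_rfl (by gcongr)
    rw [h1, hU, setLIntegral_iUnion_of_directed _ hdir]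
    refine iSup_le fun n => ?_
    have hn : (0 : ℝ) < 1 / (n + 1) := by positivity
    rcases lt_or_ge (-3 / 4 : ℝ) (1 - 1 / (n + 1)) with h | h
    · exact (hf.lintegral_gradDiffSq_le hg hDg hε hεE h (by linarith)).trans
        (mul_le_mul' le_rfl (hJ _ (by linarith)))
    · rw [Ioo_eq_empty_of_le h]
      simp

end Flow

lemma le_of_supNorm_le {X : Type*} {S : Set X} {a b : ℝ} {G : X → ℝ → ℝ}
    (h : supNorm S a b G ≤ 1) {x : X} (hx : x ∈ S) {t : ℝ} (ht : t ∈ Ioo a b) :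
    G x t ≤ (supNorm S a b G).toReal := by
  rw [← ENNReal.ofReal_le_iff_le_toReal (h.trans_lt ENNReal.one_lt_top).ne]
  exact le_iSup₂_of_le x hx (le_iSup₂_of_le t ht le_rfl)

lemma toReal_supNorm_le {X : Type*} {S : Set X} {a b : ℝ} {G : X → ℝ → ℝ}
    (h : supNorm S a b G ≤ 1) : (supNorm S a b G).toReal ≤ 1 :=
  ENNReal.toReal_le_of_le_ofReal zero_le_one (by simpa using h)

lemma coeffNorm_nonneg (A : Fin m → Fin k → Fin k → ℝ) : 0 ≤ coeffNorm A := Real.sqrt_nonneg _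

lemma IsCaloric.supNorm_hessNorm {g : EuclideanSpace ℝ (Fin k) → ℝ → EuclideanSpace ℝ (Fin m)}
    {A : Fin m → Fin k → Fin k → ℝ} (hg : IsCaloric g A) :
    supNorm (Metric.ball 0 1) (-1) 1 (fun x t => hessNorm (fun y => g y t) x) =
      ENNReal.ofReal (coeffNorm A) := by
  refine le_antisymm (iSup₂_le fun x _ => iSup₂_le fun t _ => (congrArg ENNReal.ofReal (hg.hess x t)).le) ?_
  refine le_iSup₂_of_le 0 (by simp) (le_iSup₂_of_le 0 (by norm_num)
    (congrArg ENNReal.ofReal (hg.hess 0 0)).ge)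

end BrakkeFlow

end

open BrakkeFlow in
theorem proposition4p2 (k m : ℕ) (hk : 0 < k) (hm : 0 < m) :
    ∃ c₂ : ℝ, 0 < c₂ ∧
      ∀ (f : EuclideanSpace ℝ (Fin k) → ℝ → EuclideanSpace ℝ (Fin m))
        (g : EuclideanSpace ℝ (Fin k) → ℝ → EuclideanSpace ℝ (Fin m))
        (V : ℝ → Varifold (Ambient k m) k (cylinder k m 1))
        (u : Ambient k m → ℝ → Ambient k m),
        -- the spatial gradient of `f` exists and is continuous on `B₁ᵏ × (-1,1)`
        (∀ t ∈ Ioo (-1 : ℝ) 1, DifferentiableOn ℝ (fun x => f x t) (Metric.ball 0 1)) →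
        ContinuousOn
          (fun p : EuclideanSpace ℝ (Fin k) × ℝ => fderiv ℝ (fun x => f x p.2) p.1)
          (Metric.ball 0 1 ×ˢ Ioo (-1 : ℝ) 1) →
        -- `V_t = |graph f(·,t)|` satisfies (B1) and (B4) on `C(T,1) × (-1,1)`
        (∀ t ∈ Ioo (-1 : ℝ) 1, (V t).IsNaturalVarifold (graphOverBall fun x => f x t)) →
        SatisfiesB1 (Ioo (-1 : ℝ) 1) V →
        SatisfiesB4 (Ioo (-1 : ℝ) 1) V u →
        CaloricQuadratic g →
        supNorm (Metric.ball 0 1) (-1) 1 (fun x t => gradNorm (fderiv ℝ (fun y => f y t) x)) ≤ 1 →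
        supNorm (Metric.ball 0 1) (-1) 1 (fun x t => gradNorm (fderiv ℝ (fun y => g y t) x)) ≤ 1 →
        supNorm (cylinder k m 1) (-1) 1 (fun z t => ‖u z t‖) ≤ 1 →
        supNorm (Metric.ball 0 (1 / 2)) (-3 / 4) 1 (fun x t => ‖f x t - g x t‖ ^ 2) +
            ∫⁻ t in Ioo (-3 / 4 : ℝ) 1,
              ∫⁻ x in Metric.ball (0 : EuclideanSpace ℝ (Fin k)) (1 / 2),
                ENNReal.ofReal (gradNorm (fderiv ℝ (fun y => f y t) x -
                  fderiv ℝ (fun y => g y t) x) ^ 2) ∂μHE[k] ≤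
          ENNReal.ofReal c₂ *
            ((∫⁻ t in Ioo (-1 : ℝ) 1, ∫⁻ z, ENNReal.ofReal (qDist g z t) ∂(V t).mass) +
              supNorm (cylinder k m 1) (-1) 1 (fun z t => ‖u z t‖) ^ 2 +
              supNorm (Metric.ball 0 1) (-1) 1
                  (fun x t => gradNorm (fderiv ℝ (fun y => f y t) x)) ^ 4 *
                supNorm (Metric.ball 0 1) (-1) 1 (fun x t => hessNorm (fun y => g y t) x) ^ 2) := by
  have hC := energyConst_pos k m
  have hM := massBound_nonneg k
  set B : ℝ≥0∞ := 2 * meanConst k m + ENNReal.ofReal (32768 * energyConst k m) with hB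
  have hBt : B ≠ ∞ := ENNReal.add_ne_top.2
    ⟨ENNReal.mul_ne_top (by norm_num) (meanConst_ne_top k m), ENNReal.ofReal_ne_top⟩
  -- `1 + 2 * massBound k` accounts for the integral of `ε` over the flow, `+ 1` for positivity.
  refine ⟨B.toReal * (1 + 2 * massBound k) + 1, by positivity, ?_⟩
  intro f g V u hd hc hnat _ hb4 hcal hfs hgs hus
  obtain ⟨A, hg⟩ := hcal.exists_isCaloric
  set SF := supNorm (Metric.ball 0 1) (-1) 1 (fun x t => gradNorm (fderiv ℝ (fun y => f y t) x))
  set SU := supNorm (cylinder k m 1) (-1) 1 (fun z t => ‖u z t‖)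
  have hf : IsGraphFlow f V u SF.toReal SU.toReal :=
    ⟨hd, hc, hnat, hb4, fun t ht x hx => le_of_supNorm_le hfs hx ht, toReal_supNorm_le hfs,
      fun t ht z hz => le_of_supNorm_le hus hz ht, toReal_supNorm_le hus⟩
  have hDg : ∀ x ∈ Metric.ball (0 : EuclideanSpace ℝ (Fin k)) 1,
      gradNorm (fderiv ℝ (fun y => g y 0) x) ≤ 1 := fun x hx =>
    (le_of_supNorm_le hgs hx (by norm_num : (0 : ℝ) ∈ Ioo (-1 : ℝ) 1)).trans (toReal_supNorm_le hgs)
  set P := ∫⁻ t in Ioo (-1 : ℝ) 1, ∫⁻ z, ENNReal.ofReal (qDist g z t) ∂(V t).mass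
  -- The estimate holds with `ε = e + δ` for every `δ > 0`; the addition of `δ` keeps `Q_g + ε` positive
  -- also when `u` vanishes and `∇f = 0` or `∇²g = 0`.
  set e : ℝ := SU.toReal ^ 2 + (coeffNorm A * SF.toReal ^ 2) ^ 2 with he
  have he0 : 0 ≤ e := by positivity
  have hlim : Tendsto (fun δ : ℝ => B * (P + ENNReal.ofReal (2 * massBound k * (e + δ)))) (𝓝[>] 0)
      (𝓝 (B * (P + ENNReal.ofReal (2 * massBound k * e)))) := by
    refine ENNReal.Tendsto.const_mul (Tendsto.const_add P ?_) (Or.inr hBt)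
    refine (ENNReal.continuous_ofReal.tendsto _).comp ?_
    have h1 : Continuous fun δ : ℝ => 2 * massBound k * (e + δ) := by fun_prop
    simpa using (h1.tendsto 0).mono_left nhdsWithin_le_nhds
  refine (ge_of_tendsto hlim (Eventually.mono self_mem_nhdsWithin fun δ (hδ : 0 < δ) =>
    hf.sup_add_gradient_le hk hg hDg (ε := e + δ) (by linarith) (by linarith))).trans ?_
  have hSU : ENNReal.ofReal SU.toReal = SU :=
    ENNReal.ofReal_toReal (hus.trans_lt ENNReal.one_lt_top).ne
  have hSF : ENNReal.ofReal SF.toReal = SF :=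
    ENNReal.ofReal_toReal (hfs.trans_lt ENNReal.one_lt_top).ne
  have he' : ENNReal.ofReal e = SU ^ 2 + SF ^ 4 *
      supNorm (Metric.ball 0 1) (-1) 1 (fun x t => hessNorm (fun y => g y t) x) ^ 2 := by
    have hA := coeffNorm_nonneg A
    rw [he, ENNReal.ofReal_add (by positivity) (by positivity), hg.supNorm_hessNorm,
      ENNReal.ofReal_pow ENNReal.toReal_nonneg, hSU, mul_pow, ← pow_mul, mul_comm,
      ENNReal.ofReal_mul (by positivity), ENNReal.ofReal_pow ENNReal.toReal_nonneg, hSF,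
      ENNReal.ofReal_pow hA]
  rw [add_assoc, ← he', ENNReal.ofReal_mul (by positivity)]
  calc B * (P + ENNReal.ofReal (2 * massBound k) * ENNReal.ofReal e) ≤
        B * (ENNReal.ofReal (1 + 2 * massBound k) * (P + ENNReal.ofReal e)) := by
        refine mul_le_mul' le_rfl ?_
        rw [mul_add]
        refine add_le_add (le_mul_of_one_le_left' ?_)
          (mul_le_mul' (ENNReal.ofReal_le_ofReal (by linarith)) le_rfl)
        rw [ENNReal.one_le_ofReal]
        linarith
    _ = ENNReal.ofReal (B.toReal * (1 + 2 * massBound k)) * (P + ENNReal.ofReal e) := by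
        rw [← mul_assoc, ENNReal.ofReal_mul ENNReal.toReal_nonneg, ENNReal.ofReal_toReal hBt]
    _ ≤ _ := mul_le_mul' (ENNReal.ofReal_le_ofReal (by linarith)) le_rfl
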